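/- Let $h,w\in\mathbb C$. Power series are meant where a denominator $h$ or $w$ may vanish: $\frac{\sinh(hE)}{h}=\sum_k \frac{h^{2k}E^{2k+1}}{(2k+1)!}$, $\frac{e^{wA^+}-1}{w}=\sum_k\frac{w^k(A^+)^{k+1}}{(k+1)!}$, $\frac{1-e^{-wA^+}}{w}=\sum_k\frac{(-w)^k(A^+)^{k+1}}{(k+1)!}$. Let $\mathcal U=\mathcal U_{h,w}(\mathcal H(4))$ be the complete unital associative $\mathbb C$-algebra generated by $N,E,A^+,A$ with the relations $$[A,A^+]=\frac{\sinh(hE)}{h}e^{wA^+},\quad [N,A^+]=\frac{e^{wA^+}-1}{w},\quad [N,A]=-A,\quad [E,\cdot\,]=0,$$ complete in the topology of the powers of the two-sided ideal $J$ generated by $E$ and $A^+$, that is $\mathcal U=\varprojlim_m \mathcal U_m$ with $\mathcal U_m=\mathcal U/J^m$ the algebra on the same generators and relations in which every word with at least $m$ letters $E$ or $A^+$ is zero; tensor products are completed, $\mathcal U\hat\otimes\mathcal U=\varprojlim_m \mathcal U_m\otimes\mathcal U_m$, etc. Let $$\mathcal F=e^{wN\otimes A^+},\qquad \mathcal R^h=e^{-2hE\otimes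 N}\exp\Bigl(2h\,e^{hE}A\otimes\frac{1-e^{-wA^+}}{w}\Bigr),\qquad \mathcal R^{h,w}=\mathcal F_{21}^{-1}\mathcal R^h\mathcal F .$$ **Proposition.** (a) $\mathcal U$ is a (complete) Hopf algebra, with continuous coproduct, counit and antipode such that $\varepsilon$ vanishes on the four generators, $E$ and $A^+$ are primitive, $S(E)=-E$, $S(A^+)=-A^+$, $$\Delta(N)=N\otimes e^{wA^+}+1\otimes N,\qquad S(N)=-Ne^{-wA^+},$$ $$\Delta(A)=A\otimes e^{hE}e^{wA^+}+e^{-hE}\otimes A+w\,e^{-hE}N\otimes\frac{\sinh(hE)}{h}e^{wA^+},\qquad S(A)=-Ae^{-wA^+}+wN\frac{\sinh(hE)}{h}e^{-wA^+}.$$ It is quasitriangular with universal $R$-matrix $\mathcal R=\mathcal R^{h,w}$: $\mathcal R$ is invertible, $\mathcal R\Delta(a)\mathcal R^{-1}=\sigma\Delta(a)$ for all $a$ ($\sigma$ the flip), $(\Delta\otimes\mathrm{id})\mathcal R=\mathcal R_{13}\mathcal R_{23}$ and $(\mathrm{id}\otimes\Delta)\mathcal R=\mathcal R_{13}\mathcal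 R_{12}$. It is a ribbon Hopf algebra: the series $$\theta_{h,w}=e^{-hE}\sum_{l\ge0}\frac{(-1)^l(2h)^l}{l!}e^{-hlE}\Bigl(\frac{1-e^{-wA^+}}{w}\Bigr)^lA^le^{2hEN}$$ converges, is central and invertible with inverse the convergent series $$\theta_{h,w}^{-1}=e^{hE}\sum_{l\ge0}\frac{(2h)^l}{l!}e^{hlE}\Bigl(\frac{1-e^{-wA^+}}{w}\Bigr)^lA^le^{-2hEN},$$ and, with $u=m(S\otimes\mathrm{id})(\mathcal R_{21})$, $$\theta^2=uS(u),\quad S(\theta)=\theta,\quad \Delta(\theta)=(\mathcal R_{21}\mathcal R)^{-1}(\theta\otimes\theta),\quad\varepsilon(\theta)=1\qquad(\theta=\theta_{h,w}).$$ (b) Let $e,n\in\mathbb C$, let $\gamma$ be a square root of $\frac{\sinh(he)}{h}$ (of $e$ if $h=0$), and let $\pi_{e,n}$ be given on the space of formal series $\sum_{r\ge0}v_r|r\rangle$, with coordinatewise convergence, by $E|r\rangle=e|r\rangle$, $N|r\rangle=(r+n)|r\rangle$, $A|r\rangle=\gamma\sqrt r\,|r-1\rangle$ and $$A^+|r\rangle=\sum_{k\ge0}\frac{w^k}{k+1}\gamma^{k+1}\sqrt{\frac{(r+k+1)!}{r!}}\;|r+k+1\rangle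 .$$ These operators satisfy the defining relations of $\mathcal U$, and the above series for $\theta_{h,w}$ and $\theta_{h,w}^{-1}$, evaluated at these operators, converge pointwise to the scalars $e^{(2n-1)he}$ and $e^{-(2n-1)he}$ respectively, which do not depend on $w$. -/

import Mathlib

open scoped TensorProduct Nat

namespace HeisenbergDeformation

noncomputable section

/-- The generators `N`, `E`, `A⁺`, `A`. -/
inductive Gen : Type
  | N : Gen
  | E : Gen
  | Ap : Gen
  | A : Gen

/-! ### Convergent series in a topological algebra

Everywhere below a series is the sum of its terms in the topology of the algebra at hand. -/

section Series

variable {B : Type} [Ring B] [Algebra ℂ B] [TopologicalSpace B]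

/-- `e ^ x`. -/
def fexp (x : B) : B := ∑' k : ℕ, ((k ! : ℂ)⁻¹) • x ^ k

/-- `sinh (h x) / h`, as a power series in `x` (so that its value for `h = 0` is `x`). -/
def sinhDiv (h : ℂ) (x : B) : B := ∑' k : ℕ, (h ^ (2 * k) / ((2 * k + 1)! : ℂ)) • x ^ (2 * k + 1)

/-- `(e ^ (w x) - 1) / w`, as a power series in `x` (so that its value for `w = 0` is `x`). -/
def expSubOneDiv (w : ℂ) (x : B) : B := ∑' k : ℕ, (w ^ k / ((k + 1)! : ℂ)) • x ^ (k + 1)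

/-- `(1 - e ^ (-w x)) / w`, which is `(e ^ (w' x) - 1) / w'` for `w' = -w`. -/
def oneSubExpNegDiv (w : ℂ) (x : B) : B := expSubOneDiv (-w) x

/-- The elements `g .N`, `g .E`, `g .Ap`, `g .A` satisfy the defining commutation relations of the
two parametric deformation `U_{h,w}(H(4))`. -/
structure Relations (h w : ℂ) (g : Gen → B) : Prop where
  comm_A_Ap : g .A * g .Ap - g .Ap * g .A = sinhDiv h (g .E) * fexp (w • g .Ap)
  comm_N_Ap : g .N * g .Ap - g .Ap * g .N = expSubOneDiv w (g .Ap)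
  comm_N_A : g .N * g .A - g .A * g .N = -g .A
  comm_E : ∀ x, g .E * g x = g x * g .E

/-- `θ = e^{-hE} ∑_{l ≥ 0} ((-1)^l (2h)^l / l!) e^{-hlE} ((1 - e^{-wA⁺}) / w)^l A^l e^{2hEN}`,
the series being convergent. -/
def IsTheta (h w : ℂ) (g : Gen → B) (θ : B) : Prop :=
  ∃ s : B, HasSum (fun l : ℕ => ((-1) ^ l * (2 * h) ^ l / (l ! : ℂ)) •
      (fexp (-((h * l) • g .E)) * oneSubExpNegDiv w (g .Ap) ^ l * g .A ^ l *
        fexp ((2 * h) • (g .E * g .N)))) s ∧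
    θ = fexp (-(h • g .E)) * s

/-- `θ⁻¹ = e^{hE} ∑_{l ≥ 0} ((2h)^l / l!) e^{hlE} ((1 - e^{-wA⁺}) / w)^l A^l e^{-2hEN}`,
the series being convergent. -/
def IsThetaInv (h w : ℂ) (g : Gen → B) (θ : B) : Prop :=
  ∃ s : B, HasSum (fun l : ℕ => ((2 * h) ^ l / (l ! : ℂ)) •
      (fexp ((h * l) • g .E) * oneSubExpNegDiv w (g .Ap) ^ l * g .A ^ l *
        fexp (-((2 * h) • (g .E * g .N))))) s ∧
    θ = fexp (h • g .E) * s

end Series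

/-! ### Complete algebras as inverse limits, and completed tensor products -/

/-- An inverse system of `ℂ`-algebras. -/
structure Tower where
  obj : ℕ → Type
  [ring : ∀ m, Ring (obj m)]
  [alg : ∀ m, Algebra ℂ (obj m)]
  map : ∀ m, obj (m + 1) →ₐ[ℂ] obj m

attribute [instance] Tower.ring Tower.alg

namespace Tower

/-- The inverse limit: the compatible sequences. -/
def limit (T : Tower) : Subalgebra ℂ (∀ m, T.obj m) where
  carrier := {x | ∀ m, T.map m (x (m + 1)) = x m}
  mul_mem' := by intro a b ha hb m; simp [ha m, hb m]
  add_mem' := by intro a b ha hb m; simp [ha m, hb m]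
  algebraMap_mem' := by intro r m; simp

/-- The complete algebra of an inverse system. -/
abbrev Lim (T : Tower) : Type := T.limit

/-- The inverse limit topology, every `T.obj m` being discrete. -/
instance (T : Tower) : TopologicalSpace T.Lim :=
  ⨅ m : ℕ, TopologicalSpace.induced (fun x : T.Lim => x.1 m) ⊥

/-- A compatible family of homomorphisms induces a homomorphism of the limits. -/
def mapLim {T T' : Tower} (f : ∀ m, T.obj m →ₐ[ℂ] T'.obj m)
    (hf : ∀ m x, T'.map m (f (m + 1) x) = f m (T.map m x)) : T.Lim →ₐ[ℂ] T'.Lim :=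
  AlgHom.codRestrict
    ((AlgHom.pi fun m => (f m).comp (Pi.evalAlgHom ℂ T.obj m)).comp T.limit.val) T'.limit
    (by intro x m; simpa [hf] using congrArg (f m) (x.2 m))

/-- The inverse system whose limit `(T.tensor T').Lim` is the completed tensor product of
`T.Lim` and `T'.Lim`. -/
@[reducible] def tensor (T T' : Tower) : Tower where
  obj m := T.obj m ⊗[ℂ] T'.obj m
  map m := Algebra.TensorProduct.map (T.map m) (T'.map m)

/-- The element `a ⊗ b` of the completed tensor product. -/
def tmul {T T' : Tower} (a : T.Lim) (b : T'.Lim) : (T.tensor T').Lim :=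
  ⟨fun m => a.1 m ⊗ₜ[ℂ] b.1 m, by
    intro m
    show Algebra.TensorProduct.map (T.map m) (T'.map m) _ = _
    rw [Algebra.TensorProduct.map_tmul, a.2 m, b.2 m]⟩

/-- The flip `σ (a ⊗ b) = b ⊗ a`. -/
def flip (T : Tower) : (T.tensor T).Lim →ₐ[ℂ] (T.tensor T).Lim :=
  mapLim (T := T.tensor T) (T' := T.tensor T)
    (fun m => (Algebra.TensorProduct.comm ℂ (T.obj m) (T.obj m)).toAlgHom) (by
      intro m x
      induction x using TensorProduct.induction_on with
      | zero => simp
      | tmul a b => simp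
      | add a b ha hb => simp only [map_add, ha, hb])

/-- `(a ⊗ b) ⊗ c ↦ a ⊗ (b ⊗ c)`. -/
def assoc (T : Tower) : ((T.tensor T).tensor T).Lim →ₐ[ℂ] (T.tensor (T.tensor T)).Lim :=
  mapLim (T := (T.tensor T).tensor T) (T' := T.tensor (T.tensor T))
    (fun m => (Algebra.TensorProduct.assoc ℂ ℂ ℂ (T.obj m) (T.obj m) (T.obj m)).toAlgHom) (by
      intro m x
      induction x using TensorProduct.induction_on with
      | zero => simp
      | add a b ha hb => simp only [map_add, ha, hb]
      | tmul a c =>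
        induction a using TensorProduct.induction_on with
        | zero => simp
        | tmul a b => simp
        | add a b ha hb => simp only [map_add, TensorProduct.add_tmul, ha, hb])

/-- `x ↦ x₁₂`, that is, `a ⊗ b ↦ a ⊗ b ⊗ 1`. -/
def leg12 (T : Tower) : (T.tensor T).Lim →ₐ[ℂ] (T.tensor (T.tensor T)).Lim :=
  mapLim (T := T.tensor T) (T' := T.tensor (T.tensor T))
    (fun m => Algebra.TensorProduct.map (AlgHom.id ℂ (T.obj m))
      Algebra.TensorProduct.includeLeft) (by
      intro m x
      induction x using TensorProduct.induction_on with
      | zero => simp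
      | tmul a b => simp
      | add a b ha hb => simp only [map_add, ha, hb])

/-- `x ↦ x₁₃`, that is, `a ⊗ b ↦ a ⊗ 1 ⊗ b`. -/
def leg13 (T : Tower) : (T.tensor T).Lim →ₐ[ℂ] (T.tensor (T.tensor T)).Lim :=
  mapLim (T := T.tensor T) (T' := T.tensor (T.tensor T))
    (fun m => Algebra.TensorProduct.map (AlgHom.id ℂ (T.obj m))
      Algebra.TensorProduct.includeRight) (by
      intro m x
      induction x using TensorProduct.induction_on with
      | zero => simp
      | tmul a b => simp
      | add a b ha hb => simp only [map_add, ha, hb])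

/-- `x ↦ x₂₃`, that is, `a ⊗ b ↦ 1 ⊗ a ⊗ b`. -/
def leg23 (T : Tower) : (T.tensor T).Lim →ₐ[ℂ] (T.tensor (T.tensor T)).Lim :=
  mapLim (T := T.tensor T) (T' := T.tensor (T.tensor T))
    (fun m => Algebra.TensorProduct.includeRight) (by intro m x; simp)

end Tower

/-! ### Complete Hopf algebras, quasitriangular and ribbon structures -/

/-- A Hopf algebra structure on the complete algebra `U.Lim`, with tensor products completed.
The maps `comulId = Δ ⊗ id`, `idComul = id ⊗ Δ`, `counitId = ε ⊗ id`, `idCounit = id ⊗ ε`,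
`mulAntipodeId = m (S ⊗ id)` and `mulIdAntipode = m (id ⊗ S)` are the continuous extensions to the
completed tensor product of the maps given on the elements `a ⊗ b`; since the span of these
elements is dense, they are determined by `Δ`, `ε` and `S`. -/
structure CompleteHopf (U : Tower) where
  /-- the coproduct `Δ` -/
  comul : U.Lim →ₐ[ℂ] (U.tensor U).Lim
  /-- the counit `ε` -/
  counit : U.Lim →ₐ[ℂ] ℂ
  /-- the antipode `S` -/
  antipode : U.Lim →ₗ[ℂ] U.Lim
  continuous_comul : Continuous comul
  continuous_counit : Continuous counit
  continuous_antipode : Continuous antipode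
  antipode_one : antipode 1 = 1
  antipode_mul : ∀ a b, antipode (a * b) = antipode b * antipode a
  comulId : (U.tensor U).Lim →ₐ[ℂ] (U.tensor (U.tensor U)).Lim
  continuous_comulId : Continuous comulId
  comulId_tmul : ∀ a b, comulId (Tower.tmul a b) = U.assoc (Tower.tmul (comul a) b)
  idComul : (U.tensor U).Lim →ₐ[ℂ] (U.tensor (U.tensor U)).Lim
  continuous_idComul : Continuous idComul
  idComul_tmul : ∀ a b, idComul (Tower.tmul a b) = Tower.tmul a (comul b)
  counitId : (U.tensor U).Lim →ₐ[ℂ] U.Lim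
  continuous_counitId : Continuous counitId
  counitId_tmul : ∀ a b, counitId (Tower.tmul a b) = counit a • b
  idCounit : (U.tensor U).Lim →ₐ[ℂ] U.Lim
  continuous_idCounit : Continuous idCounit
  idCounit_tmul : ∀ a b, idCounit (Tower.tmul a b) = counit b • a
  mulAntipodeId : (U.tensor U).Lim →ₗ[ℂ] U.Lim
  continuous_mulAntipodeId : Continuous mulAntipodeId
  mulAntipodeId_tmul : ∀ a b, mulAntipodeId (Tower.tmul a b) = antipode a * b
  mulIdAntipode : (U.tensor U).Lim →ₗ[ℂ] U.Lim
  continuous_mulIdAntipode : Continuous mulIdAntipode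
  mulIdAntipode_tmul : ∀ a b, mulIdAntipode (Tower.tmul a b) = a * antipode b
  coassoc : ∀ a, comulId (comul a) = idComul (comul a)
  counitId_comul : ∀ a, counitId (comul a) = a
  idCounit_comul : ∀ a, idCounit (comul a) = a
  mulAntipodeId_comul : ∀ a, mulAntipodeId (comul a) = algebraMap ℂ U.Lim (counit a)
  mulIdAntipode_comul : ∀ a, mulIdAntipode (comul a) = algebraMap ℂ U.Lim (counit a)

namespace CompleteHopf

variable {U : Tower}

/-- `R` is a universal R-matrix. -/
structure IsQuasitriangular (H : CompleteHopf U) (R : (U.tensor U).Lim) : Prop where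
  isUnit : IsUnit R
  intertwine : ∀ a, R * H.comul a * Ring.inverse R = U.flip (H.comul a)
  comulId_R : H.comulId R = U.leg13 R * U.leg23 R
  idComul_R : H.idComul R = U.leg13 R * U.leg12 R

/-- The element `u = m (S ⊗ id) (R₂₁)`. -/
def uElem (H : CompleteHopf U) (R : (U.tensor U).Lim) : U.Lim := H.mulAntipodeId (U.flip R)

/-- `(U, R, θ)` is a ribbon Hopf algebra. -/
structure IsRibbon (H : CompleteHopf U) (R : (U.tensor U).Lim) (θ : U.Lim) : Prop where
  quasitriangular : H.IsQuasitriangular R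
  central : ∀ a, θ * a = a * θ
  sq : θ ^ 2 = H.uElem R * H.antipode (H.uElem R)
  antipode_theta : H.antipode θ = θ
  comul_theta : H.comul θ = Ring.inverse (U.flip R * R) * Tower.tmul θ θ
  counit_theta : H.counit θ = 1

end CompleteHopf

/-! ### The complete algebra `U_{h,w}(H(4))` -/

/-- The generators `E` and `A⁺`, in which power series are allowed. -/
def Gen.isSmall : Gen → Bool
  | .N => false
  | .E => true
  | .Ap => true
  | .A => false

/-- A generator, as an element of the free algebra. -/
def fgen (x : Gen) : FreeAlgebra ℂ Gen := FreeAlgebra.ι ℂ x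

/-- The relations of `U_{h,w}(H(4))` modulo the `m`-th power of the two-sided ideal generated by
`E` and `A⁺`: every word with at least `m` letters `E` or `A⁺` is zero, hence each power series
in `E` or in `A⁺` stops before its `m`-th power. -/
inductive Rel (h w : ℂ) (m : ℕ) : FreeAlgebra ℂ Gen → FreeAlgebra ℂ Gen → Prop
  | comm_A_Ap : Rel h w m (fgen .A * fgen .Ap - fgen .Ap * fgen .A)
      ((∑ k ∈ Finset.range m, (h ^ (2 * k) / ((2 * k + 1)! : ℂ)) • fgen .E ^ (2 * k + 1)) *
        ∑ k ∈ Finset.range m, (w ^ k / (k ! : ℂ)) • fgen .Ap ^ k)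
  | comm_N_Ap : Rel h w m (fgen .N * fgen .Ap - fgen .Ap * fgen .N)
      (∑ k ∈ Finset.range m, (w ^ k / ((k + 1)! : ℂ)) • fgen .Ap ^ (k + 1))
  | comm_N_A : Rel h w m (fgen .N * fgen .A - fgen .A * fgen .N) (-fgen .A)
  | comm_E (x : Gen) : Rel h w m (fgen .E * fgen x) (fgen x * fgen .E)
  | word (l : List Gen) (hl : m ≤ l.countP Gen.isSmall) : Rel h w m (l.map fgen).prod 0

/-- `U_{h,w}(H(4))` modulo the `m`-th power of the ideal generated by `E` and `A⁺`. -/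
abbrev Level (h w : ℂ) (m : ℕ) : Type := RingQuot (Rel h w m)

/-- The class of an element of the free algebra. -/
def mk (h w : ℂ) (m : ℕ) : FreeAlgebra ℂ Gen →ₐ[ℂ] Level h w m := RingQuot.mkAlgHom ℂ (Rel h w m)

theorem mk_pow_eq_zero (h w : ℂ) {m k : ℕ} (hk : m ≤ k) {x : Gen} (hx : x.isSmall = true) :
    mk h w m (fgen x ^ k) = 0 := by
  have h1 : Rel h w m ((List.replicate k x).map fgen).prod 0 :=
    Rel.word _ (by simpa [List.countP_replicate, hx] using hk)
  simpa [mk] using RingQuot.mkAlgHom_rel ℂ h1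

theorem mk_rel (h w : ℂ) (m : ℕ) ⦃a b : FreeAlgebra ℂ Gen⦄ (r : Rel h w (m + 1) a b) :
    mk h w m a = mk h w m b := by
  cases r with
  | comm_A_Ap =>
    rw [Finset.sum_range_succ, Finset.sum_range_succ, map_mul, map_add, map_add, map_smul,
      map_smul, mk_pow_eq_zero h w (by omega) rfl, mk_pow_eq_zero h w le_rfl rfl, smul_zero,
      smul_zero, add_zero, add_zero, ← map_mul]
    exact RingQuot.mkAlgHom_rel ℂ Rel.comm_A_Ap
  | comm_N_Ap =>
    rw [Finset.sum_range_succ, map_add, map_smul, mk_pow_eq_zero h w (by omega) rfl, smul_zero,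
      add_zero]
    exact RingQuot.mkAlgHom_rel ℂ Rel.comm_N_Ap
  | comm_N_A => exact RingQuot.mkAlgHom_rel ℂ Rel.comm_N_A
  | comm_E x => exact RingQuot.mkAlgHom_rel ℂ (Rel.comm_E x)
  | word l hl => exact RingQuot.mkAlgHom_rel ℂ (Rel.word l (by omega))

/-- The inverse system of the algebras `Level h w m`. The algebra `U_{h,w}(H(4))` is its limit
`(Uhw h w).Lim`: the complete algebra on the generators `N`, `E`, `A⁺`, `A` and their commutation
relations, in the topology given by the powers of the ideal generated by `E` and `A⁺`. -/
@[reducible] def Uhw (h w : ℂ) : Tower where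
  obj m := Level h w m
  map m := RingQuot.liftAlgHom ℂ ⟨mk h w m, mk_rel h w m⟩

/-- The generators of `U_{h,w}(H(4))`. -/
def gen (h w : ℂ) (x : Gen) : (Uhw h w).Lim :=
  ⟨fun m => mk h w m (fgen x), by
    intro m
    show RingQuot.liftAlgHom ℂ _ (RingQuot.mkAlgHom ℂ _ _) = _
    rw [RingQuot.liftAlgHom_mkAlgHom_apply]⟩

open Tower in
/-- The coproduct, counit and antipode of `U_{h,w}(H(4))` on the generators. -/
structure IsUhwHopf (h w : ℂ) (H : CompleteHopf (Uhw h w)) : Prop where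
  comul_N : H.comul (gen h w .N) =
    tmul (gen h w .N) (fexp (w • gen h w .Ap)) + tmul 1 (gen h w .N)
  comul_E : H.comul (gen h w .E) = tmul (gen h w .E) 1 + tmul 1 (gen h w .E)
  comul_Ap : H.comul (gen h w .Ap) = tmul (gen h w .Ap) 1 + tmul 1 (gen h w .Ap)
  comul_A : H.comul (gen h w .A) =
    tmul (gen h w .A) (fexp (h • gen h w .E) * fexp (w • gen h w .Ap)) +
      tmul (fexp (-(h • gen h w .E))) (gen h w .A) +
      w • tmul (fexp (-(h • gen h w .E)) * gen h w .N)
        (sinhDiv h (gen h w .E) * fexp (w • gen h w .Ap))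
  counit_gen : ∀ x, H.counit (gen h w x) = 0
  antipode_N : H.antipode (gen h w .N) = -(gen h w .N * fexp (-(w • gen h w .Ap)))
  antipode_E : H.antipode (gen h w .E) = -gen h w .E
  antipode_Ap : H.antipode (gen h w .Ap) = -gen h w .Ap
  antipode_A : H.antipode (gen h w .A) =
    -(gen h w .A * fexp (-(w • gen h w .Ap))) +
      w • (gen h w .N * sinhDiv h (gen h w .E) * fexp (-(w • gen h w .Ap)))

/-- The twist `F = exp (w N ⊗ A⁺)`. -/
def twist (h w : ℂ) : ((Uhw h w).tensor (Uhw h w)).Lim :=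
  fexp (w • Tower.tmul (gen h w .N) (gen h w .Ap))

/-- `R^h = exp (-2h E ⊗ N) exp (2h e^{hE} A ⊗ (1 - e^{-wA⁺}) / w)`. -/
def Rh (h w : ℂ) : ((Uhw h w).tensor (Uhw h w)).Lim :=
  fexp (-((2 * h) • Tower.tmul (gen h w .E) (gen h w .N))) *
    fexp ((2 * h) • Tower.tmul (fexp (h • gen h w .E) * gen h w .A)
      (oneSubExpNegDiv w (gen h w .Ap)))

/-- The universal R-matrix `R^{h,w} = (σ F)⁻¹ R^h F`. -/
def Rhw (h w : ℂ) : ((Uhw h w).tensor (Uhw h w)).Lim :=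
  Ring.inverse ((Uhw h w).flip (twist h w)) * Rh h w * twist h w

/-! ### The representations `π_{e,n}`

The module is `ℕ → ℂ`, the space of the formal series `∑ r, v r |r⟩`, with the topology of
coordinatewise convergence: for `w ≠ 0` the vector `A⁺ |r⟩` is an infinite combination of basis
vectors. The number `γ` is a square root of `sinh (h e) / h`. -/

/-- The topology of pointwise convergence on the operators. -/
instance : TopologicalSpace (Module.End ℂ (ℕ → ℂ)) :=
  TopologicalSpace.induced (fun f => (f : (ℕ → ℂ) → (ℕ → ℂ))) inferInstance

/-- The number `sinh (h e) / h`, which is `e` for `h = 0`. -/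
def sinhRatio (h e : ℂ) : ℂ := if h = 0 then e else Complex.sinh (h * e) / h

/-- `E |r⟩ = e |r⟩`. -/
def repE (e : ℂ) : Module.End ℂ (ℕ → ℂ) := e • 1

/-- `N |r⟩ = (r + n) |r⟩`. -/
def repN (n : ℂ) : Module.End ℂ (ℕ → ℂ) where
  toFun v := fun r => ((r : ℂ) + n) * v r
  map_add' u v := by ext r; simp [mul_add]
  map_smul' c v := by ext r; simp [mul_left_comm]

/-- `A |r⟩ = γ √r |r - 1⟩`: the coefficient of `A v` at `|s⟩` comes from `|s + 1⟩`. -/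
def repA (γ : ℂ) : Module.End ℂ (ℕ → ℂ) where
  toFun v := fun s => γ * (Real.sqrt ((s : ℝ) + 1) : ℂ) * v (s + 1)
  map_add' u v := by ext r; simp [mul_add]
  map_smul' c v := by ext r; simp [mul_left_comm]

/-- `A⁺ |r⟩ = ∑_{k ≥ 0} (w ^ k / (k + 1)) γ ^ (k + 1) √((r + k + 1)! / r!) |r + k + 1⟩`: the
coefficient of `A⁺ v` at `|s⟩` comes from the `|r⟩` with `r < s`, where `k = s - r - 1`. -/
def repAp (w γ : ℂ) : Module.End ℂ (ℕ → ℂ) where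
  toFun v := fun s => ∑ r ∈ Finset.range s,
    w ^ (s - r - 1) / ((s - r : ℕ) : ℂ) * γ ^ (s - r) *
      (Real.sqrt ((s ! : ℝ) / (r ! : ℝ)) : ℂ) * v r
  map_add' u v := by ext s; simp [mul_add, Finset.sum_add_distrib]
  map_smul' c v := by ext s; simp [Finset.mul_sum, mul_left_comm]

/-- The operators of `π_{e,n}` by which the generators act. -/
def rep (w e n γ : ℂ) : Gen → Module.End ℂ (ℕ → ℂ)
  | .N => repN n
  | .E => repE e
  | .Ap => repAp w γ
  | .A => repA γ

end

end HeisenbergDeformation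

/-!
Modulo the `m`-th power of the ideal generated by `E` and `A⁺` these two generators are nilpotent,
so that every series is a finite sum, and the assertions about the Hopf algebra become identities
in arbitrary `ℂ`-algebras containing elements that satisfy the relations (`OscRel`). There the
identities are proved; the elements of a tensor product of two or three factors enter as commuting
families of generators, its legs (`Legs`).

The element `x = (1 - e ^ (-w A⁺)) / w` satisfies `[A, x] = sinh (h E) / h` and `[N, x] = x`
(`OscRel.A_x`, `OscRel.N_x`): in terms of `N`, `E`, `x`, `A` the relations do not involve `w`, and
`A⁺` is a polynomial in `x` on each level (`commute_of_commute_nesd`). The twist `e ^ (w N ⊗ A⁺)`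
conjugates the coproduct to the one with `N` and `x` primitive and
`A ↦ A ⊗ e ^ (h E) + e ^ (-h E) ⊗ A` (`tw_cop_N`, `tw_cop_A`, `tw_cop_x`). This coproduct is
intertwined with its opposite by `R^h` (`rh_comm_N`, `rh_comm_x`, `rh_copA`), and `R^h` satisfies
the two hexagon identities for it; conjugating back gives `rt_cop`, `rt_cop_left` and
`rt_cop_right`.

With `x` to the left of `A`, the series of `θ` is a normally ordered exponential times the Gaussian
`e ^ (2 h E N)`, and a normally ordered exponential `∑ y ^ k t ^ k / k!` is the exponential of the
two-sided multiplication `z ↦ y z t`, applied to `1` (`nord`). Commutation rules for exponentials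
therefore yield that `θ` is central (`OscRel.thetaG_comm`), that a change of sign of `h` in the
series inverts it (`OscRel.thetaG_mul_neg`), and that `R₂₁ R Δ(θ) = θ ⊗ θ` (`rt_rt_thetaG_cop`).
The antipode is conjugate to the antiautomorphism changing the signs of `N`, `E`, `x` and `A`
(`OscRel.anti_mul_conj`). The latter reverses the order in the exponential, which changes it only
by a central factor (`sum_antinormal_mul_normal`, `OscRel.antinormal_eq`); hence `S(θ) = θ`
(`OscRel.thetaG_anti`). Since `S²` is the conjugation by `e ^ (w A⁺)`, the element
`e ^ (-w A⁺) u` is central, and with the formula for `Δ(θ)` this gives `θ² = u S(u)`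
(`drinfeld_sq`).

By the universal property of the levels (`levelLift`) the coproduct maps level `2 m` to the tensor
square of level `m`: an element of total degree at least `2 m` in the tensor square has degree at
least `m` in one of the factors. Maps, identities and convergent series then pass to the inverse
limit componentwise (`Tower.liftAlg`, `Tower.hasSum_lim`, `uhwHopf`).

In the representations, `|r⟩ ↦ X ^ r / √(r!)` turns formal series of vectors into formal power
series in `X` (`fock`). There `A` acts as `γ d/dX` and `A⁺` as the multiplication by
`-log (1 - w γ X) / w`, so that `x` acts as the multiplication by `γ X`, whatever `w` is. Thus
`x ^ l A ^ l` is diagonal, and on `|r⟩` the series of `θ` and of `θ⁻¹` are binomial expansions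
(`hasSum_theta_rep`).
-/

open scoped TensorProduct Nat

namespace HeisenbergDeformation

noncomputable section

set_option linter.unusedSectionVars false
set_option linter.unusedSimpArgs false

/-! ### Power series at nilpotent elements -/

section Nilpotent

variable {B C : Type*} [Ring B] [Algebra ℂ B] [Ring C] [Algebra ℂ C]

/-- `e ^ x` for a nilpotent `x`, as a finite sum. The nilpotency class of an element that is not
nilpotent is `0`, and the sum is then empty. -/
def nexp (x : B) : B := ∑ k ∈ Finset.range (nilpotencyClass x), ((k ! : ℂ)⁻¹) • x ^ k

/-- `sinh (h x) / h` for a nilpotent `x`, as a finite sum. -/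
def nsinh (h : ℂ) (x : B) : B :=
  ∑ k ∈ Finset.range (nilpotencyClass x), (h ^ (2 * k) / ((2 * k + 1)! : ℂ)) • x ^ (2 * k + 1)

/-- `(e ^ (w x) - 1) / w` for a nilpotent `x`, as a finite sum. -/
def nesd (w : ℂ) (x : B) : B :=
  ∑ k ∈ Finset.range (nilpotencyClass x), (w ^ k / ((k + 1)! : ℂ)) • x ^ (k + 1)

theorem sum_range_eq_of_pow_eq_zero {x : B} {n : ℕ} (hn : x ^ n = 0) (c : ℕ → ℂ) {p : ℕ → ℕ}
    (hp : ∀ k, k ≤ p k) :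
    ∑ k ∈ Finset.range (nilpotencyClass x), c k • x ^ p k =
      ∑ k ∈ Finset.range n, c k • x ^ p k := by
  have hx : IsNilpotent x := ⟨n, hn⟩
  apply Finset.sum_subset
  · exact Finset.range_mono (Nat.sInf_le hn)
  · intro k _ hk
    rw [Finset.mem_range, not_lt] at hk
    rw [pow_eq_zero_of_le (hk.trans (hp k)) (pow_nilpotencyClass hx), smul_zero]

theorem nexp_eq_sum {x : B} {n : ℕ} (hn : x ^ n = 0) :
    nexp x = ∑ k ∈ Finset.range n, ((k ! : ℂ)⁻¹) • x ^ k :=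
  sum_range_eq_of_pow_eq_zero hn (fun k => (k ! : ℂ)⁻¹) (p := id) fun _ => le_rfl

theorem nsinh_eq_sum (h : ℂ) {x : B} {n : ℕ} (hn : x ^ n = 0) :
    nsinh h x =
      ∑ k ∈ Finset.range n, (h ^ (2 * k) / ((2 * k + 1)! : ℂ)) • x ^ (2 * k + 1) :=
  sum_range_eq_of_pow_eq_zero hn _ fun _ => by omega

theorem nesd_eq_sum (w : ℂ) {x : B} {n : ℕ} (hn : x ^ n = 0) :
    nesd w x = ∑ k ∈ Finset.range n, (w ^ k / ((k + 1)! : ℂ)) • x ^ (k + 1) :=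
  sum_range_eq_of_pow_eq_zero hn _ fun _ => by omega

theorem nexp_eq_exp [Module ℚ B] (x : B) : nexp x = IsNilpotent.exp x := by
  unfold nexp IsNilpotent.exp
  refine Finset.sum_congr rfl fun k _ => ?_
  have := Rat.cast_smul_eq_qsmul ℂ ((k ! : ℚ)⁻¹) (x ^ k)
  rw [← this]
  norm_num

@[simp] theorem nexp_zero : nexp (0 : B) = 1 := by
  rw [nexp_eq_sum (n := 1) (by simp)]; simp

theorem nexp_add {x y : B} (hxy : Commute x y) (hx : IsNilpotent x) (hy : IsNilpotent y) :
    nexp (x + y) = nexp x * nexp y := by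
  let _ : Module ℚ B := Module.compHom B (algebraMap ℚ ℂ)
  simp only [nexp_eq_exp]
  exact IsNilpotent.exp_add_of_commute hxy hx hy

theorem nexp_mul_neg {x : B} (hx : IsNilpotent x) : nexp x * nexp (-x) = 1 := by
  rw [← nexp_add (Commute.refl x).neg_right hx hx.neg]; simp

theorem nexp_neg_mul {x : B} (hx : IsNilpotent x) : nexp (-x) * nexp x = 1 := by
  simpa using nexp_mul_neg hx.neg

theorem map_nexp (f : B →ₐ[ℂ] C) {x : B} (hx : IsNilpotent x) : f (nexp x) = nexp (f x) := by
  obtain ⟨n, hn⟩ := hx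
  rw [nexp_eq_sum hn, nexp_eq_sum (n := n) (by rw [← map_pow, hn, map_zero])]
  simp

theorem map_nsinh (f : B →ₐ[ℂ] C) (h : ℂ) {x : B} (hx : IsNilpotent x) :
    f (nsinh h x) = nsinh h (f x) := by
  obtain ⟨n, hn⟩ := hx
  rw [nsinh_eq_sum h hn, nsinh_eq_sum (n := n) h (by rw [← map_pow, hn, map_zero])]
  simp

theorem map_nesd (f : B →ₐ[ℂ] C) (w : ℂ) {x : B} (hx : IsNilpotent x) :
    f (nesd w x) = nesd w (f x) := by
  obtain ⟨n, hn⟩ := hx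
  rw [nesd_eq_sum w hn, nesd_eq_sum (n := n) w (by rw [← map_pow, hn, map_zero])]
  simp

theorem commute_nexp {y x : B} (hy : Commute y x) : Commute y (nexp x) :=
  Commute.sum_right _ _ _ fun _ _ => (hy.pow_right _).smul_right _

theorem commute_nsinh (h : ℂ) {y x : B} (hy : Commute y x) : Commute y (nsinh h x) :=
  Commute.sum_right _ _ _ fun _ _ => (hy.pow_right _).smul_right _

theorem commute_nesd (w : ℂ) {y x : B} (hy : Commute y x) : Commute y (nesd w x) :=
  Commute.sum_right _ _ _ fun _ _ => (hy.pow_right _).smul_right _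

theorem isNilpotent_smul (c : ℂ) {x : B} (hx : IsNilpotent x) : IsNilpotent (c • x) :=
  hx.smul c

/-- A relation `a x = y a` passes to the exponentials. -/
theorem nexp_semiconj {a x y : B} (hx : IsNilpotent x) (hy : IsNilpotent y) (h : a * x = y * a) :
    a * nexp x = nexp y * a := by
  obtain ⟨n, hn⟩ := hx
  obtain ⟨m, hm⟩ := hy
  rw [nexp_eq_sum (pow_eq_zero_of_le (le_max_left n m) hn),
    nexp_eq_sum (pow_eq_zero_of_le (le_max_right n m) hm), Finset.mul_sum, Finset.sum_mul]
  refine Finset.sum_congr rfl fun k _ => ?_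
  have : SemiconjBy a x y := h
  rw [mul_smul_comm, smul_mul_assoc, (this.pow_right k).eq]

theorem comm_pow_of_comm {d x c : B} (h : d * x = x * d + c) (hc : Commute x c) (k : ℕ) :
    d * x ^ (k + 1) = x ^ (k + 1) * d + ((k + 1 : ℕ) : ℂ) • (x ^ k * c) := by
  induction k with
  | zero => simp [h]
  | succ k ih =>
    have e : x ^ k * c * x = x ^ (k + 1) * c := by rw [mul_assoc, ← hc.eq, ← mul_assoc, ← pow_succ]
    rw [pow_succ x (k + 1), ← mul_assoc, ih, add_mul, mul_assoc, h, smul_mul_assoc, e, mul_add,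
      ← mul_assoc, ← pow_succ]
    push_cast
    module

/-- If `[d, x] = c` commutes with `x`, then `[d, e ^ x] = e ^ x c`. -/
theorem nexp_comm {d x c : B} (hx : IsNilpotent x) (h : d * x = x * d + c) (hc : Commute x c) :
    d * nexp x = nexp x * d + nexp x * c := by
  obtain ⟨n, hn⟩ := hx
  have hn1 : x ^ (n + 1) = 0 := by rw [pow_succ, hn, zero_mul]
  rw [← mul_add, nexp_eq_sum hn1, Finset.sum_range_succ', mul_add d, Finset.mul_sum,
    Finset.sum_congr rfl fun k _ => (by
      rw [mul_smul_comm, comm_pow_of_comm h hc k, smul_add, smul_smul, ← smul_mul_assoc,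
        ← smul_mul_assoc] : d * ((((k + 1)! : ℕ) : ℂ)⁻¹ • x ^ (k + 1)) = _)]
  rw [Finset.sum_add_distrib, ← Finset.sum_mul, ← Finset.sum_mul, mul_add]
  have e2 : ∑ k ∈ Finset.range n, (((((k + 1)! : ℕ) : ℂ)⁻¹ * ((k + 1 : ℕ) : ℂ)) • x ^ k) =
      nexp x := by
    rw [nexp_eq_sum hn]
    refine Finset.sum_congr rfl fun k _ => ?_
    congr 1
    have h1 : ((k ! : ℕ) : ℂ) ≠ 0 := by exact_mod_cast k.factorial_ne_zero
    have h2 : ((k + 1 : ℕ) : ℂ) ≠ 0 := by exact_mod_cast k.succ_ne_zero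
    rw [Nat.factorial_succ]; push_cast at h2 ⊢; field_simp
  have e3 : (∑ k ∈ Finset.range n, (((k + 1)! : ℕ) : ℂ)⁻¹ • x ^ (k + 1)) +
      (((0 ! : ℕ) : ℂ)⁻¹ • x ^ 0) = nexp x := by
    rw [nexp_eq_sum hn1, Finset.sum_range_succ']
  rw [e2, e3, ← e3]
  simp only [add_mul]
  simp
  abel

theorem smul_nesd (w : ℂ) {x : B} (hx : IsNilpotent x) : w • nesd w x = nexp (w • x) - 1 := by
  obtain ⟨n, hn⟩ := hx
  rw [nexp_eq_sum (n := n + 1) (by rw [smul_pow, pow_succ x, hn, zero_mul, smul_zero]),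
    Finset.sum_range_succ', nesd_eq_sum w hn, Finset.smul_sum]
  simp only [Nat.factorial_zero, Nat.cast_one, inv_one, pow_zero, one_smul, add_sub_cancel_right]
  refine Finset.sum_congr rfl fun k _ => ?_
  rw [smul_smul, smul_pow, smul_smul]
  congr 1; ring

@[simp] theorem nesd_zero_left {x : B} (hx : IsNilpotent x) : nesd 0 x = x := by
  obtain ⟨n, hn⟩ := hx
  rw [nesd_eq_sum (n := n + 1) 0 (by rw [pow_succ x, hn, zero_mul]), Finset.sum_range_succ']
  simp

@[simp] theorem nsinh_zero_left {x : B} (hx : IsNilpotent x) : nsinh 0 x = x := by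
  obtain ⟨n, hn⟩ := hx
  rw [nsinh_eq_sum (n := n + 1) 0 (by rw [pow_succ x, hn, zero_mul]), Finset.sum_range_succ']
  simp

theorem isNilpotent_nesd (w : ℂ) {x : B} (hx : IsNilpotent x) : IsNilpotent (nesd w x) := by
  have : nesd w x = x * ∑ k ∈ Finset.range (nilpotencyClass x),
      (w ^ k / ((k + 1)! : ℂ)) • x ^ k := by
    rw [nesd, Finset.mul_sum]
    exact Finset.sum_congr rfl fun k _ => by rw [mul_smul_comm, pow_succ']
  rw [this]
  exact Commute.isNilpotent_mul_right (Commute.sum_right _ _ _ fun _ _ =>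
    ((Commute.refl x).pow_right _).smul_right _) hx

theorem sum_range_two_mul {M : Type*} [AddCommMonoid M] (f : ℕ → M) (n : ℕ) :
    ∑ k ∈ Finset.range (2 * n), f k = ∑ k ∈ Finset.range n, (f (2 * k) + f (2 * k + 1)) := by
  induction n with
  | zero => simp
  | succ n ih =>
    rw [Finset.sum_range_succ, ← ih, show 2 * (n + 1) = 2 * n + 1 + 1 by ring,
      Finset.sum_range_succ, Finset.sum_range_succ, add_assoc]

theorem smul_nsinh (h : ℂ) {x : B} (hx : IsNilpotent x) :
    (2 * h) • nsinh h x = nexp (h • x) - nexp (-(h • x)) := by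
  obtain ⟨n, hn⟩ := hx
  have e : x ^ (2 * n) = 0 := pow_eq_zero_of_le (by omega) hn
  rw [nexp_eq_sum (n := 2 * n) (x := h • x) (by rw [smul_pow, e, smul_zero]),
    nexp_eq_sum (n := 2 * n) (x := -(h • x)) (by rw [neg_pow, smul_pow, e, smul_zero, mul_zero]),
    nsinh_eq_sum h hn, ← Finset.sum_sub_distrib, sum_range_two_mul, Finset.smul_sum]
  refine Finset.sum_congr rfl fun k _ => ?_
  have h1 : (-(h • x)) ^ (2 * k) = (h • x) ^ (2 * k) := (even_two_mul k).neg_pow _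
  have h2 : (-(h • x)) ^ (2 * k + 1) = -(h • x) ^ (2 * k + 1) :=
    (odd_two_mul_add_one k).neg_pow _
  rw [h1, h2, sub_self, zero_add, smul_neg, sub_neg_eq_add, ← add_smul, smul_pow, smul_smul,
    smul_smul]
  congr 1; ring

/-- If `[d, x] = c` commutes with `x`, then `(e ^ (w x) - 1) / w` has commutator `e ^ (w x) c` with
`d`: for `w ≠ 0` this is `nexp_comm` divided by `w`. -/
theorem nesd_comm (w : ℂ) {d x c : B} (hx : IsNilpotent x) (h : d * x = x * d + c)
    (hc : Commute x c) : d * nesd w x = nesd w x * d + nexp (w • x) * c := by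
  by_cases hw : w = 0
  · subst hw; simp [nesd_zero_left hx, h]
  · have h1 := nexp_comm (isNilpotent_smul w hx) (d := d) (c := w • c)
      (by rw [mul_smul_comm, h, smul_add, smul_mul_assoc]) ((hc.smul_left w).smul_right w)
    have h2 : nexp (w • x) = w • nesd w x + 1 := by rw [smul_nesd w hx]; abel
    have h3 : w • (d * nesd w x) = w • (nesd w x * d + nexp (w • x) * c) := by
      nth_rw 1 [h2] at h1
      nth_rw 1 [h2] at h1
      simp only [mul_add, add_mul, mul_one, one_mul, mul_smul_comm, smul_mul_assoc] at h1
      rw [smul_add]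
      have h4 := congrArg (· - d) h1
      simp only [add_sub_cancel_right] at h4
      rw [h4]; abel
    exact smul_right_injective B hw h3

theorem nesd_neg (w : ℂ) {x : B} (hx : IsNilpotent x) :
    nesd w x = nexp (w • x) * nesd (-w) x := by
  by_cases hw : w = 0
  · subst hw; simp [nesd_zero_left hx]
  · apply smul_right_injective B hw
    have h1 := smul_nesd (-w) hx
    rw [neg_smul, neg_smul] at h1
    show w • nesd w x = w • _
    rw [← mul_smul_comm, show w • nesd (-w) x = 1 - nexp (-(w • x)) by rw [← neg_inj, h1]; abel,
      mul_sub, nexp_mul_neg (isNilpotent_smul w hx), smul_nesd w hx, mul_one]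

theorem nesd_neg_right (w : ℂ) {x : B} (hx : IsNilpotent x) : nesd w (-x) = -nesd (-w) x := by
  obtain ⟨n, hn⟩ := hx
  rw [nesd_eq_sum w (n := n) (by rw [neg_pow, hn, mul_zero]), nesd_eq_sum (-w) hn,
    ← Finset.sum_neg_distrib]
  refine Finset.sum_congr rfl fun k _ => ?_
  rw [← neg_one_smul ℂ x, smul_pow, smul_smul, ← neg_smul, neg_pow w, pow_succ]
  congr 1; ring

theorem nsinh_neg (h : ℂ) (x : B) (hx : IsNilpotent x) : nsinh h (-x) = -nsinh h x := by
  obtain ⟨n, hn⟩ := hx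
  rw [nsinh_eq_sum h (n := n) (by rw [neg_pow, hn, mul_zero]), nsinh_eq_sum h hn,
    ← Finset.sum_neg_distrib]
  refine Finset.sum_congr rfl fun k _ => ?_
  rw [(odd_two_mul_add_one k).neg_pow, smul_neg]

theorem nesd_add (w : ℂ) {x y : B} (hxy : Commute x y) (hx : IsNilpotent x) (hy : IsNilpotent y) :
    nesd w (x + y) = nesd w x * nexp (w • y) + nesd w y := by
  have hs := hxy.isNilpotent_add hx hy
  by_cases hw : w = 0
  · subst hw; simp [nesd_zero_left hx, nesd_zero_left hy, nesd_zero_left hs]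
  · apply smul_right_injective B hw
    show w • _ = w • (_ + _)
    rw [smul_add, ← smul_mul_assoc, smul_nesd w hx, smul_nesd w hy, smul_nesd w hs, smul_add,
      nexp_add ((hxy.smul_left w).smul_right w) (isNilpotent_smul w hx) (isNilpotent_smul w hy)]
    noncomm_ring

theorem nsinh_add (h : ℂ) {x y : B} (hxy : Commute x y) (hx : IsNilpotent x)
    (hy : IsNilpotent y) :
    nsinh h (x + y) = nsinh h x * nexp (h • y) + nexp (-(h • x)) * nsinh h y := by
  have hs := hxy.isNilpotent_add hx hy
  by_cases hh : h = 0
  · subst hh; simp [nsinh_zero_left hx, nsinh_zero_left hy, nsinh_zero_left hs]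
  · have h2 : (2 * h) ≠ 0 := by simpa using hh
    apply smul_right_injective B h2
    have hc := (hxy.smul_left h).smul_right h
    show (2 * h) • _ = (2 * h) • (_ + _)
    rw [smul_add, ← smul_mul_assoc, ← mul_smul_comm, smul_nsinh h hx, smul_nsinh h hy,
      smul_nsinh h hs, smul_add, neg_add,
      nexp_add hc (isNilpotent_smul h hx) (isNilpotent_smul h hy),
      nexp_add hc.neg_left.neg_right (isNilpotent_smul h hx).neg (isNilpotent_smul h hy).neg]
    noncomm_ring

/-- The `k`-th power of `t` plus terms of higher order is `t ^ k` plus terms of higher order. -/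
theorem exists_mul_one_add_pow {K : Type*} [CommRing K] (t g : K) (k : ℕ) :
    ∃ r, (t * (1 + t * g)) ^ k = t ^ k + t ^ (k + 1) * r := by
  obtain ⟨r, hr⟩ := sub_dvd_pow_sub_pow (1 + t * g) 1 k
  refine ⟨g * r, ?_⟩
  rw [one_pow, add_sub_cancel_left] at hr
  rw [mul_pow, eq_add_of_sub_eq hr]
  ring

/-- The nilpotent element `x` is a polynomial in `(e ^ (w x) - 1) / w`: it therefore commutes with
everything that commutes with the latter. -/
theorem commute_of_commute_nesd (w : ℂ) {R x : B} (hx : IsNilpotent x)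
    (h : Commute R (nesd w x)) : Commute R x := by
  obtain ⟨n, hn⟩ := hx
  obtain ⟨g, hg⟩ : ∃ g : Polynomial ℂ,
      nesd w x = Polynomial.aeval x (Polynomial.X * (1 + Polynomial.X * g)) := by
    refine ⟨∑ i ∈ Finset.range n, Polynomial.monomial i (w ^ (i + 1) / ((i + 2)! : ℂ)), ?_⟩
    rw [nesd_eq_sum w (n := n + 1) (by rw [pow_succ, hn, zero_mul]), Finset.sum_range_succ']
    simp only [map_mul, map_add, map_sum, Polynomial.aeval_X, Polynomial.aeval_monomial,
      Finset.mul_sum, mul_add, mul_one, ← Algebra.smul_def, mul_smul_comm]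
    rw [add_comm]
    congr 1
    · simp
    · exact Finset.sum_congr rfl fun i _ => by rw [pow_succ' x (i + 1), pow_succ' x i]
  -- descending induction: `x ^ k` is `(nesd w x) ^ k` up to higher powers of `x`
  have key : ∀ j k : ℕ, n ≤ k + j → Commute R (x ^ k) := by
    intro j
    induction j with
    | zero => intro k hk; rw [pow_eq_zero_of_le (m := n) (by omega) hn]; exact Commute.zero_right R
    | succ j ih =>
      intro k hk
      obtain ⟨r, hr⟩ := exists_mul_one_add_pow Polynomial.X g k
      have hp : nesd w x ^ k = x ^ k + x ^ (k + 1) * Polynomial.aeval x r := by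
        rw [hg, ← map_pow, hr]
        simp only [map_add, map_mul, map_pow, Polynomial.aeval_X]
      have e2 : Commute R (x ^ (k + 1) * Polynomial.aeval x r) := by
        rw [Polynomial.aeval_eq_sum_range, Finset.mul_sum]
        refine Commute.sum_right _ _ _ fun i _ => ?_
        rw [mul_smul_comm, ← pow_add]
        exact (ih _ (by omega)).smul_right _
      rw [eq_sub_of_add_eq hp.symm]
      exact (h.pow_right k).sub_right e2
  simpa using key n 1 (by omega)

/-! ### Normally ordered exponentials -/

/-- The operator `z ↦ y z t` of two-sided multiplication. -/
def twoSided (y t : B) : Module.End ℂ B := LinearMap.mulLeft ℂ y * LinearMap.mulRight ℂ t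

@[simp] theorem twoSided_apply (y t z : B) : twoSided y t z = y * z * t := by
  simp [twoSided, mul_assoc]

theorem twoSided_pow (y t : B) (k : ℕ) : twoSided y t ^ k = twoSided (y ^ k) (t ^ k) := by
  rw [twoSided, (LinearMap.commute_mulLeft_right y t).mul_pow, LinearMap.pow_mulLeft,
    LinearMap.pow_mulRight, twoSided]

theorem isNilpotent_twoSided {y : B} (hy : IsNilpotent y) (t : B) :
    IsNilpotent (twoSided y t) := by
  obtain ⟨n, hn⟩ := hy
  exact ⟨n, by rw [twoSided_pow, hn]; ext; simp⟩

theorem twoSided_commute {y t y' t' : B} (hy : Commute y y') (ht : Commute t t') :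
    Commute (twoSided y t) (twoSided y' t') := by
  ext z
  simp only [Module.End.mul_apply, twoSided_apply]
  rw [← mul_assoc, ← mul_assoc, hy.eq, mul_assoc _ t', ← ht.eq]
  simp only [mul_assoc]

theorem nexp_twoSided_apply {y t : B} {n : ℕ} (hn : twoSided y t ^ n = 0) (z : B) :
    nexp (twoSided y t) z = ∑ k ∈ Finset.range n, ((k ! : ℂ)⁻¹) • (y ^ k * z * t ^ k) := by
  rw [nexp_eq_sum hn]
  simp [LinearMap.sum_apply, twoSided_pow]

/-- The normally ordered exponential `∑ k, y ^ k t ^ k / k!`, the exponential of a two-sided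
multiplication at `1`. -/
def nord (y t : B) : B := nexp (twoSided y t) 1

theorem nord_eq_sum {y t : B} {n : ℕ} (hn : y ^ n = 0) :
    nord y t = ∑ k ∈ Finset.range n, ((k ! : ℂ)⁻¹) • (y ^ k * t ^ k) := by
  rw [nord, nexp_twoSided_apply (n := n) (by rw [twoSided_pow, hn]; ext; simp)]
  simp

/-- Left multiplication by `a` against the exponential of a two-sided multiplication. -/
theorem mul_nexp_twoSided {a y y' t : B} (hy : IsNilpotent y) (hy' : IsNilpotent y')
    (h : a * y = y' * a) (z : B) :
    a * nexp (twoSided y t) z = nexp (twoSided y' t) (a * z) := by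
  have := nexp_semiconj (a := LinearMap.mulLeft ℂ a) (isNilpotent_twoSided hy t)
    (isNilpotent_twoSided hy' t) (by
      ext z
      simp only [Module.End.mul_apply, twoSided_apply, LinearMap.mulLeft_apply]
      rw [← mul_assoc, ← mul_assoc, h, mul_assoc y'])
  simpa using LinearMap.congr_fun this z

/-- Right multiplication by `a` against the exponential of a two-sided multiplication. -/
theorem nexp_twoSided_mul {a y t t' : B} (hy : IsNilpotent y)
    (h : t * a = a * t') (z : B) :
    nexp (twoSided y t) z * a = nexp (twoSided y t') (z * a) := by
  have := nexp_semiconj (a := LinearMap.mulRight ℂ a) (isNilpotent_twoSided hy t)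
    (isNilpotent_twoSided hy t') (by
      ext z
      simp only [Module.End.mul_apply, twoSided_apply, LinearMap.mulRight_apply]
      rw [mul_assoc _ t, h]
      simp only [mul_assoc])
  simpa using LinearMap.congr_fun this z

end Nilpotent

/-! ### The deformed oscillator relations at nilpotent elements -/

section Oscillator

variable {B C : Type*} [Ring B] [Algebra ℂ B] [Ring C] [Algebra ℂ C] {h w : ℂ} {a b : Gen → B}

/-- `e ^ (c E)`. -/
def eE (c : ℂ) (a : Gen → B) : B := nexp (c • a .E)

/-- `e ^ (c A⁺)`. -/
def eP (c : ℂ) (a : Gen → B) : B := nexp (c • a .Ap)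

/-- `(1 - e ^ (-w A⁺)) / w`, the raising operator of the undeformed relations. -/
def xP (w : ℂ) (a : Gen → B) : B := nesd (-w) (a .Ap)

/-- The elements `a .N`, `a .E`, `a .Ap`, `a .A` of a plain algebra satisfy the defining relations
of `U_{h,w}(H(4))`, the elements `a .E` and `a .Ap` being nilpotent. -/
structure OscRel (h w : ℂ) (a : Gen → B) : Prop where
  nilE : IsNilpotent (a .E)
  nilP : IsNilpotent (a .Ap)
  comm_A_Ap : a .A * a .Ap - a .Ap * a .A = nsinh h (a .E) * eP w a
  comm_N_Ap : a .N * a .Ap - a .Ap * a .N = nesd w (a .Ap)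
  comm_N_A : a .N * a .A - a .A * a .N = -a .A
  comm_E : ∀ x, a .E * a x = a x * a .E

/-- The two families commute with one another, as do the generators in two different factors of a
tensor product. -/
def Legs (a b : Gen → B) : Prop := ∀ g g', Commute (a g) (b g')

theorem Legs.symm (hab : Legs a b) : Legs b a := fun g g' => (hab g' g).symm

section commute

variable {y : B}

theorem commute_eE (c : ℂ) (hy : Commute y (a .E)) : Commute y (eE c a) :=
  commute_nexp (hy.smul_right c)

theorem commute_eP (c : ℂ) (hy : Commute y (a .Ap)) : Commute y (eP c a) :=
  commute_nexp (hy.smul_right c)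

theorem commute_xP (hy : Commute y (a .Ap)) : Commute y (xP w a) :=
  commute_nesd _ hy

theorem commute_eE_left (c : ℂ) (hy : Commute (a .E) y) : Commute (eE c a) y :=
  (commute_eE c hy.symm).symm

theorem commute_eP_left (c : ℂ) (hy : Commute (a .Ap) y) : Commute (eP c a) y :=
  (commute_eP c hy.symm).symm

theorem commute_xP_left (hy : Commute (a .Ap) y) : Commute (xP w a) y :=
  (commute_xP hy.symm).symm

theorem commute_nsinh_left (c : ℂ) {x : B} (hy : Commute x y) : Commute (nsinh c x) y :=
  (commute_nsinh c hy.symm).symm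

theorem commute_nexp_left {x : B} (hy : Commute x y) : Commute (nexp x) y :=
  (commute_nexp hy.symm).symm

attribute [simp] commute_eE commute_eP commute_xP commute_eE_left commute_eP_left
  commute_xP_left commute_nsinh_left commute_nsinh commute_nexp commute_nexp_left
  Commute.smul_left Commute.smul_right Commute.add_left Commute.add_right
  Commute.neg_left Commute.neg_right

end commute

@[simp] theorem eE_zero : eE 0 a = 1 := by simp [eE]

namespace OscRel

variable (ha : OscRel h w a)
include ha

theorem commE (g : Gen) : Commute (a .E) (a g) := ha.comm_E g

theorem commE' (g : Gen) : Commute (a g) (a .E) := (ha.comm_E g).symm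

theorem nil_smulE (c : ℂ) : IsNilpotent (c • a .E) := ha.nilE.smul c

theorem nil_smulP (c : ℂ) : IsNilpotent (c • a .Ap) := ha.nilP.smul c

theorem nil_x : IsNilpotent (xP w a) := isNilpotent_nesd _ ha.nilP

theorem eE_mul (c d : ℂ) : eE c a * eE d a = eE (c + d) a := by
  rw [eE, eE, eE, add_smul, nexp_add (by simp) (ha.nil_smulE c) (ha.nil_smulE d)]

theorem eP_mul (c d : ℂ) : eP c a * eP d a = eP (c + d) a := by
  rw [eP, eP, eP, add_smul, nexp_add (by simp) (ha.nil_smulP c) (ha.nil_smulP d)]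

theorem eP_mul_neg (c : ℂ) : eP c a * eP (-c) a = 1 := by
  rw [ha.eP_mul]; simp [eP]

theorem eP_neg_mul (c : ℂ) : eP (-c) a * eP c a = 1 := by
  rw [ha.eP_mul]; simp [eP]

theorem smul_sinh : (2 * h) • nsinh h (a .E) = eE h a - eE (-h) a := by
  rw [smul_nsinh h ha.nilE, eE, eE, neg_smul]

theorem smul_x : w • xP w a = 1 - eP (-w) a := by
  have := smul_nesd (-w) ha.nilP
  rw [neg_smul] at this
  rw [xP, ← neg_inj, this, eP]; abel

theorem A_P : a .A * a .Ap = a .Ap * a .A + nsinh h (a .E) * eP w a := by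
  rw [← ha.comm_A_Ap]; abel

theorem N_P : a .N * a .Ap = a .Ap * a .N + nesd w (a .Ap) := by
  rw [← ha.comm_N_Ap]; abel

/-- In terms of `(1 - e ^ (-w A⁺)) / w` the relation between `A` and `A⁺` does not involve `w`. -/
theorem A_x : a .A * xP w a = xP w a * a .A + nsinh h (a .E) := by
  have h1 := ha.A_P
  have hs : Commute (a .Ap) (nsinh h (a .E)) := commute_nsinh h (ha.commE' _)
  rw [xP, nesd_comm (-w) ha.nilP h1 (by simp (maxDischargeDepth := 5) [hs])]
  have h2 : nexp (-w • a .Ap) * (nsinh h (a .E) * eP w a) = nsinh h (a .E) := by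
    rw [← mul_assoc, (commute_nexp_left (hs.smul_left (-w))).eq, mul_assoc]
    exact (congrArg _ (ha.eP_neg_mul w)).trans (mul_one _)
  rw [h2]

/-- In terms of `(1 - e ^ (-w A⁺)) / w` the relation between `N` and `A⁺` does not involve `w`. -/
theorem N_x : a .N * xP w a = xP w a * a .N + xP w a := by
  have h1 := ha.N_P
  rw [xP, nesd_comm (-w) ha.nilP h1 (commute_nesd _ (Commute.refl _)), nesd_neg w ha.nilP,
    ← mul_assoc, neg_smul, nexp_neg_mul (ha.nil_smulP w), one_mul]

theorem N_A : a .N * a .A = a .A * a .N - a .A := by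
  rw [sub_eq_iff_eq_add.mp ha.comm_N_A]; abel

theorem A_N : a .A * a .N = a .N * a .A + a .A := by
  rw [ha.N_A]; abel

theorem A_q : a .A * eP w a = eP w a * a .A + w • (nsinh h (a .E) * eP w a * eP w a) := by
  have h1 : a .A * (w • a .Ap) = (w • a .Ap) * a .A + w • (nsinh h (a .E) * eP w a) := by
    rw [mul_smul_comm, smul_mul_assoc, ← smul_add, ha.A_P]
  have hs : Commute (a .Ap) (nsinh h (a .E)) := commute_nsinh h (ha.commE' _)
  have h2 := nexp_comm (ha.nil_smulP w) h1 (by simp (maxDischargeDepth := 5) [hs])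
  rw [eP, h2, mul_smul_comm]
  have h3 : Commute (nexp (w • a .Ap)) (nsinh h (a .E) * nexp (w • a .Ap)) :=
    Commute.mul_right (by simp (maxDischargeDepth := 5) [ha.commE', hs]) (Commute.refl _)
  rw [eP, h3.eq]

theorem N_q : a .N * eP w a = eP w a * a .N + eP w a * eP w a - eP w a := by
  have h1 : a .N * (w • a .Ap) = (w • a .Ap) * a .N + (eP w a - 1) := by
    rw [eP, ← smul_nesd w ha.nilP, mul_smul_comm, smul_mul_assoc, ← smul_add, ha.N_P]
  have h2 := nexp_comm (ha.nil_smulP w) h1 (by simp (maxDischargeDepth := 5) [Commute.sub_right])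
  rw [eP, h2, eP]; noncomm_ring

end OscRel

/-- The deformed coproduct: the images of the generators when they are in legs `a` and `b`. -/
def cop (h w : ℂ) (a b : Gen → B) : Gen → B
  | .N => a .N * eP w b + b .N
  | .E => a .E + b .E
  | .Ap => a .Ap + b .Ap
  | .A => a .A * (eE h b * eP w b) + eE (-h) a * b .A +
      w • (eE (-h) a * a .N * (nsinh h (b .E) * eP w b))

theorem eP_cop (hab : Legs a b) (ha : OscRel h w a) (hb : OscRel h w b) (c : ℂ) :
    eP c (cop h w a b) = eP c a * eP c b := by
  rw [eP, cop, smul_add, nexp_add (by simp [hab _ _]) (ha.nil_smulP c) (hb.nil_smulP c), eP, eP]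

theorem eE_cop (hab : Legs a b) (ha : OscRel h w a) (hb : OscRel h w b) (c : ℂ) :
    eE c (cop h w a b) = eE c a * eE c b := by
  rw [eE, cop, smul_add, nexp_add (by simp [hab _ _]) (ha.nil_smulE c) (hb.nil_smulE c), eE, eE]

theorem nsinh_cop (hab : Legs a b) (ha : OscRel h w a) (hb : OscRel h w b) :
    nsinh h (cop h w a b .E) = nsinh h (a .E) * eE h b + eE (-h) a * nsinh h (b .E) := by
  rw [cop, nsinh_add h (hab _ _) ha.nilE hb.nilE, eE, eE, neg_smul]

theorem lassoc {x y r : B} (h : x * y = r) (z : B) : x * (y * z) = r * z := by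
  rw [← mul_assoc, h]

/-- The coproduct respects the relations. -/
theorem oscRel_cop (hab : Legs a b) (ha : OscRel h w a) (hb : OscRel h w b) :
    OscRel h w (cop h w a b) := by
  have hba := hab.symm
  have e1 (g : Gen) := ha.commE' g
  have e2 (g : Gen) := hb.commE' g
  have qa : Commute (a .A) (eP w b) := by simp [hab _ _]
  have qn : Commute (a .N) (eP w b) := by simp [hab _ _]
  have q1 : Commute (a .A) (eE h b) := by simp [hab _ _]
  have q2 : Commute (a .N) (eE h b) := by simp [hab _ _]
  have q3 : Commute (b .A) (eE h b) := by simp [e2]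
  have q4 : Commute (b .N) (eE h b) := by simp [e2]
  have q5 : Commute (eP w b) (eE h b) := by simp [e2]
  have p1 : Commute (a .A) (eE (-h) a) := by simp [e1]
  have p2 : Commute (a .N) (eE (-h) a) := by simp [e1]
  have p3 : Commute (b .A) (eE (-h) a) := by simp [hba _ _]
  have p4 : Commute (b .N) (eE (-h) a) := by simp [hba _ _]
  have p5 : Commute (eP w b) (eE (-h) a) := by simp [hba _ _]
  have s1 : Commute (a .A) (nsinh h (b .E)) := by simp [hab _ _]
  have s2 : Commute (a .N) (nsinh h (b .E)) := by simp [hab _ _]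
  have s3 : Commute (b .A) (nsinh h (b .E)) := by simp [e2]
  have s4 : Commute (b .N) (nsinh h (b .E)) := by simp [e2]
  have s5 : Commute (eP w b) (nsinh h (b .E)) := by simp [e2]
  refine ⟨(hab _ _).isNilpotent_add ha.nilE hb.nilE, (hab _ _).isNilpotent_add ha.nilP hb.nilP,
    ?_, ?_, ?_, ?_⟩
  · rw [nsinh_cop hab ha hb, eP_cop hab ha hb]
    have r1 := ha.A_P
    have r2 := hb.A_P
    have r3 := ha.N_P
    have r4 : Commute (b .A) (a .Ap) := hba _ _
    have r5 : Commute (a .A) (b .Ap) := hab _ _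
    have r6 : Commute (a .N) (b .Ap) := hab _ _
    have r7 : Commute (eE h b) (a .Ap) := by simp [hba _ _]
    have r8 : Commute (eE (-h) a) (a .Ap) := by simp [e1, ha.commE]
    have r9 : Commute (eE h b) (b .Ap) := by simp [hb.commE]
    have r10 : Commute (eE (-h) a) (b .Ap) := by simp [hab _ _]
    have r11 : Commute (nsinh h (b .E)) (a .Ap) := by simp [hba _ _]
    have r12 : Commute (nsinh h (b .E)) (b .Ap) := by simp [hb.commE]
    have r13 : Commute (eP w b) (a .Ap) := by simp [hba _ _]
    have r14 : Commute (eP w b) (b .Ap) := by simp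
    have r15 : Commute (eP w a) (eE h b) := by simp [hab _ _]
    have r16 : Commute (eP w a) (nsinh h (b .E)) := by simp [hab _ _]
    have t' (y : B) : w • (eE (-h) a * (nesd w (a .Ap) * y)) = eE (-h) a * ((eP w a - 1) * y) := by
      rw [eP, ← smul_nesd w ha.nilP, smul_mul_assoc, mul_smul_comm]
    simp only [cop, mul_assoc, mul_add, add_mul, mul_sub, sub_mul, smul_mul_assoc, mul_smul_comm,
      smul_add, smul_sub, r1, r2, r3, lassoc r1, lassoc r2, lassoc r3,
      r4.eq, r4.left_comm, r5.eq, r5.left_comm, r6.eq, r6.left_comm, r7.eq, r7.left_comm,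
      r8.eq, r8.left_comm, r9.eq, r9.left_comm, r10.eq, r10.left_comm, r11.eq, r11.left_comm,
      r12.eq, r12.left_comm, r13.eq, r13.left_comm, r14.eq, r14.left_comm, r15.eq, r15.left_comm,
      r16.eq, r16.left_comm]
    rw [t']
    simp only [mul_assoc, mul_add, add_mul, mul_sub, sub_mul, one_mul, r15.left_comm,
      r16.left_comm]
    have r17 : Commute (eP w b) (eE h b) := by simp [e2]
    have r18 : Commute (eP w a) (eP w b) := by simp [hab _ _]
    simp only [r17.eq, r17.left_comm, r18.eq, r18.left_comm]
    abel
  · have r3 := ha.N_P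
    have r4 := hb.N_P
    have r6 : Commute (a .N) (b .Ap) := hab _ _
    have r7 : Commute (b .N) (a .Ap) := hba _ _
    have r13 : Commute (eP w b) (a .Ap) := by simp [hba _ _]
    have r14 : Commute (eP w b) (b .Ap) := by simp
    simp only [cop, mul_assoc, mul_add, add_mul, r3, r4, lassoc r3, lassoc r4,
      r6.eq, r6.left_comm, r7.eq, r7.left_comm, r13.eq, r13.left_comm, r14.eq, r14.left_comm]
    rw [nesd_add w (hab _ _) ha.nilP hb.nilP, eP]
    abel
  · have r1 := ha.N_A
    have r2 := hb.N_A
    have r3 := hb.N_q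
    have r4 := hb.A_q
    have r5 : Commute (b .N) (a .A) := hba _ _
    have r6 : Commute (b .N) (a .N) := hba _ _
    have r7 : Commute (b .A) (a .A) := hba _ _
    have r8 : Commute (b .A) (a .N) := hba _ _
    have r9 : Commute (nsinh h (b .E)) (eE (-h) a) := by simp [hba _ _]
    have r10 : Commute (eE h b) (eE (-h) a) := by simp [hba _ _]
    simp only [cop, mul_assoc, mul_add, add_mul, mul_sub, sub_mul, smul_mul_assoc, mul_smul_comm,
      smul_add, smul_sub, neg_add, r1, r2, r3, r4, lassoc r1, lassoc r2, lassoc r3, lassoc r4,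
      r5.eq, r5.left_comm, r6.eq, r6.left_comm, r7.eq, r7.left_comm, r8.eq, r8.left_comm,
      r9.eq, r9.left_comm, r10.eq, r10.left_comm, qa.eq, qa.left_comm, qn.eq, qn.left_comm,
      q1.eq, q1.left_comm, q2.eq, q2.left_comm, q3.eq, q3.left_comm, q4.eq, q4.left_comm,
      q5.eq, q5.left_comm, p1.eq, p1.left_comm, p2.eq, p2.left_comm, p3.eq, p3.left_comm,
      p4.eq, p4.left_comm, p5.eq, p5.left_comm, s1.eq, s1.left_comm, s2.eq, s2.left_comm,
      s3.eq, s3.left_comm, s4.eq, s4.left_comm, s5.eq, s5.left_comm]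
    module
  · intro g
    have c1 (g : Gen) : Commute (a .E) (cop h w a b g) := by
      cases g <;> simp (maxDischargeDepth := 9) [cop, ha.commE, hab _ _]
    have c2 (g : Gen) : Commute (b .E) (cop h w a b g) := by
      cases g <;> simp (maxDischargeDepth := 9) [cop, hb.commE, hba _ _]
    exact (c1 g).add_left (c2 g)

end Oscillator

/-! ### The twist and the universal R-matrix -/

section RMatrix

variable {B : Type*} [Ring B] [Algebra ℂ B] {h w : ℂ} {a b : Gen → B}

/-- The twist `exp (w N ⊗ A⁺)`, in legs `a` and `b`. -/
def tw (w : ℂ) (a b : Gen → B) : B := nexp (w • (a .N * b .Ap))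

/-- The inverse of the twist. -/
def twInv (w : ℂ) (a b : Gen → B) : B := nexp (-(w • (a .N * b .Ap)))

/-- The R-matrix of the untwisted coproduct, in legs `a` and `b`. -/
def rh (h w : ℂ) (a b : Gen → B) : B :=
  nexp (-((2 * h) • (a .E * b .N))) * nexp ((2 * h) • (eE h a * a .A * xP w b))

/-- The universal R-matrix of the twisted coproduct, in legs `a` and `b`. -/
def rt (h w : ℂ) (a b : Gen → B) : B := twInv w b a * rh h w a b * tw w a b

theorem nil_N_P (hab : Legs a b) (hb : OscRel h w b) (c : ℂ) :
    IsNilpotent (c • (a .N * b .Ap)) :=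
  ((hab _ _).isNilpotent_mul_left hb.nilP).smul c

theorem nil_E_N (hab : Legs a b) (ha : OscRel h w a) (c : ℂ) :
    IsNilpotent (c • (a .E * b .N)) :=
  ((hab _ _).isNilpotent_mul_right ha.nilE).smul c

theorem nil_A_x (hb : OscRel h w b) (c : ℂ) (y : B)
    (hy : Commute y (xP w b)) : IsNilpotent (c • (y * xP w b)) :=
  (hy.isNilpotent_mul_left hb.nil_x).smul c

theorem tw_mul_twInv (hab : Legs a b) (hb : OscRel h w b) : tw w a b * twInv w a b = 1 :=
  nexp_mul_neg (nil_N_P hab hb w)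

theorem twInv_mul_tw (hab : Legs a b) (hb : OscRel h w b) : twInv w a b * tw w a b = 1 :=
  nexp_neg_mul (nil_N_P hab hb w)

/-- The untwisted coproduct of `A`. -/
def copA (h : ℂ) (a b : Gen → B) : B := a .A * eE h b + eE (-h) a * b .A

/-- The twist conjugates the coproduct of `N` to the primitive one. -/
theorem tw_cop_N (hab : Legs a b) (hb : OscRel h w b) :
    tw w a b * cop h w a b .N = (a .N + b .N) * tw w a b := by
  have hba := hab.symm
  have h1 : b .N * (w • (a .N * b .Ap)) =
      (w • (a .N * b .Ap)) * b .N + a .N * (eP w b - 1) := by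
    rw [eP, ← smul_nesd w hb.nilP, mul_smul_comm, (hba .N .N).left_comm, hb.N_P, mul_add,
      smul_add, smul_mul_assoc, mul_assoc, mul_smul_comm]
  have h2 := nexp_comm (nil_N_P hab hb w) h1
    (by simp (maxDischargeDepth := 6) [hab _ _, hba _ _, Commute.sub_right])
  have h3 : Commute (a .N) (tw w a b) := by simp (maxDischargeDepth := 6) [tw, hab _ _]
  rw [cop, add_mul, h3.eq, tw, h2]
  noncomm_ring

/-- The twist conjugates the coproduct of `A` to the untwisted one. -/
theorem tw_cop_A (hab : Legs a b) (ha : OscRel h w a) (hb : OscRel h w b) :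
    tw w a b * cop h w a b .A = copA h a b * tw w a b := by
  have hba := hab.symm
  have nil := nil_N_P hab hb w
  have cq : Commute (w • (a .N * b .Ap)) (w • b .Ap) := by
    simp (maxDischargeDepth := 6) [hab _ _]
  -- moving `A ⊗ 1` across the twist
  have h1 : a .A * tw w a b = tw w a b * (a .A * eP w b) := by
    rw [tw, nexp_semiconj nil (y := w • (a .N * b .Ap) + w • b .Ap)
      (cq.isNilpotent_add nil (hb.nil_smulP w)) (by
        rw [mul_smul_comm, ← mul_assoc, ha.A_N, ← smul_add, smul_mul_assoc, add_mul, add_mul,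
          mul_assoc, mul_assoc, (hab .A .Ap).eq]),
      nexp_add cq nil (hb.nil_smulP w), mul_assoc]
    congr 1
    exact (show Commute (a .A) (eP w b) by simp [hab _ _]).eq.symm
  -- moving `1 ⊗ A` across the twist
  have h2 : b .A * tw w a b =
      tw w a b * (b .A + w • (a .N * (nsinh h (b .E) * eP w b))) := by
    rw [tw, nexp_comm nil (c := w • (a .N * (nsinh h (b .E) * eP w b))) (by
        rw [mul_smul_comm, (hba .A .N).left_comm, hb.A_P, mul_add, smul_add, smul_mul_assoc,
          mul_assoc])
      (by simp (maxDischargeDepth := 8) [hab _ _, hba _ _, hb.commE, hb.commE']), mul_add]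
  have c1 : Commute (eE h b) (tw w a b) := by
    simp (maxDischargeDepth := 6) [tw, hba _ _, hb.commE]
  have c2 : Commute (eE (-h) a) (tw w a b) := by
    simp (maxDischargeDepth := 6) [tw, hab _ _, ha.commE]
  have c3 : Commute (eP w b) (eE h b) := by simp [hb.commE']
  have k1 : a .A * eE h b * tw w a b = tw w a b * (a .A * (eE h b * eP w b)) := by
    rw [mul_assoc, c1.eq, ← mul_assoc, h1, mul_assoc, mul_assoc, c3.eq]
  have k2 : eE (-h) a * b .A * tw w a b = tw w a b * (eE (-h) a * b .A +
      w • (eE (-h) a * a .N * (nsinh h (b .E) * eP w b))) := by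
    rw [mul_assoc, h2, c2.left_comm, mul_add, mul_smul_comm, mul_assoc]
  rw [cop, copA, add_mul, k1, k2, ← mul_add, add_assoc]

theorem xP_cop (hab : Legs a b) (ha : OscRel h w a) (hb : OscRel h w b) :
    xP w (cop h w a b) = xP w a * eP (-w) b + xP w b := by
  rw [xP, cop, nesd_add (-w) (hab _ _) ha.nilP hb.nilP, eP, xP, xP]

/-- The twist makes `(1 - e ^ (-w A⁺)) / w` primitive. -/
theorem tw_cop_x (hab : Legs a b) (ha : OscRel h w a) (hb : OscRel h w b) :
    tw w a b * xP w (cop h w a b) = (xP w a + xP w b) * tw w a b := by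
  have hba := hab.symm
  have nil := nil_N_P hab hb w
  have cq : Commute (w • (a .N * b .Ap)) (w • b .Ap) := by
    simp (maxDischargeDepth := 6) [hab _ _]
  have cx : Commute (xP w a) (b .Ap) := by simp [hab _ _]
  have h1 : xP w a * (tw w a b * eP w b) = tw w a b * xP w a := by
    rw [tw, eP, ← nexp_add cq nil (hb.nil_smulP w)]
    refine nexp_semiconj (cq.isNilpotent_add nil (hb.nil_smulP w)) nil ?_
    rw [mul_add, mul_smul_comm, mul_smul_comm, ← mul_assoc, ← smul_add, ← add_mul,
      ← ha.N_x, smul_mul_assoc, mul_assoc, cx.eq, mul_assoc]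
  have c1 : Commute (xP w b) (tw w a b) := by
    simp (maxDischargeDepth := 6) [tw, hba _ _]
  rw [xP_cop hab ha hb, mul_add, add_mul, c1.eq, ← mul_assoc, ← h1, mul_assoc, mul_assoc,
    hb.eP_mul_neg, mul_one]

/-- The untwisted R-matrix intertwines the untwisted coproduct of `N`, which is symmetric. -/
theorem rh_comm_N (hab : Legs a b) (ha : OscRel h w a) (hb : OscRel h w b) :
    Commute (rh h w a b) (a .N + b .N) := by
  have hba := hab.symm
  have e1 := ha.commE
  have c1 : Commute (a .N) (eE h a) := by simp [ha.commE']
  have c2 : Commute (a .N) (xP w b) := by simp [hab _ _]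
  have c3 : Commute (b .N) (eE h a * a .A) := by simp (maxDischargeDepth := 6) [hba _ _]
  unfold rh
  refine Commute.mul_left (commute_nexp_left ?_) (commute_nexp_left ?_)
  · simp (maxDischargeDepth := 6) [hab _ _, hba _ _, ha.commE]
  · refine Commute.smul_left ?_ _
    have : (a .N + b .N) * (eE h a * a .A * xP w b) = eE h a * a .A * xP w b * (a .N + b .N) := by
      rw [add_mul, mul_add, c3.left_comm, hb.N_x, ← mul_assoc, ← mul_assoc (a .N), c1.eq,
        mul_assoc (eE h a), ha.N_A, mul_assoc _ (xP w b), ← c2.eq]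
      noncomm_ring
    exact this.symm

theorem eE_smul_sinh (ha : OscRel h w a) :
    (2 * h) • (eE h a * nsinh h (a .E)) = eE (2 * h) a - 1 := by
  rw [← mul_smul_comm, ha.smul_sinh, mul_sub, ha.eE_mul, ha.eE_mul]
  simp [two_mul]

/-- The untwisted R-matrix intertwines the untwisted coproduct of `(1 - e ^ (-w A⁺)) / w`, which is
symmetric. Each of its two exponentials alone does not. -/
theorem rh_comm_x (hab : Legs a b) (ha : OscRel h w a) (hb : OscRel h w b) :
    Commute (rh h w a b) (xP w a + xP w b) := by
  have hba := hab.symm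
  have c0 : Commute (eE h a * a .A) (xP w b) := by simp (maxDischargeDepth := 6) [hab _ _]
  have nil := nil_A_x hb (2 * h) (eE h a * a .A) c0
  have nil1 := (nil_E_N (b := b) hab ha (2 * h)).neg
  have ca : Commute (xP w a) (eE h a) := by simp [ha.commE']
  have cab : Commute (xP w a) (xP w b) := by simp [hab _ _]
  set G1 := nexp (-((2 * h) • (a .E * b .N))) with hG1
  set G2 := nexp ((2 * h) • (eE h a * a .A * xP w b)) with hG2
  -- the second factor
  have h1 : G2 * (xP w a + xP w b) = (xP w a + eE (2 * h) a * xP w b) * G2 := by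
    have k1 := nexp_comm nil (d := xP w a) (c := -((eE (2 * h) a - 1) * xP w b)) (by
        rw [← eE_smul_sinh ha, mul_smul_comm, ← mul_assoc, ← mul_assoc, ca.eq,
          mul_assoc (eE h a), ← sub_eq_of_eq_add ha.A_x, smul_mul_assoc, smul_mul_assoc,
          ← smul_neg, ← smul_add, mul_assoc _ _ (xP w a), ← cab.eq]
        congr 1
        noncomm_ring)
      (by simp (maxDischargeDepth := 8) [hab _ _, hba _ _, ha.commE, ha.commE', Commute.sub_right])
    have k2 : Commute G2 ((eE (2 * h) a - 1) * xP w b) := by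
      simp (maxDischargeDepth := 8) [hG2, hab _ _, hba _ _, ha.commE, ha.commE', Commute.sub_right]
    have k3 : Commute G2 (xP w b) := by
      simp (maxDischargeDepth := 8) [hG2, hab _ _, hba _ _]
    rw [← hG2, mul_neg, k2.eq] at k1
    rw [add_mul, k1, mul_add, k3.eq]
    noncomm_ring
  -- the first factor
  have h2 : G1 * (eE (2 * h) a * xP w b) = xP w b * G1 := by
    have cq : Commute (-((2 * h) • (a .E * b .N))) ((2 * h) • a .E) := by
      simp (maxDischargeDepth := 6) [hba _ _]
    have cx : Commute (xP w b) (a .E) := by simp [hba _ _]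
    rw [← mul_assoc, hG1, eE, ← nexp_add cq nil1 (ha.nil_smulE _)]
    refine (nexp_semiconj nil1 (cq.isNilpotent_add nil1 (ha.nil_smulE _)) ?_).symm
    rw [mul_neg, mul_smul_comm, cx.left_comm, ← sub_eq_of_eq_add hb.N_x]
    simp only [add_mul, neg_mul, smul_mul_assoc, mul_sub, smul_sub, mul_assoc]
    abel
  have h3 : Commute G1 (xP w a) := by
    simp (maxDischargeDepth := 6) [hG1, hba _ _, ha.commE]
  show rh h w a b * _ = _ * rh h w a b
  rw [rh, mul_assoc, h1, ← mul_assoc, mul_add, h2, h3.eq, ← add_mul, mul_assoc]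

/-- The untwisted R-matrix intertwines the untwisted coproduct of `A` and its opposite. -/
theorem rh_copA (hab : Legs a b) (ha : OscRel h w a) (hb : OscRel h w b) :
    rh h w a b * copA h a b = copA h b a * rh h w a b := by
  have hba := hab.symm
  have c0 : Commute (eE h a * a .A) (xP w b) := by simp (maxDischargeDepth := 6) [hab _ _]
  have nil := nil_A_x hb (2 * h) (eE h a * a .A) c0
  have nil1 := (nil_E_N (b := b) hab ha (2 * h)).neg
  set G1 := nexp (-((2 * h) • (a .E * b .N))) with hG1
  set G2 := nexp ((2 * h) • (eE h a * a .A * xP w b)) with hG2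
  have d1 : Commute (b .A) (eE h a * a .A) := by simp (maxDischargeDepth := 6) [hba _ _]
  have k0 : b .A * G2 = G2 * b .A + G2 * (eE h a * a .A * (eE h b - eE (-h) b)) := by
    refine nexp_comm nil ?_
      (by simp (maxDischargeDepth := 8) [hab _ _, hba _ _, hb.commE, hb.commE', Commute.sub_right])
    rw [← hb.smul_sinh, mul_smul_comm, d1.left_comm, hb.A_x, mul_smul_comm, smul_mul_assoc,
      ← smul_add, mul_add]
    congr 1
    noncomm_ring
  have k1 : Commute G2 (eE h a * a .A * (eE h b - eE (-h) b)) := by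
    simp (maxDischargeDepth := 8) [hG2, hab _ _, hba _ _, hb.commE, hb.commE', Commute.sub_right]
  have k2 : Commute G2 (a .A * eE h b) := by
    simp (maxDischargeDepth := 8) [hG2, hab _ _, hba _ _, hb.commE, hb.commE', ha.commE, ha.commE']
  have k3 : Commute G2 (eE (-h) a) := by
    simp (maxDischargeDepth := 8) [hG2, hab _ _, hba _ _, hb.commE, hb.commE', ha.commE, ha.commE']
  have h1 : G2 * copA h a b = (a .A * eE (-h) b + eE (-h) a * b .A) * G2 := by
    have : G2 * b .A = b .A * G2 - eE h a * a .A * (eE h b - eE (-h) b) * G2 := by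
      rw [k0, ← k1.eq]; abel
    have hc : eE (-h) a * (eE h a * a .A * (eE h b - eE (-h) b) * G2) =
        a .A * (eE h b - eE (-h) b) * G2 := by
      simp only [mul_assoc, lassoc (ha.eE_mul _ _)]
      simp
    rw [copA, mul_add, k2.eq, k3.left_comm, this, mul_sub, hc]
    noncomm_ring
  have h2 : G1 * b .A = eE (2 * h) a * b .A * G1 := by
    have cq : Commute (-((2 * h) • (a .E * b .N))) ((2 * h) • a .E) := by
      simp (maxDischargeDepth := 6) [hba _ _]
    have cx : Commute (b .A) (a .E) := by simp [hba _ _]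
    have ce : Commute (b .A) (eE (2 * h) a) := by simp [hba _ _]
    have cg : Commute (eE (2 * h) a) G1 := by simp (maxDischargeDepth := 6) [hG1, hab _ _]
    rw [← ce.eq, mul_assoc, cg.eq, hG1, eE, ← nexp_add cq nil1 (ha.nil_smulE _)]
    refine (nexp_semiconj (cq.isNilpotent_add nil1 (ha.nil_smulE _)) nil1 ?_).symm
    rw [mul_add, mul_neg, mul_smul_comm, mul_smul_comm, cx.left_comm, hb.A_N, cx.eq, neg_mul,
      smul_mul_assoc, ← smul_neg, ← smul_neg, ← smul_add]
    congr 1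
    noncomm_ring
  have h3 : Commute G1 (a .A * eE (-h) b) := by
    simp (maxDischargeDepth := 6) [hG1, hba _ _, hab _ _, ha.commE, hb.commE']
  have h4 : Commute G1 (eE (-h) a) := by
    simp (maxDischargeDepth := 6) [hG1, hba _ _, hab _ _, ha.commE, hb.commE']
  have c5 : Commute (a .A) (eE (-h) b) := by simp [hab _ _]
  have c6 : Commute (eE h a) (b .A) := by simp [hab _ _]
  rw [rh, mul_assoc, h1, ← mul_assoc, mul_add, h3.eq, h4.left_comm, h2, copA, ← c5.eq, ← c6.eq]
  simp only [← mul_assoc, ha.eE_mul, ← add_mul]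
  rw [show -h + 2 * h = h by ring, add_comm]

theorem rh_comm_E (hab : Legs a b) (ha : OscRel h w a) (hb : OscRel h w b) :
    Commute (a .E) (rh h w a b) ∧ Commute (b .E) (rh h w a b) := by
  have hba := hab.symm
  constructor <;>
  simp (maxDischargeDepth := 8) [rh, hba _ _, hab _ _, ha.commE, hb.commE]

theorem tw_comm_E (hab : Legs a b) (ha : OscRel h w a) (hb : OscRel h w b) :
    Commute (a .E) (tw w a b) ∧ Commute (b .E) (tw w a b) := by
  have hba := hab.symm
  constructor <;>
  simp (maxDischargeDepth := 8) [tw, hba _ _, hab _ _, ha.commE, hb.commE]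

theorem twInv_comm_E (hab : Legs a b) (ha : OscRel h w a) (hb : OscRel h w b) :
    Commute (a .E) (twInv w a b) ∧ Commute (b .E) (twInv w a b) := by
  have hba := hab.symm
  constructor <;>
  simp (maxDischargeDepth := 8) [twInv, hba _ _, hab _ _, ha.commE, hb.commE]

/-- If the twist in both orders and the untwisted R-matrix intertwine, so does the twisted one. -/
theorem rt_mul_of (hab : Legs a b) (ha : OscRel h w a) {x y x' y' : B}
    (h1 : tw w a b * x = x' * tw w a b) (h2 : rh h w a b * x' = y' * rh h w a b)
    (h3 : tw w b a * y = y' * tw w b a) : rt h w a b * x = y * rt h w a b := by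
  have i1 := tw_mul_twInv hab.symm ha
  have i2 := twInv_mul_tw hab.symm ha
  have h4 : twInv w b a * y' = y * twInv w b a := by
    calc twInv w b a * y' = twInv w b a * (y' * tw w b a) * twInv w b a := by
          rw [mul_assoc, mul_assoc, i1, mul_one]
      _ = _ := by rw [← h3, ← mul_assoc, i2, one_mul]
  rw [rt, mul_assoc, h1, mul_assoc, ← mul_assoc (rh h w a b), h2, mul_assoc y', ← mul_assoc, h4]
  simp only [mul_assoc]

/-- The universal R-matrix intertwines the twisted coproduct and its opposite. -/
theorem rt_cop (hab : Legs a b) (ha : OscRel h w a) (hb : OscRel h w b) (g : Gen) :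
    rt h w a b * cop h w a b g = cop h w b a g * rt h w a b := by
  have hba := hab.symm
  cases g with
  | N =>
    refine rt_mul_of hab ha (tw_cop_N hab hb)
      (rh_comm_N hab ha hb).eq ?_
    rw [tw_cop_N hba ha, add_comm]
  | A =>
    exact rt_mul_of hab ha (tw_cop_A hab ha hb)
      (rh_copA hab ha hb) (tw_cop_A hba hb ha)
  | E =>
    have e1 := twInv_comm_E hba hb ha
    have e2 := rh_comm_E hab ha hb
    have e3 := tw_comm_E hab ha hb
    have : Commute (a .E + b .E) (rt h w a b) := by
      unfold rt
      exact ((e1.2.add_left e1.1).mul_right (e2.1.add_left e2.2)).mul_right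
        (e3.1.add_left e3.2)
    simp only [cop]
    rw [add_comm (b .E)]
    exact this.eq.symm
  | Ap =>
    have h1 : rt h w a b * xP w (cop h w a b) = xP w (cop h w b a) * rt h w a b := by
      refine rt_mul_of hab ha (tw_cop_x hab ha hb)
        (rh_comm_x hab ha hb).eq ?_
      rw [tw_cop_x hba hb ha, add_comm]
    have h2 : cop h w b a .Ap = cop h w a b .Ap := add_comm _ _
    rw [h2]
    exact commute_of_commute_nesd (-w) (oscRel_cop hab ha hb).nilP (by
      rw [xP, xP, h2] at h1; exact h1)

end RMatrix

/-! ### The hexagon identities -/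

section Hexagon

variable {B : Type*} [Ring B] [Algebra ℂ B] {h w : ℂ} {i j k : Gen → B}

theorem legs_cop (hik : Legs i k) (hjk : Legs j k) : Legs (cop h w i j) k := by
  intro g g'
  cases g <;> simp (maxDischargeDepth := 9) [cop, hik _ _, hjk _ _]

theorem mul_mul_swap {p q r r' t : B} (h : r' * q = q * r) :
    p * q * (r * t) = p * r' * (q * t) := by
  rw [mul_assoc, mul_assoc, ← mul_assoc q, ← h, mul_assoc]

/-- Conjugation of an expression of the form of the untwisted R-matrix, factor by factor. -/
theorem rh_semiconj {u : B} {E α N x E' α' N' x' : B}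
    (n1 : IsNilpotent (-((2 * h) • (E * N)))) (n1' : IsNilpotent (-((2 * h) • (E' * N'))))
    (n2 : IsNilpotent ((2 * h) • (α * x))) (n2' : IsNilpotent ((2 * h) • (α' * x')))
    (hE : u * E = E' * u) (hN : u * N = N' * u) (hα : u * α = α' * u) (hx : u * x = x' * u) :
    u * (nexp (-((2 * h) • (E * N))) * nexp ((2 * h) • (α * x))) =
      nexp (-((2 * h) • (E' * N'))) * nexp ((2 * h) • (α' * x')) * u := by
  rw [← mul_assoc, nexp_semiconj n1 n1', mul_assoc, nexp_semiconj n2 n2', ← mul_assoc]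
  · rw [mul_smul_comm, ← mul_assoc, hα, mul_assoc, hx, smul_mul_assoc, mul_assoc]
  · rw [mul_neg, mul_smul_comm, ← mul_assoc, hE, mul_assoc, hN, neg_mul, smul_mul_assoc, mul_assoc]

theorem rt_comm_P {a b : Gen → B} (hab : Legs a b) (ha : OscRel h w a) (hb : OscRel h w b) :
    Commute (rt h w a b) (a .Ap + b .Ap) := by
  have := rt_cop hab ha hb .Ap
  simp only [cop] at this
  rw [add_comm (b .Ap)] at this
  exact this

variable (hij : Legs i j) (hik : Legs i k) (hjk : Legs j k)
  (hi : OscRel h w i) (hj : OscRel h w j) (hk : OscRel h w k)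
include hij hik hjk hi hj hk

/-- The untwisted `(Δ ⊗ id) R = R₁₃ R₂₃`, conjugated by the twist. -/
theorem tw_rh_cop_left :
    tw w i j * rh h w (cop h w i j) k = rh h w i k * rh h w j k * tw w i j := by
  have hji := hij.symm
  have hki := hik.symm
  have hkj := hjk.symm
  have hc := legs_cop (h := h) (w := w) hik hjk
  have oc := oscRel_cop hij hi hj
  set α := eE h i * i .A * eE (2 * h) j + eE h j * j .A with hα
  have cα : Commute α (xP w k) := by
    simp (maxDischargeDepth := 9) [hα, hik _ _, hjk _ _]
  have c0 : Commute (eE h (cop h w i j) * cop h w i j .A) (xP w k) := by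
    simp (maxDischargeDepth := 9) [hc _ _]
  have ci : Commute (eE h i * i .A) (xP w k) := by simp (maxDischargeDepth := 9) [hik _ _]
  have cj : Commute (eE h j * j .A) (xP w k) := by simp (maxDischargeDepth := 9) [hjk _ _]
  have ci2 : Commute (eE h i * i .A * eE (2 * h) j) (xP w k) := by
    simp (maxDischargeDepth := 9) [hik _ _, hjk _ _]
  have nE : IsNilpotent (-((2 * h) • ((i .E + j .E) * k .N))) :=
    ((nil_E_N hc oc (2 * h)).neg)
  have t1 := tw_comm_E hij hi hj
  have e1 : tw w i j * (eE h (cop h w i j) * cop h w i j .A) = α * tw w i j := by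
    have q1 : Commute (tw w i j) (eE h i * eE h j) := by
      simp (maxDischargeDepth := 9) [t1.1.symm, t1.2.symm]
    have q2 : Commute (eE h j) (i .A) := by simp (maxDischargeDepth := 9) [hji _ _]
    have q3 : Commute (eE h j) (eE (-h) i) := by simp (maxDischargeDepth := 9) [hji _ _]
    rw [eE_cop hij hi hj, ← mul_assoc, q1.eq, mul_assoc, tw_cop_A hij hi hj, ← mul_assoc]
    congr 1
    rw [copA, hα, mul_add, mul_assoc, q2.left_comm, hj.eE_mul, mul_assoc, q3.left_comm,
      lassoc (hi.eE_mul _ _)]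
    simp [two_mul, mul_assoc]
  have e2 : tw w i j * (cop h w i j .E) = (i .E + j .E) * tw w i j := by
    rw [cop]; exact (t1.1.add_left t1.2).eq.symm
  have e3 : Commute (tw w i j) (k .N) := by simp (maxDischargeDepth := 9) [tw, hik _ _, hjk _ _]
  have e4 : Commute (tw w i j) (xP w k) := by simp (maxDischargeDepth := 9) [tw, hik _ _, hjk _ _]
  have key := rh_semiconj (u := tw w i j) ((nil_E_N hc oc (2 * h)).neg) nE
    (nil_A_x hk (2 * h) _ c0) (nil_A_x hk (2 * h) α cα) e2 e3.eq e1 e4.eq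
  rw [rh, key]
  congr 1
  -- splitting the exponents
  have s1 : nexp (-((2 * h) • ((i .E + j .E) * k .N))) =
      nexp (-((2 * h) • (i .E * k .N))) * nexp (-((2 * h) • (j .E * k .N))) := by
    rw [add_mul, smul_add, neg_add,
      nexp_add _ (nil_E_N hik hi (2 * h)).neg (nil_E_N hjk hj (2 * h)).neg]
    simp (maxDischargeDepth := 9) [hik _ _, hjk _ _, hij _ _, hkj _ _, hki _ _]
  have n3 := nil_A_x hk (2 * h) _ ci2
  have s2 : nexp ((2 * h) • (α * xP w k)) =
      nexp ((2 * h) • (eE h i * i .A * eE (2 * h) j * xP w k)) *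
        nexp ((2 * h) • (eE h j * j .A * xP w k)) := by
    rw [hα, add_mul, smul_add, nexp_add _ n3 (nil_A_x hk (2 * h) _ cj)]
    simp (maxDischargeDepth := 12) [hik _ _, hjk _ _, hij _ _, hkj _ _, hki _ _, hj.commE]
  have n4 := nil_A_x hk (2 * h) _ ci
  have n5 := (nil_E_N hjk hj (2 * h)).neg
  have s3 : nexp ((2 * h) • (eE h i * i .A * xP w k)) * nexp (-((2 * h) • (j .E * k .N))) =
      nexp (-((2 * h) • (j .E * k .N))) *
        nexp ((2 * h) • (eE h i * i .A * eE (2 * h) j * xP w k)) := by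
    -- moving `xP w k` across `exp (-2h E ⊗ N)` costs a factor `e ^ (2hE)`
    have m0 : nexp (-((2 * h) • (j .E * k .N))) * (eE (2 * h) j * xP w k) =
        xP w k * nexp (-((2 * h) • (j .E * k .N))) := by
      have cq : Commute (-((2 * h) • (j .E * k .N))) ((2 * h) • j .E) := by
        simp (maxDischargeDepth := 6) [hkj _ _]
      have cx : Commute (xP w k) (j .E) := by simp [hkj _ _]
      rw [← mul_assoc, eE, ← nexp_add cq n5 (hj.nil_smulE _)]
      refine (nexp_semiconj n5 (cq.isNilpotent_add n5 (hj.nil_smulE _)) ?_).symm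
      rw [mul_neg, mul_smul_comm, cx.left_comm, ← sub_eq_of_eq_add hk.N_x]
      simp only [add_mul, neg_mul, smul_mul_assoc, mul_sub, smul_sub, mul_assoc]
      abel
    refine (nexp_semiconj n3 n4 ?_).symm
    have q1 : Commute (nexp (-((2 * h) • (j .E * k .N)))) (eE h i * i .A) := by
      simp (maxDischargeDepth := 9) [hji _ _, hki _ _]
    rw [mul_smul_comm, mul_assoc _ (eE (2 * h) j), ← mul_assoc, q1.eq, mul_assoc, m0,
      smul_mul_assoc]
    simp only [mul_assoc]
  rw [s1, s2, rh, rh]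
  exact mul_mul_swap s3

/-- The untwisted `(id ⊗ Δ) R = R₁₃ R₁₂`, conjugated by the twist. -/
theorem tw_rh_cop_right :
    tw w j k * rh h w i (cop h w j k) = rh h w i k * rh h w i j * tw w j k := by
  have hji := hij.symm
  have hki := hik.symm
  have hkj := hjk.symm
  have hc := (legs_cop (h := h) (w := w) hji hki).symm
  have oc := oscRel_cop hjk hj hk
  have cij : Commute (eE h i * i .A) (xP w j) := by simp (maxDischargeDepth := 9) [hij _ _]
  have cik : Commute (eE h i * i .A) (xP w k) := by simp (maxDischargeDepth := 9) [hik _ _]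
  have cs : Commute (xP w j) (xP w k) := by simp (maxDischargeDepth := 9) [hjk _ _]
  have c0 : Commute (eE h i * i .A) (xP w (cop h w j k)) := by
    simp (maxDischargeDepth := 9) [hc _ _]
  have e1 : Commute (tw w j k) (i .E) := by simp (maxDischargeDepth := 9) [tw, hji _ _, hki _ _]
  have e2 : Commute (tw w j k) (eE h i * i .A) := by
    simp (maxDischargeDepth := 9) [tw, hji _ _, hki _ _]
  have nS : IsNilpotent ((2 * h) • (eE h i * i .A * (xP w j + xP w k))) :=
    (Commute.isNilpotent_mul_left (cij.add_right cik)
      (cs.isNilpotent_add hj.nil_x hk.nil_x)).smul _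
  have nE : IsNilpotent (-((2 * h) • (i .E * (j .N + k .N)))) :=
    (((((hij _ _).add_right (hik _ _)).isNilpotent_mul_right hi.nilE)).smul _).neg
  have key := rh_semiconj (u := tw w j k) ((nil_E_N hc hi (2 * h)).neg) nE
    (nil_A_x oc (2 * h) _ c0) nS e1.eq (tw_cop_N hjk hk) e2.eq (tw_cop_x hjk hj hk)
  rw [rh, key]
  congr 1
  have s1 : nexp (-((2 * h) • (i .E * (j .N + k .N)))) =
      nexp (-((2 * h) • (i .E * k .N))) * nexp (-((2 * h) • (i .E * j .N))) := by
    rw [add_comm, mul_add, smul_add, neg_add,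
      nexp_add _ (nil_E_N hik hi (2 * h)).neg (nil_E_N hij hi (2 * h)).neg]
    simp (maxDischargeDepth := 9) [hik _ _, hjk _ _, hij _ _, hkj _ _, hki _ _, hji _ _]
  have s2 : nexp ((2 * h) • (eE h i * i .A * (xP w j + xP w k))) =
      nexp ((2 * h) • (eE h i * i .A * xP w k)) * nexp ((2 * h) • (eE h i * i .A * xP w j)) := by
    rw [add_comm, mul_add, smul_add,
      nexp_add _ (nil_A_x hk (2 * h) _ cik) (nil_A_x hj (2 * h) _ cij)]
    have : Commute (eE h i) (i .A) := by simp [hi.commE]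
    refine Commute.smul_left (Commute.smul_right ?_ _) _
    exact Commute.mul_left (Commute.mul_right (Commute.refl _) cij)
      (Commute.mul_right cik.symm cs.symm)
  have s3 : Commute (nexp ((2 * h) • (eE h i * i .A * xP w k)))
      (nexp (-((2 * h) • (i .E * j .N)))) := by
    simp (maxDischargeDepth := 9) [hik _ _, hjk _ _, hij _ _, hkj _ _, hki _ _, hji _ _, hi.commE']
  rw [s1, s2, rh, rh]
  exact mul_mul_swap s3

/-- `(Δ ⊗ id) R = R₁₃ R₂₃`. -/
theorem rt_cop_left : rt h w (cop h w i j) k = rt h w i k * rt h w j k := by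
  have hji := hij.symm
  have hki := hik.symm
  have hkj := hjk.symm
  have oc := oscRel_cop hij hi hj
  have hc := legs_cop (h := h) (w := w) hik hjk
  -- the twists
  have f1 : tw w i j * tw w (cop h w i j) k = tw w i k * tw w j k * tw w i j := by
    have nS : IsNilpotent (w • ((i .N + j .N) * k .Ap)) :=
      ((((hik _ _).add_left (hjk _ _)).isNilpotent_mul_left hk.nilP)).smul _
    have q : Commute (tw w i j) (k .Ap) := by simp (maxDischargeDepth := 9) [tw, hik _ _, hjk _ _]
    have := nexp_semiconj (a := tw w i j) (nil_N_P hc hk w) nS (by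
      rw [mul_smul_comm, ← mul_assoc, tw_cop_N hij hj, mul_assoc, q.eq, smul_mul_assoc, mul_assoc])
    show tw w i j * nexp (w • (cop h w i j .N * k .Ap)) = _
    rw [this, add_mul, smul_add, nexp_add _ (nil_N_P hik hk w) (nil_N_P hjk hk w)]
    · rfl
    · simp (maxDischargeDepth := 9) [hik _ _, hjk _ _, hij _ _, hkj _ _, hki _ _, hji _ _]
  have f2 : twInv w k (cop h w i j) = twInv w k i * twInv w k j := by
    rw [twInv, cop, mul_add, smul_add, neg_add,
      nexp_add _ (nil_N_P hki hi w).neg (nil_N_P hkj hj w).neg]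
    · rfl
    · simp (maxDischargeDepth := 9) [hik _ _, hjk _ _, hij _ _, hkj _ _, hki _ _, hji _ _]
  -- commuting pairs
  have c1 : Commute (tw w i k) (tw w j k) := by
    simp (maxDischargeDepth := 9) [tw, hik _ _, hjk _ _, hij _ _, hkj _ _, hki _ _, hji _ _]
  have c2 : Commute (tw w i k) (tw w i j) := by
    simp (maxDischargeDepth := 9) [tw, hik _ _, hjk _ _, hij _ _, hkj _ _, hki _ _, hji _ _]
  have c3 : Commute (tw w k j) (tw w i j) := by
    simp (maxDischargeDepth := 9) [tw, hik _ _, hjk _ _, hij _ _, hkj _ _, hki _ _, hji _ _]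
  have c4 : Commute (rt h w j k) (tw w i k * tw w i j) := by
    rw [tw, tw, ← nexp_add (by
      simp (maxDischargeDepth := 9) [hik _ _, hjk _ _, hij _ _, hkj _ _, hki _ _, hji _ _])
      (nil_N_P hik hk w) (nil_N_P hij hj w), ← smul_add, ← mul_add]
    refine commute_nexp (Commute.smul_right (Commute.mul_right ?_ ?_) _)
    · simp (maxDischargeDepth := 12) [rt, twInv, rh, tw, hkj _ _, hki _ _, hji _ _]
    · rw [add_comm]
      exact rt_comm_P hjk hj hk
  have c5 : Commute (rh h w i k) (tw w k j * tw w i j) := by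
    rw [tw, tw, ← nexp_add (by
      simp (maxDischargeDepth := 9) [hik _ _, hjk _ _, hij _ _, hkj _ _, hki _ _, hji _ _])
      (nil_N_P hkj hj w) (nil_N_P hij hj w), ← smul_add, ← add_mul]
    refine commute_nexp (Commute.smul_right (Commute.mul_right ?_ ?_) _)
    · rw [add_comm]
      exact rh_comm_N hik hi hk
    · simp (maxDischargeDepth := 12) [rh, tw, hkj _ _, hki _ _, hij _ _]
  have i1 := twInv_mul_tw (w := w) hij hj
  have i2 := tw_mul_twInv (w := w) hij hj
  have i3 := tw_mul_twInv (w := w) hkj hj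
  have i4 := twInv_mul_tw (w := w) hkj hj
  have r1 : rh h w j k * tw w j k = tw w k j * rt h w j k := by
    rw [rt, ← mul_assoc, ← mul_assoc, i3, one_mul]
  have key : tw w i j * (rh h w (cop h w i j) k * tw w (cop h w i j) k) =
      tw w i j * (tw w k j * (rh h w i k * tw w i k * rt h w j k)) := by
    calc tw w i j * (rh h w (cop h w i j) k * tw w (cop h w i j) k)
        = rh h w i k * rh h w j k * (tw w i k * tw w j k * tw w i j) := by
          rw [← mul_assoc, tw_rh_cop_left hij hik hjk hi hj hk, mul_assoc, f1]
      _ = rh h w i k * (rh h w j k * tw w j k) * (tw w i k * tw w i j) := by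
          rw [c1.eq]; simp only [mul_assoc]
      _ = rh h w i k * tw w k j * (tw w i k * tw w i j) * rt h w j k := by
          rw [r1, mul_assoc, mul_assoc, c4.eq]; simp only [mul_assoc]
      _ = (rh h w i k * (tw w k j * tw w i j)) * tw w i k * rt h w j k := by
          rw [c2.eq]; simp only [mul_assoc]
      _ = _ := by rw [c5.eq, c3.eq]; simp only [mul_assoc]
  have key2 := congrArg (twInv w i j * ·) key
  simp only [lassoc i1, one_mul] at key2
  rw [rt, mul_assoc, key2, f2, mul_assoc, lassoc i4, one_mul]
  show _ = twInv w k i * rh h w i k * tw w i k * rt h w j k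
  simp only [mul_assoc]

/-- `(id ⊗ Δ) R = R₁₃ R₁₂`. -/
theorem rt_cop_right : rt h w i (cop h w j k) = rt h w i k * rt h w i j := by
  have hji := hij.symm
  have hki := hik.symm
  have hkj := hjk.symm
  have oc := oscRel_cop hjk hj hk
  have hc := legs_cop (h := h) (w := w) hji hki
  have nS : IsNilpotent (-(w • ((j .N + k .N) * i .Ap))) :=
    (((((hji _ _).add_left (hki _ _)).isNilpotent_mul_left hi.nilP)).smul _).neg
  have f1 : tw w i (cop h w j k) = tw w i j * tw w i k := by
    rw [tw, cop, mul_add, smul_add, nexp_add _ (nil_N_P hij hj w) (nil_N_P hik hk w)]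
    · rfl
    · simp (maxDischargeDepth := 9) [hik _ _, hjk _ _, hij _ _, hkj _ _, hki _ _, hji _ _]
  have f2 : tw w j k * twInv w (cop h w j k) i = twInv w j i * twInv w k i * tw w j k := by
    have q : Commute (tw w j k) (i .Ap) := by simp (maxDischargeDepth := 9) [tw, hji _ _, hki _ _]
    have := nexp_semiconj (a := tw w j k) (nil_N_P hc hi w).neg nS (by
      rw [mul_neg, mul_smul_comm, ← mul_assoc, tw_cop_N hjk hk, mul_assoc, q.eq, neg_mul,
        smul_mul_assoc, mul_assoc])
    show tw w j k * nexp (-(w • (cop h w j k .N * i .Ap))) = _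
    rw [this, add_mul, smul_add, neg_add,
      nexp_add _ (nil_N_P hji hi w).neg (nil_N_P hki hi w).neg]
    · rfl
    · simp (maxDischargeDepth := 9) [hik _ _, hjk _ _, hij _ _, hkj _ _, hki _ _, hji _ _]
  have c1 : Commute (tw w i j) (tw w i k) := by
    simp (maxDischargeDepth := 9) [tw, hik _ _, hjk _ _, hij _ _, hkj _ _, hki _ _, hji _ _]
  have c2 : Commute (tw w j k) (tw w i k) := by
    simp (maxDischargeDepth := 9) [tw, hik _ _, hjk _ _, hij _ _, hkj _ _, hki _ _, hji _ _]
  have c3 : Commute (tw w j k) (tw w j i) := by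
    simp (maxDischargeDepth := 9) [tw, hik _ _, hjk _ _, hij _ _, hkj _ _, hki _ _, hji _ _]
  have c4 : Commute (rt h w i k) (tw w j k * tw w j i) := by
    rw [tw, tw, ← nexp_add (by
      simp (maxDischargeDepth := 9) [hik _ _, hjk _ _, hij _ _, hkj _ _, hki _ _, hji _ _])
      (nil_N_P hjk hk w) (nil_N_P hji hi w), ← smul_add, ← mul_add]
    refine commute_nexp (Commute.smul_right (Commute.mul_right ?_ ?_) _)
    · simp (maxDischargeDepth := 12) [rt, twInv, rh, tw, hkj _ _, hki _ _, hij _ _]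
    · rw [add_comm]
      exact rt_comm_P hik hi hk
  have c5 : Commute (rh h w i j) (tw w j k * tw w i k) := by
    rw [tw, tw, ← nexp_add (by
      simp (maxDischargeDepth := 9) [hik _ _, hjk _ _, hij _ _, hkj _ _, hki _ _, hji _ _])
      (nil_N_P hjk hk w) (nil_N_P hik hk w), ← smul_add, ← add_mul]
    refine commute_nexp (Commute.smul_right (Commute.mul_right ?_ ?_) _)
    · rw [add_comm]
      exact rh_comm_N hij hi hj
    · simp (maxDischargeDepth := 12) [rh, tw, hik _ _, hjk _ _]
  have i1 := twInv_mul_tw (w := w) hjk hk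
  have i2 := tw_mul_twInv (w := w) hji hi
  have i3 := tw_mul_twInv (w := w) hki hi
  have i4 := twInv_mul_tw (w := w) hji hi
  have i5 := twInv_mul_tw (w := w) hki hi
  have r1 : rh h w i j * tw w i j = tw w j i * rt h w i j := by
    rw [rt, ← mul_assoc, ← mul_assoc, i2, one_mul]
  have r2 : rh h w i k * tw w i k = tw w k i * rt h w i k := by
    rw [rt, ← mul_assoc, ← mul_assoc, i3, one_mul]
  have key : tw w j k * rt h w i (cop h w j k) = tw w j k * (rt h w i k * rt h w i j) := by
    calc tw w j k * rt h w i (cop h w j k)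
        = twInv w j i * twInv w k i * (rh h w i k * rh h w i j * tw w j k) *
            (tw w i j * tw w i k) := by
          rw [rt, f1, ← tw_rh_cop_right hij hik hjk hi hj hk]
          simp only [mul_assoc, lassoc f2]
      _ = twInv w j i * twInv w k i * rh h w i k * (rh h w i j * (tw w j k * tw w i k)) *
            tw w i j := by
          rw [c1.eq]; simp only [mul_assoc]
      _ = twInv w j i * twInv w k i * (rh h w i k * tw w i k) * tw w j k *
            (rh h w i j * tw w i j) := by
          rw [c5.eq, c2.eq]; simp only [mul_assoc]
      _ = twInv w j i * (rt h w i k * (tw w j k * tw w j i)) * rt h w i j := by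
          rw [r1, r2]; simp only [mul_assoc, lassoc i5, one_mul]
      _ = _ := by
          rw [c4.eq, c3.eq]; simp only [mul_assoc, lassoc i4, one_mul]
  have key2 := congrArg (twInv w j k * ·) key
  simpa only [lassoc i1, one_mul] using key2

end Hexagon

/-! ### The ribbon element -/

section Ribbon

variable {B : Type*} [Ring B] [Algebra ℂ B] {h w σ : ℂ} {a : Gen → B}

/-- The normally ordered part of the ribbon element, `∑ k, (2 σ) ^ k e ^ (k σ E) x ^ k A ^ k / k!`
with `x = (1 - e ^ (-w A⁺)) / w`. -/
def nT (w σ : ℂ) (a : Gen → B) : B := nord ((2 * σ) • (eE σ a * xP w a)) (a .A)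

/-- The ribbon element for `σ = -h`, and its inverse for `σ = h`. Its properties rest on
`2 σ e ^ (σ E) sinh (h E) / h = e ^ (2 σ E) - 1`, true for both signs. -/
def thetaG (w σ : ℂ) (a : Gen → B) : B :=
  eE σ a * nT w σ a * nexp (-((2 * σ) • (a .E * a .N)))

theorem twoSided_add_left (y y' t : B) : twoSided (y + y') t = twoSided y t + twoSided y' t := by
  ext; simp [add_mul]

theorem twoSided_add_right (y t t' : B) : twoSided y (t + t') = twoSided y t + twoSided y t' := by
  ext; simp [mul_add]

theorem twoSided_neg_left (y t : B) : twoSided (-y) t = -twoSided y t := by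
  ext; simp

theorem nexp_twoSided_mul_of_commute {y t z : B} (hy : IsNilpotent y) (h : Commute t z) (z' : B) :
    nexp (twoSided y t) (z' * z) = nexp (twoSided y t) z' * z :=
  (nexp_twoSided_mul hy h.eq z').symm

theorem mul_nexp_twoSided_of_commute {y t z : B} (hy : IsNilpotent y) (h : Commute z y) (z' : B) :
    nexp (twoSided y t) (z * z') = z * nexp (twoSided y t) z' :=
  (mul_nexp_twoSided hy hy h.eq z').symm

/-- Moving all right multiplications to the left turns the exponential of a two-sided
multiplication into a left multiplication. -/
theorem nexp_twoSided_eq_mul {y t t' z : B} (hy : IsNilpotent y) (hz : z * t = t' * z)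
    (hc : Commute y t') : nexp (twoSided y t) z = nexp (y * t') * z := by
  obtain ⟨n, hn⟩ := hy
  rw [nexp_twoSided_apply (n := n) (by rw [twoSided_pow, hn]; ext; simp),
    nexp_eq_sum (n := n) (by rw [hc.mul_pow, hn, zero_mul]), Finset.sum_mul]
  refine Finset.sum_congr rfl fun k _ => ?_
  rw [smul_mul_assoc, hc.mul_pow, mul_assoc, (SemiconjBy.pow_right (show SemiconjBy z t t' from hz)
    k).eq, mul_assoc]

namespace OscRel

variable (ha : OscRel h w a)
include ha

theorem smul_sinh_neg : (2 * -h) • (eE (-h) a * nsinh h (a .E)) = eE (2 * -h) a - 1 := by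
  rw [mul_neg, neg_smul, ← mul_smul_comm, ha.smul_sinh, mul_sub, ha.eE_mul, ha.eE_mul,
    ← two_mul, mul_neg]
  simp

theorem nil_eE_x (σ : ℂ) : IsNilpotent ((2 * σ) • (eE σ a * xP w a)) :=
  ((Commute.isNilpotent_mul_left (by simp [ha.commE]) ha.nil_x)).smul _

theorem nil_E_N : IsNilpotent (-((2 * σ) • (a .E * a .N))) :=
  (((ha.commE _).isNilpotent_mul_right ha.nilE).smul _).neg

theorem commute_nT_E : Commute (a .E) (nT w σ a) := by
  obtain ⟨n, hn⟩ := ha.nil_eE_x σ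
  rw [nT, nord_eq_sum hn]
  refine Commute.sum_right _ _ _ fun k _ => Commute.smul_right (Commute.mul_right ?_ ?_) _
  · exact Commute.pow_right (by simp (maxDischargeDepth := 9) [ha.commE]) _
  · exact (ha.commE _).pow_right _

variable (hσ : (2 * σ) • (eE σ a * nsinh h (a .E)) = eE (2 * σ) a - 1)
include hσ

/-- In the summands `y ^ k A ^ k / k!` of the normally ordered part the commutator is central:
`[A, y] = e ^ (2 σ E) - 1`. -/
theorem A_y : a .A * ((2 * σ) • (eE σ a * xP w a)) =
    (2 * σ) • (eE σ a * xP w a) * a .A + (eE (2 * σ) a - 1) := by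
  have c1 : Commute (a .A) (eE σ a) := by simp [ha.commE']
  rw [← hσ, mul_smul_comm, c1.left_comm, ha.A_x, mul_add, smul_add, smul_mul_assoc, mul_assoc]

/-- The normally ordered part rescales `(1 - e ^ (-w A⁺)) / w` by `e ^ (2 σ E)`; the Gaussian factor
compensates this. -/
theorem nT_x : nT w σ a * xP w a = eE (2 * σ) a * xP w a * nT w σ a := by
  have ny := ha.nil_eE_x σ
  rw [nT]
  set y := (2 * σ) • (eE σ a * xP w a) with hy
  have cs : Commute (a .A) (nsinh h (a .E)) := by simp [ha.commE']
  have key := nexp_comm (isNilpotent_twoSided ny (a .A)) (d := LinearMap.mulRight ℂ (xP w a))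
    (c := twoSided y (nsinh h (a .E))) (by
      ext z
      simp only [Module.End.mul_apply, twoSided_apply, LinearMap.mulRight_apply,
        LinearMap.add_apply]
      rw [mul_assoc (y * z), ha.A_x, mul_add]
      simp only [mul_assoc]) (twoSided_commute (Commute.refl y) cs)
  have h1 := LinearMap.congr_fun key 1
  simp only [Module.End.mul_apply, LinearMap.mulRight_apply, twoSided_apply, one_mul, mul_one,
    LinearMap.add_apply, ← map_add] at h1
  have h2 : xP w a + y * nsinh h (a .E) = eE (2 * σ) a * xP w a * 1 := by
    have c1 : Commute (xP w a) (nsinh h (a .E)) := by simp [ha.commE']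
    rw [hy, smul_mul_assoc, mul_assoc, c1.eq, ← mul_assoc, ← smul_mul_assoc, hσ]
    noncomm_ring
  have c2 : Commute (eE (2 * σ) a * xP w a) y := by
    simp (maxDischargeDepth := 9) [hy, ha.commE, ha.commE']
  rw [nord, h1, h2, mul_nexp_twoSided_of_commute ny c2]

/-- The normally ordered part rescales `A` by `e ^ (-2 σ E)`; the Gaussian factor compensates
this. -/
theorem A_nT : a .A * nT w σ a = eE (2 * σ) a * (nT w σ a * a .A) := by
  have ny := ha.nil_eE_x σ
  have hy := ha.A_y hσ
  rw [nT]
  set y := (2 * σ) • (eE σ a * xP w a) with hy'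
  have c2 : Commute (eE (2 * σ) a) y := by
    simp (maxDischargeDepth := 9) [hy', ha.commE, ha.commE']
  have key := nexp_comm (isNilpotent_twoSided ny (a .A)) (d := LinearMap.mulLeft ℂ (a .A))
    (c := twoSided (eE (2 * σ) a - 1) (a .A)) (by
      ext z
      simp only [Module.End.mul_apply, twoSided_apply, LinearMap.mulLeft_apply,
        LinearMap.add_apply]
      rw [← mul_assoc, ← mul_assoc, hy, add_mul, add_mul]
      simp only [mul_assoc])
    (twoSided_commute (c2.symm.sub_right (Commute.one_right _)) (Commute.refl _))
  have h1 := LinearMap.congr_fun key 1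
  simp only [Module.End.mul_apply, LinearMap.mulLeft_apply, twoSided_apply, mul_one,
    LinearMap.add_apply, ← map_add] at h1
  rw [nord, h1, show a .A + (eE (2 * σ) a - 1) * a .A = eE (2 * σ) a * (1 * a .A) by
    noncomm_ring, mul_nexp_twoSided_of_commute ny c2,
    nexp_twoSided_mul_of_commute ny (Commute.refl _)]

omit hσ in
theorem N_nT : Commute (a .N) (nT w σ a) := by
  have ny := ha.nil_eE_x σ
  have hy : a .N * ((2 * σ) • (eE σ a * xP w a)) =
      (2 * σ) • (eE σ a * xP w a) * a .N + (2 * σ) • (eE σ a * xP w a) := by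
    have c1 : Commute (a .N) (eE σ a) := by simp [ha.commE']
    rw [mul_smul_comm, c1.left_comm, ha.N_x, mul_add, smul_add, smul_mul_assoc, mul_assoc]
  rw [nT]
  set y := (2 * σ) • (eE σ a * xP w a) with hy'
  have key := commute_nexp (y := LinearMap.mulLeft ℂ (a .N) - LinearMap.mulRight ℂ (a .N))
    (x := twoSided y (a .A)) (by
      ext z
      simp only [Module.End.mul_apply, twoSided_apply, LinearMap.mulLeft_apply,
        LinearMap.mulRight_apply, LinearMap.sub_apply, mul_sub, sub_mul]
      rw [← mul_assoc, ← mul_assoc, hy, mul_assoc (y * z), ha.A_N]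
      noncomm_ring)
  have h1 := LinearMap.congr_fun key.eq 1
  simp only [Module.End.mul_apply, LinearMap.mulLeft_apply, LinearMap.mulRight_apply,
    LinearMap.sub_apply, one_mul, mul_one, sub_self, map_zero] at h1
  exact sub_eq_zero.mp h1

/-- The product of the normally ordered parts for opposite signs is `1`. -/
theorem nT_mul_nT_neg : nT w σ a * nT w (-σ) a = 1 := by
  have ny := ha.nil_eE_x σ
  have ny' := ha.nil_eE_x (w := w) (-σ)
  have c1 : Commute (nT w σ a) (eE (-σ) a) := (commute_eE_left _ ha.commute_nT_E).symm
  have e : nT w σ a * ((2 * -σ) • (eE (-σ) a * xP w a)) =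
      -((2 * σ) • (eE σ a * xP w a)) * nT w σ a := by
    rw [mul_smul_comm, c1.left_comm, ha.nT_x hσ, ← mul_assoc, ← mul_assoc, ha.eE_mul]
    rw [show -σ + 2 * σ = σ by ring, mul_neg, neg_smul, neg_mul, smul_mul_assoc]
  have h1 := mul_nexp_twoSided (t := a .A) ny' ny.neg e 1
  rw [nT, nT, nord, nord] at *
  rw [h1, mul_one, twoSided_neg_left]
  exact LinearMap.congr_fun (nexp_neg_mul (isNilpotent_twoSided ny (a .A))) 1

omit hσ in
/-- `A` moves past the Gaussian factor `e ^ (-2 σ E N)`. -/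
theorem A_gauss : a .A * nexp (-((2 * σ) • (a .E * a .N))) =
    eE (-(2 * σ)) a * nexp (-((2 * σ) • (a .E * a .N))) * a .A := by
  have n1 := ha.nil_E_N (σ := σ)
  have cq : Commute (-((2 * σ) • a .E)) (-((2 * σ) • (a .E * a .N))) := by
    simp (maxDischargeDepth := 9) [ha.commE]
  rw [eE, neg_smul, ← nexp_add cq (ha.nil_smulE _).neg n1]
  refine nexp_semiconj n1 (cq.isNilpotent_add (ha.nil_smulE _).neg n1) ?_
  rw [mul_neg, mul_smul_comm, (ha.commE' _).left_comm, ha.A_N, add_mul, neg_mul, neg_mul,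
    smul_mul_assoc, smul_mul_assoc, mul_add, smul_add, neg_add, mul_assoc]
  abel

omit hσ in
/-- `(1 - e ^ (-w A⁺)) / w` moves past the Gaussian factor `e ^ (-2 σ E N)`. -/
theorem x_gauss : xP w a * nexp (-((2 * σ) • (a .E * a .N))) =
    eE (2 * σ) a * nexp (-((2 * σ) • (a .E * a .N))) * xP w a := by
  have n1 := ha.nil_E_N (σ := σ)
  have cq : Commute ((2 * σ) • a .E) (-((2 * σ) • (a .E * a .N))) := by
    simp (maxDischargeDepth := 9) [ha.commE]
  have cx : Commute (xP w a) (a .E) := by simp [ha.commE']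
  rw [eE, ← nexp_add cq (ha.nil_smulE _) n1]
  refine nexp_semiconj n1 (cq.isNilpotent_add (ha.nil_smulE _) n1) ?_
  rw [mul_neg, mul_smul_comm, cx.left_comm, ← sub_eq_of_eq_add ha.N_x]
  simp only [add_mul, neg_mul, smul_mul_assoc, mul_sub, smul_sub, mul_assoc]
  abel

theorem thetaG_comm_A : Commute (thetaG w σ a) (a .A) := by
  have c1 : Commute (a .A) (eE σ a) := by simp [ha.commE']
  have c2 : Commute (nT w σ a) (eE (-(2 * σ)) a) := (commute_eE_left _ ha.commute_nT_E).symm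
  refine Eq.symm ?_
  show a .A * thetaG w σ a = _ * a .A
  rw [thetaG, mul_assoc, c1.left_comm, lassoc (ha.A_nT hσ), mul_assoc, mul_assoc,
    ha.A_gauss, mul_assoc, c2.left_comm, lassoc (ha.eE_mul _ _), lassoc (ha.eE_mul _ _)]
  simp [mul_assoc]

theorem thetaG_comm_x : Commute (thetaG w σ a) (xP w a) := by
  have c1 : Commute (xP w a) (eE σ a) := by simp [ha.commE']
  have c2 : Commute (nT w σ a) (eE (2 * σ) a) := (commute_eE_left _ ha.commute_nT_E).symm
  refine Eq.symm ?_
  have e := ha.x_gauss (σ := σ)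
  have e2 := ha.nT_x hσ
  have c3 : Commute (eE (2 * σ) a) (xP w a) := by simp [ha.commE]
  -- both orders equal `e ^ (σ E) T x e ^ (-2 σ E N)` up to the same central factor
  have h1 : nexp (-((2 * σ) • (a .E * a .N))) * xP w a =
      eE (-(2 * σ)) a * (xP w a * nexp (-((2 * σ) • (a .E * a .N)))) := by
    rw [e, ← mul_assoc, ← mul_assoc, ha.eE_mul]; simp
  have h2 : xP w a * nT w σ a = eE (-(2 * σ)) a * (nT w σ a * xP w a) := by
    rw [e2, ← mul_assoc, ← mul_assoc, ha.eE_mul]; simp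
  have c4 : Commute (nT w σ a) (eE (-(2 * σ)) a) := (commute_eE_left _ ha.commute_nT_E).symm
  rw [thetaG, mul_assoc, c1.left_comm, lassoc h2, mul_assoc, mul_assoc, mul_assoc, mul_assoc, h1,
    c4.left_comm]

/-- The ribbon element is central. -/
theorem thetaG_comm (g : Gen) : Commute (thetaG w σ a) (a g) := by
  have gN : Commute (a .N) (nexp (-((2 * σ) • (a .E * a .N)))) := by
    simp (maxDischargeDepth := 9) [ha.commE']
  have gE : Commute (a .E) (nexp (-((2 * σ) • (a .E * a .N)))) := by
    simp (maxDischargeDepth := 9) [ha.commE]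
  cases g with
  | N =>
    exact (((show Commute (a .N) (eE σ a) by simp [ha.commE']).mul_right ha.N_nT).mul_right
      gN).symm
  | E =>
    exact (((show Commute (a .E) (eE σ a) by simp).mul_right ha.commute_nT_E).mul_right gE).symm
  | A => exact ha.thetaG_comm_A hσ
  | Ap => exact commute_of_commute_nesd (-w) ha.nilP (ha.thetaG_comm_x hσ)

/-- Opposite signs of `σ` give inverse elements. -/
theorem thetaG_mul_neg : thetaG w σ a * thetaG w (-σ) a = 1 := by
  have n1 := ha.nil_E_N (σ := σ)
  set K := nexp (-((2 * σ) • (a .E * a .N))) with hK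
  have e1 : nexp (-((2 * -σ) • (a .E * a .N))) = nexp (-(-((2 * σ) • (a .E * a .N)))) := by
    congr 1; module
  have cE : Commute K (eE (-σ) a) := by simp (maxDischargeDepth := 9) [hK, ha.commE']
  have cT : Commute K (nT w (-σ) a) := by
    refine commute_nexp_left (Commute.neg_left (Commute.smul_left ?_ _))
    exact (ha.commute_nT_E).mul_left ha.N_nT
  have cE2 : Commute (nT w σ a) (eE (-σ) a) := (commute_eE_left _ ha.commute_nT_E).symm
  rw [thetaG, thetaG, e1]
  simp only [mul_assoc]
  rw [cE.left_comm, cT.left_comm, nexp_mul_neg n1, mul_one, cE2.left_comm, ha.nT_mul_nT_neg hσ,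
    mul_one, ha.eE_mul]
  simp

end OscRel

end Ribbon

/-! ### The coproduct of the ribbon element -/

section RibbonCoproduct

variable {B : Type*} [Ring B] [Algebra ℂ B] {h w : ℂ} {i j : Gen → B}

theorem nord_semiconj {u y y' t t' : B} (ny : IsNilpotent y) (ny' : IsNilpotent y')
    (hy : u * y = y' * u) (ht : u * t = t' * u) : u * nord y t = nord y' t' * u := by
  obtain ⟨n, hn⟩ := ny
  obtain ⟨m, hm⟩ := ny'
  rw [nord_eq_sum (pow_eq_zero_of_le (le_max_left n m) hn),
    nord_eq_sum (pow_eq_zero_of_le (le_max_right n m) hm), Finset.mul_sum, Finset.sum_mul]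
  refine Finset.sum_congr rfl fun k _ => ?_
  have h1 : SemiconjBy u y y' := hy
  have h2 : SemiconjBy u t t' := ht
  rw [mul_smul_comm, smul_mul_assoc, ← mul_assoc, (h1.pow_right k).eq, mul_assoc,
    (h2.pow_right k).eq, mul_assoc]

/-- A factor commuting with both arguments may be moved from one to the other. -/
theorem nord_move {y t c : B} (ny : IsNilpotent y) (hy : Commute c y) (ht : Commute c t) :
    nord (c * y) t = nord y (c * t) := by
  obtain ⟨n, hn⟩ := ny
  rw [nord_eq_sum hn, nord_eq_sum (n := n) (by rw [hy.mul_pow, hn, mul_zero])]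
  refine Finset.sum_congr rfl fun k _ => ?_
  rw [hy.mul_pow, ht.mul_pow, (hy.pow_pow k k).eq, mul_assoc]

theorem commute_nord {u y t : B} (hy : Commute u y) (ht : Commute u t) :
    Commute u (nord y t) := by
  have h1 : Commute (LinearMap.mulLeft ℂ u - LinearMap.mulRight ℂ u) (twoSided y t) := by
    ext z
    simp only [Module.End.mul_apply, twoSided_apply, LinearMap.mulLeft_apply,
      LinearMap.mulRight_apply, LinearMap.sub_apply, mul_sub, sub_mul]
    rw [← mul_assoc, ← mul_assoc, hy.eq, mul_assoc (y * z), ← ht.eq]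
    simp only [mul_assoc]
  have h2 := LinearMap.congr_fun (commute_nexp h1).eq 1
  simp only [Module.End.mul_apply, LinearMap.mulLeft_apply, LinearMap.mulRight_apply,
    LinearMap.sub_apply, one_mul, mul_one, sub_self, map_zero] at h2
  exact sub_eq_zero.mp h2

variable (hij : Legs i j) (hi : OscRel h w i) (hj : OscRel h w j)
include hij hi hj

/-- Conjugation by the second exponential of the R-matrix shifts `(1 - e ^ (-w A⁺)) / w ⊗ 1`. -/
theorem exp_A_x_comm_x :
    nexp ((2 * h) • (eE h i * i .A * xP w j)) * xP w i =
      (xP w i + (eE (2 * h) i - 1) * xP w j) * nexp ((2 * h) • (eE h i * i .A * xP w j)) := by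
  have hji := hij.symm
  have c0 : Commute (eE h i * i .A) (xP w j) := by simp (maxDischargeDepth := 6) [hij _ _]
  have nil := nil_A_x hj (2 * h) (eE h i * i .A) c0
  have ca : Commute (xP w i) (eE h i) := by simp [hi.commE']
  have cab : Commute (xP w i) (xP w j) := by simp [hij _ _]
  have k2 : Commute (nexp ((2 * h) • (eE h i * i .A * xP w j))) ((eE (2 * h) i - 1) * xP w j) := by
    simp (maxDischargeDepth := 8) [hij _ _, hji _ _, hi.commE, hi.commE', Commute.sub_right]
  have k1 := nexp_comm nil (d := xP w i) (c := -((eE (2 * h) i - 1) * xP w j)) (by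
      rw [← eE_smul_sinh hi, mul_smul_comm, ← mul_assoc, ← mul_assoc, ca.eq,
        mul_assoc (eE h i), ← sub_eq_of_eq_add hi.A_x, smul_mul_assoc, smul_mul_assoc,
        ← smul_neg, ← smul_add, mul_assoc _ _ (xP w i), ← cab.eq]
      congr 1
      noncomm_ring)
    (by simp (maxDischargeDepth := 8) [hij _ _, hji _ _, hi.commE, hi.commE', Commute.sub_right])
  rw [mul_neg, k2.eq] at k1
  rw [add_mul, k1]
  abel

/-- `Δ(θ)` before the twist: the normally ordered part for the untwisted coproduct, against the
second exponential of the R-matrix. -/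
theorem exp_mul_nord_cop :
    nexp ((2 * h) • (eE h i * i .A * xP w j)) *
        nord ((2 * -h) • (eE (-h) i * eE (-h) j * (xP w i + xP w j))) (copA h i j) =
      nexp (-((2 * h) • (eE (-(2 * h)) i * (eE h j * j .A * xP w i)))) *
        (nT w (-h) i * nT w (-h) j) := by
  have hji := hij.symm
  have ei := hi.commE
  have ei' := hi.commE'
  have ej := hj.commE
  have ej' := hj.commE'
  have cx : Commute (xP w i) (xP w j) := by simp [hij _ _]
  have nx := hi.nil_x
  have nx' := hj.nil_x
  set B1 := (2 * -h) • (eE (-h) i * i .A) with hB1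
  set B2 := (2 * -h) • (eE (-h) i * (eE (-h) i * (eE (-h) j * j .A))) with hB2
  have cB : Commute B1 B2 := by
    simp (maxDischargeDepth := 12) [hB1, hB2, hij _ _, hji _ _, ei, ei', ej, ej']
  have c0 : Commute (eE h i * i .A) (xP w j) := by simp (maxDischargeDepth := 6) [hij _ _]
  have nil := nil_A_x hj (2 * h) (eE h i * i .A) c0
  set G := nexp ((2 * h) • (eE h i * i .A * xP w j)) with hG
  -- all central factors are moved to the right
  have hT : nord ((2 * -h) • (eE (-h) i * eE (-h) j * (xP w i + xP w j))) (copA h i j) =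
      nord (xP w i + xP w j) (B1 + B2) := by
    have q1 : Commute ((2 * -h) • (eE (-h) i * eE (-h) j)) (xP w i + xP w j) := by
      simp (maxDischargeDepth := 12) [hij _ _, hji _ _, ei, ej]
    have q2 : Commute ((2 * -h) • (eE (-h) i * eE (-h) j)) (copA h i j) := by
      simp (maxDischargeDepth := 12) [copA, hij _ _, hji _ _, ei, ej]
    rw [← smul_mul_assoc, nord_move (cx.isNilpotent_add nx nx') q1 q2]
    congr 1
    have q3 : Commute (i .A) (eE h j) := by simp [hij _ _]
    have q4 : Commute (eE (-h) j) (eE (-h) i) := by simp [hji _ _]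
    rw [copA, q3.eq, smul_mul_assoc, mul_add, hB1, hB2, ← smul_add]
    simp only [mul_assoc, lassoc (hj.eE_mul _ _), q4.left_comm]
    simp
  have hT1 : nT w (-h) i = nord (xP w i) B1 := by
    rw [nT, ← smul_mul_assoc, nord_move nx (by simp (maxDischargeDepth := 6) [ei])
      (by simp (maxDischargeDepth := 6) [ei]), smul_mul_assoc]
  have hT2 : nT w (-h) j = nord (eE (2 * h) i * xP w j) B2 := by
    rw [nT, ← smul_mul_assoc, nord_move nx' (by simp (maxDischargeDepth := 6) [ej])
        (by simp (maxDischargeDepth := 6) [ej]),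
      nord_move nx' (by simp [hij _ _]) (by
        simp (maxDischargeDepth := 12) [hB2, hij _ _, hji _ _, ei]), hB2, mul_smul_comm]
    congr 2
    simp only [lassoc (hi.eE_mul _ _)]
    rw [show 2 * h + (-h + -h) = 0 by ring, eE_zero, one_mul, smul_mul_assoc]
  rw [hT]
  -- splitting the normally ordered exponential into four commuting parts
  have n11 := isNilpotent_twoSided nx B1
  have n12 := isNilpotent_twoSided nx B2
  have n21 := isNilpotent_twoSided nx' B1
  have n22 := isNilpotent_twoSided nx' B2
  have k12_21 := twoSided_commute cx cB.symm
  have k12_11 := twoSided_commute (Commute.refl (xP w i)) cB.symm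
  have k12_22 := twoSided_commute cx (Commute.refl B2)
  have k21_11 := twoSided_commute cx.symm (Commute.refl B1)
  have k21_22 := twoSided_commute (Commute.refl (xP w j)) cB
  have k11_22 := twoSided_commute cx cB
  have hsplit : nord (xP w i + xP w j) (B1 + B2) =
      nexp (twoSided (xP w i) B2) (nexp (twoSided (xP w j) B1)
        (nexp (twoSided (xP w i) B1) (nord (xP w j) B2))) := by
    rw [nord, twoSided_add_left, twoSided_add_right, twoSided_add_right,
      show twoSided (xP w i) B1 + twoSided (xP w i) B2 +
        (twoSided (xP w j) B1 + twoSided (xP w j) B2) = twoSided (xP w i) B2 +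
        (twoSided (xP w j) B1 + (twoSided (xP w i) B1 + twoSided (xP w j) B2)) by abel,
      nexp_add (k12_21.add_right (k12_11.add_right k12_22)) n12
        ((k21_11.add_right k21_22).isNilpotent_add n21 (k11_22.isNilpotent_add n11 n22)),
      nexp_add (k21_11.add_right k21_22) n21 (k11_22.isNilpotent_add n11 n22),
      nexp_add k11_22 n11 n22]
    rfl
  have cT2' : Commute B1 (nord (xP w j) B2) :=
    commute_nord (by simp (maxDischargeDepth := 12) [hB1, hij _ _, hji _ _, ei]) cB
  have h11 : nexp (twoSided (xP w i) B1) (nord (xP w j) B2) = nT w (-h) i * nord (xP w j) B2 := by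
    conv_lhs => rw [← one_mul (nord (xP w j) B2)]
    rw [nexp_twoSided_mul_of_commute nx cT2', ← nord, hT1]
  -- the part `x₂ B₁` cancels the second exponential of the R-matrix
  have h21 : nexp (twoSided (xP w j) B1) (nT w (-h) i * nord (xP w j) B2) =
      nexp (-((2 * h) • (eE h i * i .A * xP w j))) * (nT w (-h) i * nord (xP w j) B2) := by
    have hA : i .A * nT w (-h) i = eE (2 * -h) i * (nT w (-h) i * i .A) :=
      hi.A_nT hi.smul_sinh_neg
    have hA' : nT w (-h) i * i .A = eE (2 * h) i * i .A * nT w (-h) i := by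
      rw [mul_assoc, hA, lassoc (hi.eE_mul _ _)]; simp
    have c1 : Commute (nT w (-h) i) (eE (-h) i) := (commute_eE_left _ hi.commute_nT_E).symm
    rw [nexp_twoSided_eq_mul (t' := -((2 * h) • (eE h i * i .A))) nx' _ _]
    · congr 2
      rw [mul_neg, mul_smul_comm, c0.eq]
    · rw [mul_assoc, ← cT2'.eq, ← mul_assoc, ← mul_assoc]
      congr 1
      rw [hB1, mul_smul_comm, c1.left_comm, hA', ← mul_assoc, ← mul_assoc, hi.eE_mul,
        show -h + 2 * h = h by ring, neg_mul, smul_mul_assoc, mul_neg, neg_smul]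
    · simp (maxDischargeDepth := 12) [hij _ _, hji _ _, ei]
  rw [hsplit, h11, h21]
  have hshift := exp_A_x_comm_x hij hi hj
  rw [← hG] at hshift
  have cz : Commute (xP w i) ((eE (2 * h) i - 1) * xP w j) := by
    simp (maxDischargeDepth := 12) [hij _ _, hji _ _, ei', Commute.sub_right]
  have cu : Commute (eE (2 * h) i - 1) (xP w j) := by
    simp (maxDischargeDepth := 12) [hij _ _, Commute.sub_left]
  have nu : IsNilpotent ((eE (2 * h) i - 1) * xP w j) := cu.isNilpotent_mul_left nx'
  rw [mul_nexp_twoSided nx (cz.isNilpotent_add nx nu) hshift, ← mul_assoc, hG, nexp_mul_neg nil,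
    one_mul, twoSided_add_left, nexp_add (twoSided_commute cz (Commute.refl B2))
      n12 (isNilpotent_twoSided nu B2)]
  -- the shifted part completes the second normally ordered factor
  have cT1 : Commute (nT w (-h) i) ((eE (2 * h) i - 1) * xP w j) := by
    refine Commute.mul_right ?_ ?_
    · exact ((commute_eE_left _ hi.commute_nT_E).symm).sub_right (Commute.one_right _)
    · rw [hT1]
      exact (commute_nord cx.symm (by simp (maxDischargeDepth := 9) [hB1, hji _ _])).symm
  have h22 : nexp (twoSided ((eE (2 * h) i - 1) * xP w j) B2)
      (nT w (-h) i * nord (xP w j) B2) = nT w (-h) i * nT w (-h) j := by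
    rw [mul_nexp_twoSided_of_commute nu cT1, hT2, nord, nord, ← Module.End.mul_apply,
      ← nexp_add _ (isNilpotent_twoSided nu B2) n22, ← twoSided_add_left]
    · congr 4
      noncomm_ring
    · exact twoSided_commute (by
        simp (maxDischargeDepth := 12) [hij _ _, Commute.sub_left]) (Commute.refl B2)
  rw [Module.End.mul_apply, h22]
  have hA : j .A * nT w (-h) j = eE (2 * -h) j * (nT w (-h) j * j .A) :=
    hj.A_nT hj.smul_sinh_neg
  have hA' : nT w (-h) j * j .A = eE (2 * h) j * j .A * nT w (-h) j := by
    rw [mul_assoc, hA, lassoc (hj.eE_mul _ _)]; simp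
  have c1 : Commute (nT w (-h) j) (eE (-h) j) := (commute_eE_left _ hj.commute_nT_E).symm
  have c2 : Commute (eE (-h) i) (nT w (-h) j) :=
    commute_nord (by simp (maxDischargeDepth := 9) [hij _ _]) (by simp [hij _ _])
  have c3 : Commute (eE (-(2 * h)) i * (eE h j * j .A)) (nT w (-h) i) :=
    commute_nord (by simp (maxDischargeDepth := 12) [hji _ _, ei]) (by
      simp (maxDischargeDepth := 9) [hji _ _, ei])
  rw [nexp_twoSided_eq_mul (t' := -((2 * h) • (eE (-(2 * h)) i * (eE h j * j .A)))) nx _ _]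
  · congr 2
    have q : Commute (xP w i) (eE (-(2 * h)) i * (eE h j * j .A)) := by
      simp (maxDischargeDepth := 12) [hij _ _, ei']
    rw [mul_neg, mul_smul_comm, q.eq, mul_assoc]
  · have : nT w (-h) j * B2 =
        -((2 * h) • (eE (-(2 * h)) i * (eE h j * j .A))) * nT w (-h) j := by
      rw [hB2, mul_smul_comm, c2.symm.left_comm, c2.symm.left_comm, c1.left_comm, hA']
      simp only [← mul_assoc, hi.eE_mul, neg_mul, smul_mul_assoc, mul_neg, neg_smul]
      simp only [mul_assoc, lassoc (hj.eE_mul _ _)]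
      rw [show -h + 2 * h = h by ring, show -h + -h = -(2 * h) by ring]
    rw [mul_assoc, this, ← mul_assoc, ((c3.smul_left (2 * h)).neg_left).symm.eq, mul_assoc]
  · simp (maxDischargeDepth := 12) [hij _ _, hji _ _, ei']

/-- The twist conjugates `Δ(θ)` to the same series for the untwisted coproduct. -/
theorem tw_thetaG_cop :
    tw w i j * thetaG w (-h) (cop h w i j) =
      eE (-h) i * eE (-h) j *
        nord ((2 * -h) • (eE (-h) i * eE (-h) j * (xP w i + xP w j))) (copA h i j) *
        nexp (-((2 * -h) • ((i .E + j .E) * (i .N + j .N)))) * tw w i j := by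
  have hji := hij.symm
  have oc := oscRel_cop hij hi hj
  have t1 := tw_comm_E hij hi hj
  have cx : Commute (xP w i) (xP w j) := by simp [hij _ _]
  have cE : Commute (i .E + j .E) (i .N + j .N) := by
    simp (maxDischargeDepth := 9) [hij _ _, hji _ _, hi.commE, hj.commE]
  have q1 : Commute (tw w i j) (eE (-h) i * eE (-h) j) := by
    simp (maxDischargeDepth := 9) [t1.1.symm, t1.2.symm]
  have q2 : Commute (eE (-h) i * eE (-h) j) (xP w i + xP w j) := by
    simp (maxDischargeDepth := 9) [hij _ _, hji _ _, hi.commE, hj.commE]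
  have e1 := nord_semiconj (u := tw w i j) (oc.nil_eE_x (-h))
    (y' := (2 * -h) • (eE (-h) i * eE (-h) j * (xP w i + xP w j)))
    ((q2.isNilpotent_mul_left (cx.isNilpotent_add hi.nil_x hj.nil_x)).smul _)
    (by rw [mul_smul_comm, eE_cop hij hi hj, ← mul_assoc, q1.eq, mul_assoc,
          tw_cop_x hij hi hj, smul_mul_assoc, ← mul_assoc])
    (tw_cop_A hij hi hj)
  have e2 := nexp_semiconj (a := tw w i j) (oc.nil_E_N (σ := -h))
    (y := -((2 * -h) • ((i .E + j .E) * (i .N + j .N))))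
    (((cE.isNilpotent_mul_right ((hij _ _).isNilpotent_add hi.nilE hj.nilE)).smul _).neg)
    (by
      have q3 : Commute (tw w i j) (i .E + j .E) := (t1.1.add_left t1.2).symm
      rw [mul_neg, mul_smul_comm, ← mul_assoc, show cop h w i j .E = i .E + j .E from rfl,
        q3.eq, mul_assoc, tw_cop_N hij hj, neg_mul, smul_mul_assoc, mul_assoc])
  rw [thetaG, eE_cop hij hi hj, ← mul_assoc, ← mul_assoc, q1.eq, mul_assoc _ (tw w i j), nT, e1,
    ← mul_assoc, mul_assoc _ (tw w i j), e2, ← mul_assoc]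

theorem commute_thetaG_leg (σ : ℂ) (g : Gen) : Commute (thetaG w σ i) (j g) := by
  have hji := hij.symm
  have : Commute (j g) (nT w σ i) :=
    commute_nord (by simp (maxDischargeDepth := 9) [hji _ _]) (hji _ _)
  unfold thetaG
  simp (maxDischargeDepth := 9) [this.symm, hij _ _]

/-- `R₂₁ R Δ(θ) = θ ⊗ θ` for the untwisted R-matrix and coproduct. -/
theorem rh_rh_theta :
    rh h w j i * rh h w i j * (eE (-h) i * eE (-h) j *
        nord ((2 * -h) • (eE (-h) i * eE (-h) j * (xP w i + xP w j))) (copA h i j) *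
        nexp (-((2 * -h) • ((i .E + j .E) * (i .N + j .N))))) =
      thetaG w (-h) i * thetaG w (-h) j := by
  have hji := hij.symm
  have ei := hi.commE
  have ei' := hi.commE'
  have ej := hj.commE
  have ej' := hj.commE'
  have key := exp_mul_nord_cop hij hi hj
  set M := nord ((2 * -h) • (eE (-h) i * eE (-h) j * (xP w i + xP w j))) (copA h i j)
  set K := nexp (-((2 * -h) • ((i .E + j .E) * (i .N + j .N)))) with hK
  set G := nexp ((2 * h) • (eE h i * i .A * xP w j)) with hG
  set G' := nexp ((2 * h) • (eE h j * j .A * xP w i)) with hG'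
  set P := nexp (-((2 * h) • (i .E * j .N))) with hP
  set P' := nexp (-((2 * h) • (j .E * i .N))) with hP'
  set T := nT w (-h) i
  set T' := nT w (-h) j
  have cA : Commute (eE h j * j .A) (xP w i) := by simp (maxDischargeDepth := 6) [hji _ _]
  have cB : Commute (eE (-(2 * h)) i * (eE h j * j .A)) (xP w i) := by
    simp (maxDischargeDepth := 9) [hji _ _, ei]
  have nG := nil_A_x hi (2 * h) _ cA
  have nG' := nil_A_x hi (2 * h) _ cB
  have nP := (nil_E_N (b := j) hij hi (2 * h)).neg
  have nP' := (nil_E_N (b := i) hji hj (2 * h)).neg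
  -- the first exponential of one R-matrix moves past the second one of the other
  have m1 : G' * P = P * nexp ((2 * h) • (eE (-(2 * h)) i * (eE h j * j .A) * xP w i)) := by
    refine (nexp_semiconj nG' nG ?_).symm
    have q0 : j .A * P = eE (-(2 * h)) i * P * j .A := by
      have cq : Commute (-((2 * h) • i .E)) (-((2 * h) • (i .E * j .N))) := by
        simp (maxDischargeDepth := 6) [hij _ _]
      rw [eE, neg_smul, hP, ← nexp_add cq (hi.nil_smulE _).neg nP]
      refine nexp_semiconj nP (cq.isNilpotent_add (hi.nil_smulE _).neg nP) ?_
      rw [mul_neg, mul_smul_comm, (hji _ _).left_comm, hj.A_N, add_mul, neg_mul, neg_mul,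
        smul_mul_assoc, smul_mul_assoc, mul_add, smul_add, neg_add, mul_assoc]
      abel
    have q1 : Commute (eE h j) P := by simp (maxDischargeDepth := 9) [hP, hji _ _, ej]
    have q2 : Commute (eE (-(2 * h)) i) P := by simp (maxDischargeDepth := 9) [hP, hij _ _]
    have q3 : Commute (xP w i) P := by simp (maxDischargeDepth := 9) [hP, hij _ _, ei']
    have q4 : Commute (eE h j) (eE (-(2 * h)) i) := by simp [hji _ _]
    rw [mul_smul_comm, smul_mul_assoc]
    congr 1
    simp only [mul_assoc]
    rw [q3.eq, lassoc q0, q2.symm.left_comm, q1.symm.left_comm]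
    simp only [mul_assoc]
    rw [q4.left_comm]
  have m2 : nexp ((2 * h) • (eE (-(2 * h)) i * (eE h j * j .A) * xP w i)) * (G * M) = T * T' := by
    rw [key, ← mul_assoc, ← mul_assoc (eE (-(2 * h)) i), ← mul_assoc (eE (-(2 * h)) i)]
    have := nexp_mul_neg nG'
    simp only [← mul_assoc] at this ⊢
    rw [this, one_mul]
  -- central factors
  have c1 (c : ℂ) : Commute (G * P) (eE c i) := by
    simp (maxDischargeDepth := 9) [hG, hP, hij _ _, hji _ _, ei, ei', ej, ej']
  have e1 : Commute (P' * G' * (P * G)) (eE (-h) i * eE (-h) j) := by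
    simp (maxDischargeDepth := 9) [hG, hP, hG', hP', hij _ _, hji _ _, ei, ei', ej, ej']
  have cN : Commute (j .N) T :=
    commute_nord (by simp (maxDischargeDepth := 9) [hji _ _]) (hji _ _)
  have cN' : Commute (i .N) T' :=
    commute_nord (by simp (maxDischargeDepth := 9) [hij _ _]) (hij _ _)
  have cE : Commute (j .E) T :=
    commute_nord (by simp (maxDischargeDepth := 9) [hji _ _]) (hji _ _)
  have cE' : Commute (i .E) T' :=
    commute_nord (by simp (maxDischargeDepth := 9) [hij _ _]) (hij _ _)
  have d1 : Commute (P' * P) (T * T') := by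
    have a1 : Commute (i .E) T := hi.commute_nT_E
    have a2 : Commute (j .E) T' := hj.commute_nT_E
    have a3 : Commute (i .N) T := hi.N_nT
    have a4 : Commute (j .N) T' := hj.N_nT
    simp (maxDischargeDepth := 9) [hP, hP', a1, a2, a3, a4, cN, cN', cE, cE']
  set k := nexp (-((2 * -h) • (i .E * i .N))) with hk
  set k' := nexp (-((2 * -h) • (j .E * j .N))) with hk'
  have d2 : P' * P * K = k * k' := by
    have z1 : Commute (-((2 * h) • (j .E * i .N))) (-((2 * h) • (i .E * j .N))) := by
      simp (maxDischargeDepth := 9) [hij _ _, hji _ _, ei, ei', ej, ej']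
    have z2 : Commute (-((2 * h) • (j .E * i .N)) + -((2 * h) • (i .E * j .N)))
        (-((2 * -h) • ((i .E + j .E) * (i .N + j .N)))) := by
      simp (maxDischargeDepth := 12) [hij _ _, hji _ _, ei, ei', ej, ej']
    have z3 : Commute (-((2 * -h) • (i .E * i .N))) (-((2 * -h) • (j .E * j .N))) := by
      simp (maxDischargeDepth := 9) [hij _ _, hji _ _]
    have z4 : Commute (i .E + j .E) (i .N + j .N) := by
      simp (maxDischargeDepth := 9) [hij _ _, hji _ _, ei, ej]
    rw [hP, hP', hK, hk, hk', ← nexp_add z1 nP' nP, ← nexp_add z2 (z1.isNilpotent_add nP' nP)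
      ((z4.isNilpotent_mul_right ((hij _ _).isNilpotent_add hi.nilE hj.nilE)).smul _).neg,
      ← nexp_add z3 hi.nil_E_N hj.nil_E_N]
    congr 1
    simp only [add_mul, mul_add]
    module
  have d3 : Commute k T' := by
    simp (maxDischargeDepth := 9) [hk, cN', cE']
  have d4 : Commute k (eE (-h) j) := by simp (maxDischargeDepth := 9) [hk, hij _ _]
  have d5 : Commute T (eE (-h) j) := (commute_eE_left _ cE).symm
  calc rh h w j i * rh h w i j * (eE (-h) i * eE (-h) j * M * K)
      = (P' * G' * (P * G) * (eE (-h) i * eE (-h) j)) * (M * K) := by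
        rw [rh, rh]; simp only [mul_assoc, hG, hG', hP, hP']
    _ = eE (-h) i * eE (-h) j * (P' * (G' * P) * (G * M) * K) := by
        rw [e1.eq]; simp only [mul_assoc]
    _ = eE (-h) i * eE (-h) j * (P' * P * (T * T') * K) := by
        rw [m1, ← m2]; simp only [mul_assoc]
    _ = eE (-h) i * eE (-h) j * (T * T') * (k * k') := by
        rw [d1.eq, mul_assoc, mul_assoc (T * T'), d2]
        simp only [mul_assoc]
    _ = thetaG w (-h) i * thetaG w (-h) j := by
        rw [thetaG, thetaG]
        simp only [mul_assoc]
        rw [d4.left_comm, d3.left_comm, d5.left_comm]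

/-- `R₂₁ R Δ(θ) = θ ⊗ θ`. -/
theorem rt_rt_thetaG_cop :
    rt h w j i * rt h w i j * thetaG w (-h) (cop h w i j) =
      thetaG w (-h) i * thetaG w (-h) j := by
  have hji := hij.symm
  have i1 := tw_mul_twInv (w := w) hji hi
  have i2 := twInv_mul_tw (w := w) hij hj
  have c1 (g : Gen) : Commute (thetaG w (-h) i * thetaG w (-h) j) (i g) :=
    (hi.thetaG_comm hi.smul_sinh_neg g).mul_left (commute_thetaG_leg hji hj hi (-h) g)
  have c2 (g : Gen) : Commute (thetaG w (-h) i * thetaG w (-h) j) (j g) :=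
    (commute_thetaG_leg hij hi hj (-h) g).mul_left (hj.thetaG_comm hj.smul_sinh_neg g)
  have c3 : Commute (thetaG w (-h) i * thetaG w (-h) j) (tw w i j) :=
    commute_nexp (((c1 _).mul_right (c2 _)).smul_right _)
  have key := rh_rh_theta hij hi hj
  have e1 : rt h w j i * rt h w i j = twInv w i j * (rh h w j i * rh h w i j) * tw w i j := by
    show twInv w i j * rh h w j i * tw w j i * (twInv w j i * rh h w i j * tw w i j) = _
    simp only [mul_assoc, lassoc i1, one_mul]
  rw [e1, mul_assoc, tw_thetaG_cop hij hi hj, ← mul_assoc, mul_assoc (twInv w i j), key, mul_assoc,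
    c3.eq, lassoc i2, one_mul]

end RibbonCoproduct

/-! ### Antinormal and normal ordering -/

section Ordering

variable {B : Type*} [Ring B] [Algebra ℂ B] {y t S : B}

theorem pow_mul_of_comm (h : t * y = y * t + S) (ht : Commute t S) (l : ℕ) :
    t ^ (l + 1) * y = y * t ^ (l + 1) + ((l + 1 : ℕ) : ℂ) • (t ^ l * S) := by
  have := comm_pow_of_comm (d := y) (x := t) (c := -S) (by rw [h]; abel) ht.neg_right l
  rw [this, mul_neg, smul_neg]; abel

/-- The antinormally ordered monomials satisfy a first order recursion in `y t`, the factor being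
put on the left. -/
theorem antinormal_succ (h : t * y = y * t + S) (ht : Commute t S) (l : ℕ) :
    t ^ (l + 1) * y ^ (l + 1) = (y * t + ((l + 1 : ℕ) : ℂ) • S) * (t ^ l * y ^ l) := by
  rw [pow_succ' y, ← mul_assoc, pow_mul_of_comm h ht, (ht.pow_left l).eq, pow_succ' t]
  simp only [add_mul, smul_mul_assoc, mul_assoc]

/-- The normally ordered monomials satisfy a first order recursion in `y t`, the factor being put on
the right. -/
theorem normal_succ (h : t * y = y * t + S) (ht : Commute t S) (l : ℕ) :
    y ^ (l + 1) * t ^ (l + 1) = y ^ l * t ^ l * (y * t - (l : ℂ) • S) := by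
  have h1 : t ^ l * (y * t) = y * t ^ (l + 1) + (l : ℂ) • (t ^ l * S) := by
    rw [eq_sub_of_add_eq h.symm, mul_sub, ← mul_assoc, ← pow_succ, pow_mul_of_comm h ht]
    push_cast
    module
  rw [mul_sub, mul_assoc, h1, mul_add, ← mul_assoc, ← pow_succ, mul_smul_comm, mul_smul_comm,
    ← mul_assoc]
  abel

theorem commute_antinormal (h : t * y = y * t + S) (ht : Commute t S) (hy : Commute y S)
    (l : ℕ) : Commute (y * t) (t ^ l * y ^ l) := by
  induction l with
  | zero => simp
  | succ l ih =>
    rw [antinormal_succ h ht]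
    exact Commute.mul_right ((Commute.refl _).add_right ((hy.mul_left ht).smul_right _)) ih

theorem commute_normal (h : t * y = y * t + S) (ht : Commute t S) (hy : Commute y S)
    (l : ℕ) : Commute (y * t) (y ^ l * t ^ l) := by
  induction l with
  | zero => simp
  | succ l ih =>
    rw [normal_succ h ht]
    exact Commute.mul_right ih ((Commute.refl _).sub_right ((hy.mul_left ht).smul_right _))

/-- Both families of ordered monomials are polynomials in `y t` and `S`; Pascal's rule makes the
alternating sum collapse. -/
theorem sum_antinormal_mul_normal (h : t * y = y * t + S) (ht : Commute t S) (hy : Commute y S)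
    (m : ℕ) :
    ∑ p ∈ Finset.HasAntidiagonal.antidiagonal m,
      (m.choose p.1 : ℂ) • ((-1 : ℂ) ^ p.2 • (t ^ p.1 * y ^ p.1 * (y ^ p.2 * t ^ p.2))) =
      (m ! : ℂ) • S ^ m := by
  induction m with
  | zero => simp
  | succ m ih =>
    have e := Finset.sum_antidiagonal_choose_succ_nsmul
      (fun i j => (-1 : ℂ) ^ j • (t ^ i * y ^ i * (y ^ j * t ^ j))) m
    simp only [← Nat.cast_smul_eq_nsmul ℂ] at e
    rw [e, ← Finset.sum_add_distrib, Nat.factorial_succ, pow_succ', Nat.cast_mul, ← smul_smul,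
      ← mul_smul_comm, ← ih, Finset.mul_sum, Finset.smul_sum]
    refine Finset.sum_congr rfl fun p hp => ?_
    have hm := Finset.HasAntidiagonal.mem_antidiagonal.mp hp
    have h2 : m.choose p.2 = m.choose p.1 := by
      rw [← hm, Nat.choose_symm_add]
    have cb := commute_normal h ht hy p.2
    have ca := commute_antinormal h ht hy p.1
    have cS : Commute S (t ^ p.1 * y ^ p.1) :=
      ((ht.symm.pow_right _).mul_right (hy.symm.pow_right _))
    have cS' : Commute S (y ^ p.2 * t ^ p.2) :=
      ((hy.symm.pow_right _).mul_right (ht.symm.pow_right _))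
    have hm' : (m : ℂ) = p.1 + p.2 := by rw [← hm]; push_cast; ring
    rw [antinormal_succ h ht, normal_succ h ht, ← (cb.sub_left ((cS'.smul_left _))).eq]
    generalize t ^ p.1 * y ^ p.1 = u at *
    generalize y ^ p.2 * t ^ p.2 = v at *
    generalize y * t = n at *
    rw [h2, pow_succ, Nat.cast_add, Nat.cast_add, hm']
    simp only [add_mul, sub_mul, mul_sub, smul_mul_assoc, mul_smul_comm, Nat.cast_one, mul_assoc]
    rw [← ca.left_comm, ← cS.left_comm]
    module

/-- Antinormal times normal ordered exponential is a geometric series. -/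
theorem antinormal_mul_nord_neg (h : t * y = y * t + S) (ht : Commute t S) (hy : Commute y S)
    {K : ℕ} (hK : y ^ K = 0) :
    (1 - S) * ((∑ k ∈ Finset.range K, ((k ! : ℂ)⁻¹) • (t ^ k * y ^ k)) * nord (-y) t) = 1 := by
  have fne (k : ℕ) : (k ! : ℂ) ≠ 0 := by exact_mod_cast k.factorial_ne_zero
  have hz (i j : ℕ) (hij : K ≤ i + j) : t ^ i * y ^ i * (y ^ j * t ^ j) = 0 := by
    rw [mul_assoc, ← mul_assoc (y ^ i), ← pow_add, pow_eq_zero_of_le hij hK]; simp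
  have hS : S ^ K = 0 := by
    have := sum_antinormal_mul_normal h ht hy K
    rw [Finset.sum_eq_zero fun p hp => by
      rw [hz _ _ (Finset.HasAntidiagonal.mem_antidiagonal.mp hp).ge, smul_zero, smul_zero]] at this
    exact (smul_eq_zero.mp this.symm).resolve_left (fne K)
  have e : (∑ k ∈ Finset.range K, ((k ! : ℂ)⁻¹) • (t ^ k * y ^ k)) * nord (-y) t =
      ∑ m ∈ Finset.range K, S ^ m := by
    have e1 : nord (-y) t =
        ∑ j ∈ Finset.range K, ((j ! : ℂ)⁻¹ * (-1) ^ j) • (y ^ j * t ^ j) := by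
      rw [nord_eq_sum (n := K) (by rw [neg_pow, hK, mul_zero])]
      refine Finset.sum_congr rfl fun j _ => ?_
      rw [← neg_one_smul ℂ y, smul_pow, smul_mul_assoc, smul_smul]
    rw [e1, Finset.sum_mul_sum, ← Finset.sum_product']
    have hsub : (Finset.range K ×ˢ Finset.range K).filter (fun p => p.1 + p.2 < K) ⊆
        Finset.range K ×ˢ Finset.range K := Finset.filter_subset _ _
    rw [← Finset.sum_subset hsub (by
      intro p hp hp'
      have : K ≤ p.1 + p.2 := by
        by_contra hc
        exact hp' (Finset.mem_filter.mpr ⟨hp, by omega⟩)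
      rw [smul_mul_smul_comm, hz _ _ this, smul_zero])]
    rw [← Finset.sum_fiberwise_of_maps_to (t := Finset.range K) (g := fun p => p.1 + p.2)
      (by intro p hp; exact Finset.mem_range.mpr (Finset.mem_filter.mp hp).2)]
    refine Finset.sum_congr rfl fun m hm => ?_
    have hmK := Finset.mem_range.mp hm
    have hset : ((Finset.range K ×ˢ Finset.range K).filter (fun p => p.1 + p.2 < K)).filter
        (fun p => p.1 + p.2 = m) = Finset.HasAntidiagonal.antidiagonal m := by
      ext p
      simp only [Finset.mem_filter, Finset.mem_product, Finset.mem_range,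
        Finset.HasAntidiagonal.mem_antidiagonal]
      omega
    apply smul_right_injective B (fne m)
    show (m ! : ℂ) • _ = (m ! : ℂ) • _
    rw [hset, ← sum_antinormal_mul_normal h ht hy, Finset.smul_sum]
    refine Finset.sum_congr rfl fun p hp => ?_
    rw [smul_mul_smul_comm, smul_smul, smul_smul]
    congr 1
    have h1 := Nat.add_choose_mul_factorial_mul_factorial p.1 p.2
    rw [← Nat.choose_symm_add] at h1
    rw [Finset.HasAntidiagonal.mem_antidiagonal.mp hp] at h1
    have h2 : (m ! : ℂ) = m.choose p.1 * p.1! * p.2! := by exact_mod_cast h1.symm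
    have := fne p.1
    have := fne p.2
    rw [h2]
    field_simp
  rw [e, mul_neg_geom_sum, hS, sub_zero]

end Ordering

/-! ### The antipode -/

section Antipode

open MulOpposite

variable {B : Type*} [Ring B] [Algebra ℂ B] {h w σ : ℂ} {a : Gen → B}

theorem nexp_op {x : B} (hx : IsNilpotent x) : nexp (op x) = op (nexp x) := by
  obtain ⟨n, hn⟩ := hx
  rw [nexp_eq_sum hn, nexp_eq_sum (n := n) (by rw [← op_pow, hn, op_zero])]
  simp

theorem nsinh_op (h : ℂ) {x : B} (hx : IsNilpotent x) : nsinh h (op x) = op (nsinh h x) := by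
  obtain ⟨n, hn⟩ := hx
  rw [nsinh_eq_sum h hn, nsinh_eq_sum (n := n) h (by rw [← op_pow, hn, op_zero])]
  simp

theorem nesd_op (w : ℂ) {x : B} (hx : IsNilpotent x) : nesd w (op x) = op (nesd w x) := by
  obtain ⟨n, hn⟩ := hx
  rw [nesd_eq_sum w hn, nesd_eq_sum (n := n) w (by rw [← op_pow, hn, op_zero])]
  simp

/-- If `t b = b t + c b`, then moving `b` out of a normally ordered exponential in `t` produces
the factor `e ^ (c y)`. -/
theorem nexp_twoSided_shift {y t b : B} (c : ℂ)
    (ny : IsNilpotent y) (h : t * b = b * t + c • b) :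
    nexp (twoSided y t) 1 * b = nexp (c • y) * nexp (twoSided y t) b := by
  have nL : IsNilpotent (LinearMap.mulLeft ℂ (c • y)) := by
    obtain ⟨n, hn⟩ := ny
    exact ⟨n, by rw [LinearMap.pow_mulLeft, smul_pow, hn, smul_zero]; ext; simp⟩
  have nT := isNilpotent_twoSided ny t
  have cT : Commute (LinearMap.mulLeft ℂ (c • y)) (twoSided y t) := by
    ext z; simp [mul_assoc]
  have key := nexp_semiconj (a := LinearMap.mulRight ℂ b) nT (cT.isNilpotent_add nL nT) (by
    ext z
    simp only [Module.End.mul_apply, twoSided_apply, LinearMap.mulRight_apply,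
      LinearMap.add_apply, LinearMap.mulLeft_apply]
    rw [mul_assoc (y * z), h, mul_add, mul_smul_comm, smul_mul_assoc, add_comm]
    simp only [mul_assoc])
  have hL : nexp (LinearMap.mulLeft ℂ (c • y)) = LinearMap.mulLeft ℂ (nexp (c • y)) :=
    (map_nexp (Algebra.lmul ℂ B) (ny.smul c)).symm
  rw [nexp_add cT nL nT, hL] at key
  simpa using LinearMap.congr_fun key 1

/-- The antipode on the generators. -/
def anti (h w : ℂ) (a : Gen → B) : Gen → B
  | .N => -(a .N * eP (-w) a)
  | .E => -a .E
  | .Ap => -a .Ap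
  | .A => -(a .A * eP (-w) a) + w • (a .N * nsinh h (a .E) * eP (-w) a)

namespace OscRel

variable (ha : OscRel h w a)
include ha

theorem qn_eq : eP (-w) a = 1 - w • xP w a := by rw [ha.smul_x]; abel

theorem A_qn : a .A * eP (-w) a = eP (-w) a * a .A - w • nsinh h (a .E) := by
  rw [ha.qn_eq, mul_sub, mul_smul_comm, ha.A_x, sub_mul, smul_add, smul_mul_assoc]
  noncomm_ring

theorem N_qn : a .N * eP (-w) a = eP (-w) a * a .N + eP (-w) a - 1 := by
  rw [ha.qn_eq, mul_sub, mul_smul_comm, ha.N_x, sub_mul, smul_add, smul_mul_assoc]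
  noncomm_ring

/-- The images of the generators under the antipode satisfy the relations in the opposite
algebra. -/
theorem oscRel_anti : OscRel h w (fun g => op (anti h w a g)) := by
  have opn {x : B} (hx : IsNilpotent x) : IsNilpotent (op x) := by
    obtain ⟨n, hn⟩ := hx
    exact ⟨n, by rw [← op_pow, hn, op_zero]⟩
  have hq : eP w (fun g => op (anti h w a g)) = op (eP (-w) a) := by
    show nexp (w • op (-a .Ap)) = _
    rw [← op_smul, nexp_op (ha.nilP.neg.smul w), smul_neg, ← neg_smul, eP]
  have s1 (g : Gen) : Commute (a g) (nsinh h (a .E)) := commute_nsinh h (ha.commE' g)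
  have s2 : Commute (eP (-w) a) (nsinh h (a .E)) := commute_eP_left _ (s1 _)
  have r1 := ha.A_qn
  have r2 := ha.N_qn
  refine ⟨opn ha.nilE.neg, opn ha.nilP.neg, ?_, ?_, ?_, ?_⟩
  · rw [hq]
    show op (anti h w a .A) * op (-a .Ap) - op (-a .Ap) * op (anti h w a .A) =
      nsinh h (op (-a .E)) * _
    rw [nsinh_op h ha.nilE.neg, nsinh_neg h _ ha.nilE, ← op_mul, ← op_mul, ← op_mul, ← op_sub]
    congr 1
    have r3 : Commute (eP (-w) a) (a .Ap) := by simp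
    have e1 : a .A * eP (-w) a * a .Ap =
        a .Ap * (a .A * eP (-w) a) + nsinh h (a .E) := by
      rw [mul_assoc, r3.eq, ← mul_assoc, ha.A_P, add_mul, mul_assoc, mul_assoc,
        ha.eP_mul_neg, mul_one]
    have e2 : w • (a .N * nsinh h (a .E) * eP (-w) a * a .Ap) =
        w • (a .Ap * (a .N * nsinh h (a .E) * eP (-w) a)) + nsinh h (a .E) -
          nsinh h (a .E) * eP (-w) a := by
      have e3 : w • nesd w (a .Ap) = eP w a - 1 := smul_nesd w ha.nilP
      rw [mul_assoc, mul_assoc, r3.eq, (s1 .Ap).symm.left_comm, lassoc ha.N_P, add_mul, smul_add,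
        ← smul_mul_assoc w (nesd _ _), e3, sub_mul, one_mul, s2.symm.eq, lassoc (ha.eP_mul_neg w),
        one_mul]
      simp only [mul_assoc, s2.eq]
      abel
    simp only [anti, mul_add, add_mul, neg_mul, mul_neg, neg_neg, smul_mul_assoc, mul_smul_comm,
      e1, e2, s2.eq, smul_neg]
    abel
  · show op (-(a .N * eP (-w) a)) * op (-a .Ap) - op (-a .Ap) * op (-(a .N * eP (-w) a)) =
      nesd w (op (-a .Ap))
    rw [nesd_op w ha.nilP.neg, nesd_neg_right w ha.nilP, ← op_mul, ← op_mul, ← op_sub]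
    congr 1
    have r3 : Commute (eP (-w) a) (a .Ap) := by simp
    rw [neg_mul_neg, neg_mul_neg, mul_assoc, r3.eq, lassoc ha.N_P, nesd_neg w ha.nilP, add_mul]
    have r4 : Commute (nesd (-w) (a .Ap)) (eP (-w) a) :=
      commute_eP _ (commute_nesd _ (Commute.refl _)).symm
    have e5 : nexp (w • a .Ap) * nesd (-w) (a .Ap) * eP (-w) a = nesd (-w) (a .Ap) := by
      rw [mul_assoc, r4.eq, ← mul_assoc]
      show eP w a * eP (-w) a * _ = _
      rw [ha.eP_mul_neg, one_mul]
    rw [e5]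
    noncomm_ring
  · show op (anti h w a .N) * op (anti h w a .A) - op (anti h w a .A) * op (anti h w a .N) =
      -op (anti h w a .A)
    rw [← op_mul, ← op_mul, ← op_sub, ← op_neg]
    congr 1
    have r3 := ha.N_A
    simp only [anti, mul_add, add_mul, mul_sub, sub_mul, neg_mul, mul_neg, neg_neg, neg_add,
      smul_mul_assoc, mul_smul_comm, mul_assoc, r1, r2, r3, lassoc r1, lassoc r2, lassoc r3,
      (s1 _).eq, (s1 _).left_comm, s2.eq, s2.left_comm, smul_add, smul_sub, mul_one, one_mul]
    module
  · intro g
    show op (-a .E) * op (anti h w a g) = op (anti h w a g) * op (-a .E)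
    rw [← op_mul, ← op_mul]
    congr 1
    have : Commute (a .E) (anti h w a g) := by
      cases g <;> simp (maxDischargeDepth := 9) [anti, ha.commE]
    rw [mul_neg, neg_mul, this.eq]

/-- Conjugation of `N` by `∑ k, (w A⁺) ^ k N ^ k / k!`, which up to the factor `e ^ (w A⁺)` is the
element conjugating the antipode into a change of signs. -/
theorem N_nord : a .N * nord (w • a .Ap) (a .N) = eP w a * (nord (w • a .Ap) (a .N) * a .N) := by
  have ny := ha.nil_smulP w
  have hy : a .N * (w • a .Ap) = w • a .Ap * a .N + (eP w a - 1) := by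
    rw [eP, ← smul_nesd w ha.nilP, mul_smul_comm, ha.N_P, smul_add, smul_mul_assoc]
  have c2 : Commute (eP w a) (w • a .Ap) := by simp
  set y := w • a .Ap with hy'
  have key := nexp_comm (isNilpotent_twoSided ny (a .N)) (d := LinearMap.mulLeft ℂ (a .N))
    (c := twoSided (eP w a - 1) (a .N)) (by
      ext z
      simp only [Module.End.mul_apply, twoSided_apply, LinearMap.mulLeft_apply,
        LinearMap.add_apply]
      rw [← mul_assoc, ← mul_assoc, hy, add_mul, add_mul]
      simp only [mul_assoc])
    (twoSided_commute (c2.symm.sub_right (Commute.one_right _)) (Commute.refl _))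
  have h1 := LinearMap.congr_fun key 1
  simp only [Module.End.mul_apply, LinearMap.mulLeft_apply, twoSided_apply, mul_one,
    LinearMap.add_apply, ← map_add] at h1
  rw [nord, h1, show a .N + (eP w a - 1) * a .N = eP w a * (1 * a .N) by
    noncomm_ring, mul_nexp_twoSided_of_commute ny c2,
    nexp_twoSided_mul_of_commute ny (Commute.refl _)]

theorem nord_mul_x : nord (w • a .Ap) (a .N) * xP w a =
    eP w a * (xP w a * nord (w • a .Ap) (a .N)) := by
  have c1 : Commute (xP w a) (w • a .Ap) := by simp
  have := nexp_twoSided_shift (b := xP w a) 1 (ha.nil_smulP w) (by rw [one_smul, ha.N_x])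
  rw [one_smul] at this
  rw [nord, this, ← mul_nexp_twoSided_of_commute (ha.nil_smulP w) c1, mul_one, eP]

/-- Conjugation of `A` by `∑ k, (w A⁺) ^ k N ^ k / k!`: the second summand accounts for the second
summand of the antipode of `A`. -/
theorem A_nord : a .A * nord (w • a .Ap) (a .N) =
    eP w a * (nord (w • a .Ap) (a .N) * a .A) +
      w • (nsinh h (a .E) * (a .N * nord (w • a .Ap) (a .N))) := by
  have ny := ha.nil_smulP w
  have hy : a .A * (w • a .Ap) = w • a .Ap * a .A + w • (nsinh h (a .E) * eP w a) := by
    rw [mul_smul_comm, ha.A_P, smul_add, smul_mul_assoc]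
  have hs : Commute (nsinh h (a .E)) (a .Ap) := commute_nsinh_left h (ha.commE _)
  have c2 : Commute (w • (nsinh h (a .E) * eP w a)) (w • a .Ap) := by
    simp (maxDischargeDepth := 9) [hs]
  have h3 := nexp_twoSided_shift (b := a .A) (-1) ny (by rw [ha.N_A]; module)
  have h4 := ha.N_nord
  set y := w • a .Ap with hy'
  have key := nexp_comm (isNilpotent_twoSided ny (a .N)) (d := LinearMap.mulLeft ℂ (a .A))
    (c := twoSided (w • (nsinh h (a .E) * eP w a)) (a .N)) (by
      ext z
      simp only [Module.End.mul_apply, twoSided_apply, LinearMap.mulLeft_apply,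
        LinearMap.add_apply]
      rw [← mul_assoc, ← mul_assoc, hy, add_mul, add_mul]
      simp only [mul_assoc])
    (twoSided_commute c2.symm (Commute.refl _))
  have h1 := LinearMap.congr_fun key 1
  simp only [Module.End.mul_apply, LinearMap.mulLeft_apply, twoSided_apply, mul_one,
    LinearMap.add_apply] at h1
  have h5 : nexp (twoSided y (a .N)) (a .A) = eP w a * (nord y (a .N) * a .A) := by
    rw [nord, h3, neg_one_smul, eP, ← mul_assoc, ← hy', nexp_mul_neg ny, one_mul]
  have h6 : nexp (twoSided y (a .N)) (w • (nsinh h (a .E) * eP w a) * a .N) =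
      w • (nsinh h (a .E) * eP w a) * (nord y (a .N) * a .N) := by
    rw [mul_nexp_twoSided_of_commute ny c2, nord,
      ← nexp_twoSided_mul_of_commute ny (Commute.refl _), one_mul]
  rw [nord, h1, h5, h6, ← nord, h4, smul_mul_assoc]
  simp only [mul_assoc]

/-- The antipode is conjugate to the antiautomorphism negating `N`, `E`, `A` and
`(1 - e ^ (-w A⁺)) / w`. -/
theorem anti_mul_conj :
    anti h w a .N * (eP w a * nord (w • a .Ap) (a .N)) =
        -(eP w a * nord (w • a .Ap) (a .N) * a .N) ∧
      anti h w a .A * (eP w a * nord (w • a .Ap) (a .N)) =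
        -(eP w a * nord (w • a .Ap) (a .N) * a .A) ∧
      nesd (-w) (anti h w a .Ap) * (eP w a * nord (w • a .Ap) (a .N)) =
        -(eP w a * nord (w • a .Ap) (a .N) * xP w a) := by
  have q1 := ha.eP_neg_mul w
  refine ⟨?_, ?_, ?_⟩
  · rw [anti, neg_mul, mul_assoc, lassoc q1, one_mul, ha.N_nord, mul_assoc]
  · have s1 : Commute (a .N) (nsinh h (a .E)) := commute_nsinh h (ha.commE' _)
    rw [anti, add_mul, neg_mul, smul_mul_assoc]
    simp only [mul_assoc]
    rw [lassoc q1, one_mul, ha.A_nord, s1.left_comm]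
    abel
  · have c1 : Commute (xP w a) (eP w a) := by simp
    rw [anti, nesd_neg_right _ ha.nilP, neg_neg, nesd_neg w ha.nilP, mul_assoc, ha.nord_mul_x,
      neg_mul]
    show -(eP w a * xP w a * _) = _
    rw [mul_assoc, c1.left_comm]

variable (hσ : (2 * σ) • (eE σ a * nsinh h (a .E)) = eE (2 * σ) a - 1)
  (hσ' : (2 * -σ) • (eE (-σ) a * nsinh h (a .E)) = eE (2 * -σ) a - 1)
include hσ hσ'

/-- The antinormally ordered exponential is the normally ordered one up to a central factor. -/
theorem antinormal_eq {K : ℕ} (hK : ((2 * σ) • (eE (-σ) a * xP w a)) ^ K = 0) :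
    ∑ k ∈ Finset.range K, ((k ! : ℂ)⁻¹) •
        ((a .A) ^ k * ((2 * σ) • (eE (-σ) a * xP w a)) ^ k) =
      eE (2 * σ) a * nT w σ a := by
  have hA : a .A * ((2 * σ) • (eE (-σ) a * xP w a)) =
      (2 * σ) • (eE (-σ) a * xP w a) * a .A + (1 - eE (2 * -σ) a) := by
    have := ha.A_y hσ'
    rw [show (2 * -σ) • (eE (-σ) a * xP w a) = -((2 * σ) • (eE (-σ) a * xP w a)) by module] at this
    rw [mul_neg, neg_mul, ← neg_inj, neg_neg] at this
    rw [this]; abel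
  have c1 (c : ℂ) (g : Gen) : Commute (a g) (eE c a) := by simp [ha.commE']
  have key := antinormal_mul_nord_neg hA ((Commute.one_right _).sub_right (c1 _ _))
    ((Commute.one_right _).sub_right (Commute.smul_left
      ((commute_eE_left _ (by simp)).mul_left (commute_xP_left (c1 _ _))) _)) hK
  set Z := ∑ k ∈ Finset.range K, ((k ! : ℂ)⁻¹) •
        ((a .A) ^ k * ((2 * σ) • (eE (-σ) a * xP w a)) ^ k)
  have e1 : nord (-((2 * σ) • (eE (-σ) a * xP w a))) (a .A) = nT w (-σ) a := by
    rw [nT]; congr 1; module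
  rw [e1, sub_sub_cancel, show (2 * -σ) = -(2 * σ) by ring] at key
  have e2 := ha.nT_mul_nT_neg (σ := -σ) hσ'
  rw [neg_neg] at e2
  have e3 : Z * nT w (-σ) a = eE (2 * σ) a := by
    have := congrArg (eE (2 * σ) a * ·) key
    simp only [lassoc (ha.eE_mul _ _), add_neg_cancel, eE_zero, one_mul, mul_one] at this
    exact this
  rw [← e3, mul_assoc, e2, mul_one]

/-- The ribbon element is invariant under the antipode. -/
theorem thetaG_anti (hV : IsUnit (nord (w • a .Ap) (a .N))) :
    unop (thetaG w σ (fun g => op (anti h w a g))) = thetaG w σ a := by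
  have hr := ha.oscRel_anti
  obtain ⟨v1, v2, v3⟩ := ha.anti_mul_conj
  have uq : IsUnit (eP w a) := ⟨⟨_, _, ha.eP_mul_neg w, ha.eP_neg_mul w⟩, rfl⟩
  have uV := uq.mul hV
  set V := eP w a * nord (w • a .Ap) (a .N) with hVd
  refine uV.mul_right_cancel ?_
  have cV : Commute V (thetaG w σ a) := by
    obtain ⟨n, hn⟩ := ha.nil_smulP w
    rw [hVd, nord_eq_sum hn]
    have cT (g : Gen) := (ha.thetaG_comm hσ g).symm
    refine (commute_eP_left _ (cT _)).mul_left ?_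
    exact Commute.sum_left _ _ _ fun k _ => Commute.smul_left
      ((((cT _).smul_left w).pow_left k).mul_left ((cT _).pow_left k)) _
  rw [← cV.eq]
  have vE : Commute (a .E) V := by
    obtain ⟨n, hn⟩ := ha.nil_smulP w
    rw [hVd, nord_eq_sum hn]
    refine (commute_eP _ (ha.commE _)).mul_right ?_
    exact Commute.sum_right _ _ _ fun k _ => Commute.smul_right
      ((((ha.commE _).smul_right w).pow_right k).mul_right ((ha.commE _).pow_right k)) _
  clear_value V
  -- the factors of `S θ`, read in the opposite algebra
  set Y := (2 * σ) • (nesd (-w) (-a .Ap) * eE (-σ) a) with hY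
  have e1 : eE σ (fun g => op (anti h w a g)) = op (eE (-σ) a) := by
    show nexp (σ • op (-a .E)) = _
    rw [← op_smul, nexp_op (ha.nilE.neg.smul σ), smul_neg, ← neg_smul, eE]
  have e2 : (2 * σ) • (eE σ (fun g => op (anti h w a g)) *
      xP w (fun g => op (anti h w a g))) = op Y := by
    rw [e1]
    show (2 * σ) • (op _ * nesd (-w) (op (-a .Ap))) = _
    rw [nesd_op _ ha.nilP.neg, ← op_mul, ← op_smul]
  have hx : nesd (-w) (-a .Ap) * V = -(V * xP w a) := v3
  have cYE : Commute V (eE (-σ) a) := (commute_eE_left _ vE).symm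
  set y := (2 * σ) • (eE (-σ) a * xP w a) with hy
  have hYV : Y * V = V * (-y) := by
    have c5 : Commute (xP w a) (eE (-σ) a) := by simp [ha.commE']
    rw [hY, hy, smul_mul_assoc, mul_assoc, ← cYE.eq, ← mul_assoc, hx, mul_neg, mul_smul_comm,
      ← c5.eq, neg_mul, smul_neg]
    simp only [mul_assoc]
  have ny : IsNilpotent y := by
    have := ha.nil_eE_x (w := w) (-σ)
    rw [show (2 * -σ) • (eE (-σ) a * xP w a) = -y by rw [hy]; module] at this
    simpa using this.neg
  obtain ⟨K, hK⟩ := ny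
  obtain ⟨K', hK'⟩ := hr.nil_eE_x σ
  have hKK : y ^ (K + K') = 0 := pow_eq_zero_of_le (by omega) hK
  have hT : unop (nT w σ (fun g => op (anti h w a g))) * V =
      V * ∑ k ∈ Finset.range (K + K'), ((k ! : ℂ)⁻¹) • ((a .A) ^ k * y ^ k) := by
    rw [nT, nord_eq_sum (n := K + K') (pow_eq_zero_of_le (by omega) hK'), e2, Finset.mul_sum,
      Finset.unop_sum, Finset.sum_mul]
    refine Finset.sum_congr rfl fun k _ => ?_
    have h1 : SemiconjBy V (-y) Y := hYV.symm
    have h2 : SemiconjBy V (-(a .A)) (anti h w a .A) := by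
      rw [SemiconjBy, v2, mul_neg]
    have h3 := (h2.pow_right k).mul_right (h1.pow_right k)
    rw [← op_pow, ← op_pow, ← op_mul, ← op_smul, unop_op, smul_mul_assoc, ← h3.eq, mul_smul_comm,
      neg_pow (a .A), neg_pow y]
    congr 2
    rw [mul_assoc, ((Commute.neg_one_left (y ^ k)).pow_left k).eq, ← mul_assoc (a .A ^ k),
      ← mul_assoc, ((Commute.neg_one_left _).pow_left k).eq, mul_assoc, ← pow_add,
      (Even.add_self k).neg_one_pow, mul_one]
  have nEN := hr.nil_E_N (σ := σ)
  have e3 : -((2 * σ) • (op (anti h w a .E) * op (anti h w a .N))) =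
      op (-((2 * σ) • (anti h w a .N * -(a .E)))) := rfl
  have nEN' : IsNilpotent (-((2 * σ) • (anti h w a .N * -(a .E)))) := by
    obtain ⟨n, hn⟩ := nEN
    refine ⟨n, op_injective ?_⟩
    rw [op_pow, ← e3, hn, op_zero]
  have e4 : V * nexp (-((2 * σ) • (a .E * a .N))) =
      nexp (-((2 * σ) • (anti h w a .N * -(a .E)))) * V := by
    refine nexp_semiconj ha.nil_E_N nEN' ?_
    rw [neg_mul, smul_mul_assoc, mul_assoc, neg_mul, vE.eq, mul_neg, mul_neg, ← mul_assoc, v1,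
      neg_mul, neg_neg, mul_smul_comm, mul_assoc V, (ha.commE .N).eq]
  have cT : Commute (nexp (-((2 * σ) • (a .E * a .N)))) (eE (2 * σ) a * nT w σ a) := by
    refine Commute.mul_right (by simp (maxDischargeDepth := 9) [ha.commE']) ?_
    exact commute_nexp_left (Commute.neg_left (Commute.smul_left
      (ha.commute_nT_E.mul_left ha.N_nT) _))
  have cT2 : Commute (nexp (-((2 * σ) • (a .E * a .N)))) (eE (-σ) a) := by
    simp (maxDischargeDepth := 9) [ha.commE']
  have cT3 : Commute (nT w σ a) (eE (-σ) a) := (commute_eE_left _ ha.commute_nT_E).symm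
  rw [thetaG, e1]
  simp only [unop_mul, unop_op, mul_assoc]
  rw [← cYE.eq, ← mul_assoc (unop (nT w σ _)), hT, ha.antinormal_eq hσ hσ' hKK]
  rw [e3, nexp_op nEN', unop_op, ← mul_assoc, ← mul_assoc, ← e4, thetaG, mul_assoc V,
    cT.eq, mul_assoc V, mul_assoc (eE (2 * σ) a * _), cT2.eq, mul_assoc (eE (2 * σ) a),
    cT3.left_comm, lassoc (ha.eE_mul _ _)]
  rw [show 2 * σ + -σ = σ by ring]
  simp only [mul_assoc]

end OscRel

end Antipode

/-! ### Filtrations -/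

section Filtration

variable {B C : Type*} [Ring B] [Algebra ℂ B] [Ring C] [Algebra ℂ C]

/-- A decreasing multiplicative filtration, all of `B` in degree `0`. -/
structure IsFilt (I : ℕ → Submodule ℂ B) : Prop where
  top : I 0 = ⊤
  anti : Antitone I
  mul : ∀ {i j : ℕ} {x y : B}, x ∈ I i → y ∈ I j → x * y ∈ I (i + j)

namespace IsFilt

variable {I : ℕ → Submodule ℂ B} {J : ℕ → Submodule ℂ C} (hI : IsFilt I) (hJ : IsFilt J)
include hI

theorem mem_zero (x : B) : x ∈ I 0 := by rw [hI.top]; trivial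

theorem mul_left {k : ℕ} {y : B} (x : B) (hy : y ∈ I k) : x * y ∈ I k := by
  simpa using hI.mul (hI.mem_zero x) hy

theorem mul_right {k : ℕ} {x : B} (hx : x ∈ I k) (y : B) : x * y ∈ I k := by
  simpa using hI.mul hx (hI.mem_zero y)

theorem pow_mem {x : B} (hx : x ∈ I 1) (k : ℕ) : x ^ k ∈ I k := by
  induction k with
  | zero => exact hI.mem_zero _
  | succ k ih => rw [pow_succ]; exact hI.mul ih hx

theorem pow_eq_zero {M : ℕ} (hM : I M = ⊥) {x : B} (hx : x ∈ I 1) : x ^ M = 0 := by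
  have := hI.pow_mem hx M
  rwa [hM, Submodule.mem_bot] at this

theorem op :
    IsFilt (B := Bᵐᵒᵖ) (fun k => (I k).comap (MulOpposite.opLinearEquiv ℂ).symm.toLinearMap) where
  top := by simp [hI.top]
  anti := fun i j hij => Submodule.comap_mono (hI.anti hij)
  mul := by
    intro i j x y hx hy
    rw [add_comm]
    exact hI.mul hy hx

/-- If `I 1` is nilpotent, then `1 + I 1` consists of units. -/
theorem isUnit_of_sub_mem {M : ℕ} (hM : I M = ⊥) {x : B} (hx : x - 1 ∈ I 1) : IsUnit x := by
  have : IsNilpotent (x - 1) := ⟨M, hI.pow_eq_zero hM hx⟩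
  simpa using this.isUnit_add_one

end IsFilt

/-- The filtration of a tensor product by total degree. -/
def tenFil (I : ℕ → Submodule ℂ B) (J : ℕ → Submodule ℂ C) (k : ℕ) : Submodule ℂ (B ⊗[ℂ] C) :=
  Submodule.span ℂ {z | ∃ i j x y, k ≤ i + j ∧ x ∈ I i ∧ y ∈ J j ∧ x ⊗ₜ[ℂ] y = z}

theorem tmul_mem_tenFil {I : ℕ → Submodule ℂ B} {J : ℕ → Submodule ℂ C} {i j k : ℕ} {x : B}
    {y : C} (hx : x ∈ I i) (hy : y ∈ J j) (hk : k ≤ i + j) : x ⊗ₜ[ℂ] y ∈ tenFil I J k :=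
  Submodule.subset_span ⟨i, j, x, y, hk, hx, hy, rfl⟩

theorem isFilt_tenFil {I : ℕ → Submodule ℂ B} {J : ℕ → Submodule ℂ C} (hI : IsFilt I)
    (hJ : IsFilt J) : IsFilt (tenFil I J) where
  top := by
    rw [eq_top_iff, ← TensorProduct.span_tmul_eq_top, Submodule.span_le]
    rintro _ ⟨x, y, rfl⟩
    exact tmul_mem_tenFil (hI.mem_zero x) (hJ.mem_zero y) le_rfl
  anti := by
    intro k l hkl
    refine Submodule.span_mono ?_
    rintro z ⟨i, j, x, y, h, r⟩
    exact ⟨i, j, x, y, hkl.trans h, r⟩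
  mul := by
    intro k l x y hx hy
    induction hx, hy using Submodule.span_induction₂ with
    | mem_mem x y hx hy =>
      obtain ⟨i, j, x, x', h, h1, h2, rfl⟩ := hx
      obtain ⟨i', j', y, y', h', h1', h2', rfl⟩ := hy
      rw [Algebra.TensorProduct.tmul_mul_tmul]
      exact tmul_mem_tenFil (hI.mul h1 h1') (hJ.mul h2 h2') (by omega)
    | zero_left y hy => simp
    | zero_right x hx => simp
    | add_left x y z hx hy hz h1 h2 => rw [add_mul]; exact add_mem h1 h2
    | add_right x y z hx hy hz h1 h2 => rw [mul_add]; exact add_mem h1 h2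
    | smul_left r x y hx hy h => rw [smul_mul_assoc]; exact Submodule.smul_mem _ _ h
    | smul_right r x y hx hy h => rw [mul_smul_comm]; exact Submodule.smul_mem _ _ h

theorem tenFil_eq_bot {I : ℕ → Submodule ℂ B} {J : ℕ → Submodule ℂ C} (hI : IsFilt I)
    (hJ : IsFilt J) {m n : ℕ} (hm : I m = ⊥) (hn : J n = ⊥) : tenFil I J (m + n) = ⊥ := by
  rw [eq_bot_iff, tenFil, Submodule.span_le]
  rintro _ ⟨i, j, x, y, h, h1, h2, rfl⟩
  rcases le_or_gt m i with hi | hi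
  · have : x = 0 := by simpa [hm] using hI.anti hi h1
    simp [this]
  · have : y = 0 := by simpa [hn] using hJ.anti (show n ≤ j by omega) h2
    simp [this]

end Filtration

/-! ### The algebras `U_{h,w}(H(4))` modulo a power of the ideal -/

section Level

variable {B C : Type*} [Ring B] [Algebra ℂ B] [Ring C] [Algebra ℂ C] {h w : ℂ} {m : ℕ}

theorem OscRel.map {a : Gen → B} (ha : OscRel h w a) (f : B →ₐ[ℂ] C) :
    OscRel h w (fun g => f (a g)) := by
  have hq : eP w (fun g => f (a g)) = f (eP w a) := by
    rw [eP, eP, map_nexp f (ha.nil_smulP w), map_smul]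
  refine ⟨ha.nilE.map f, ha.nilP.map f, ?_, ?_, ?_, ?_⟩
  · rw [hq, ← map_nsinh f h ha.nilE, ← map_mul, ← map_mul, ← map_mul, ← map_sub, ha.comm_A_Ap]
  · rw [← map_nesd f w ha.nilP, ← map_mul, ← map_mul, ← map_sub, ha.comm_N_Ap]
  · rw [← map_mul, ← map_mul, ← map_sub, ha.comm_N_A, map_neg]
  · intro g
    rw [← map_mul, ← map_mul, ha.comm_E]

theorem OscRel.tmul_one {a : Gen → B} (ha : OscRel h w a) :
    OscRel h w (fun g => a g ⊗ₜ[ℂ] (1 : C)) :=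
  ha.map (Algebra.TensorProduct.includeLeft : B →ₐ[ℂ] B ⊗[ℂ] C)

theorem OscRel.one_tmul {a : Gen → C} (ha : OscRel h w a) :
    OscRel h w (fun g => (1 : B) ⊗ₜ[ℂ] a g) :=
  ha.map (Algebra.TensorProduct.includeRight : C →ₐ[ℂ] B ⊗[ℂ] C)

/-- The algebra `Level h w m`, sealed so that its only visible structure is that of a
`ℂ`-algebra. -/
def Lev (h w : ℂ) (m : ℕ) : Type := Level h w m

instance : Ring (Lev h w m) := inferInstanceAs (Ring (Level h w m))

instance : Algebra ℂ (Lev h w m) := inferInstanceAs (Algebra ℂ (Level h w m))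

/-- The quotient map onto `Lev h w m`. -/
def mkLev (h w : ℂ) (m : ℕ) : FreeAlgebra ℂ Gen →ₐ[ℂ] Lev h w m := mk h w m

theorem mkLev_rel {x y : FreeAlgebra ℂ Gen} (r : Rel h w m x y) :
    mkLev h w m x = mkLev h w m y := RingQuot.mkAlgHom_rel ℂ r

/-- The generators in `Lev h w m`. -/
def lgen (h w : ℂ) (m : ℕ) (g : Gen) : Lev h w m := mkLev h w m (fgen g)

theorem lgen_pow (hs : g.isSmall = true) {k : ℕ} (hk : m ≤ k) : lgen h w m g ^ k = 0 := by
  rw [lgen, ← map_pow]; exact mk_pow_eq_zero h w hk hs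

theorem sum_exp_eq_nexp {x : B} {n : ℕ} (hn : x ^ n = 0) :
    ∑ k ∈ Finset.range n, (w ^ k / (k ! : ℂ)) • x ^ k = nexp (w • x) := by
  rw [nexp_eq_sum (n := n) (by rw [smul_pow, hn, smul_zero])]
  refine Finset.sum_congr rfl fun k _ => ?_
  rw [smul_pow, smul_smul, div_eq_inv_mul]

theorem oscRel_lgen (h w : ℂ) (m : ℕ) : OscRel h w (lgen h w m) := by
  have hE : lgen h w m .E ^ m = 0 := lgen_pow rfl le_rfl
  have hP : lgen h w m .Ap ^ m = 0 := lgen_pow rfl le_rfl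
  refine ⟨⟨m, hE⟩, ⟨m, hP⟩, ?_, ?_, ?_, ?_⟩
  · have := mkLev_rel (Rel.comm_A_Ap (h := h) (w := w) (m := m))
    rw [eP, nsinh_eq_sum h hE, ← sum_exp_eq_nexp hP]
    simpa [lgen] using this
  · have := mkLev_rel (Rel.comm_N_Ap (h := h) (w := w) (m := m))
    rw [nesd_eq_sum w hP]
    simpa [lgen] using this
  · have := mkLev_rel (Rel.comm_N_A (h := h) (w := w) (m := m))
    simpa [lgen] using this
  · intro g
    have := mkLev_rel (Rel.comm_E (h := h) (w := w) (m := m) g)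
    simpa [lgen] using this

theorem mkLev_surjective (h w : ℂ) (m : ℕ) : Function.Surjective (mkLev h w m) :=
  RingQuot.mkAlgHom_surjective ℂ _

/-- To prove a property of all elements, it suffices to treat the generators. -/
theorem level_induction {p : Lev h w m → Prop} (hg : ∀ g, p (lgen h w m g))
    (hc : ∀ c : ℂ, p (algebraMap ℂ _ c)) (hadd : ∀ x y, p x → p y → p (x + y))
    (hmul : ∀ x y, p x → p y → p (x * y)) (x : Lev h w m) : p x := by
  obtain ⟨x, rfl⟩ := mkLev_surjective h w m x
  induction x using FreeAlgebra.induction with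
  | grade0 c => rw [AlgHom.commutes]; exact hc c
  | grade1 g => exact hg g
  | mul a b ha hb => rw [map_mul]; exact hmul _ _ ha hb
  | add a b ha hb => rw [map_add]; exact hadd _ _ ha hb

theorem level_hom_ext {f f' : Lev h w m →ₐ[ℂ] B} (hf : ∀ g, f (lgen h w m g) = f' (lgen h w m g)) :
    f = f' := by
  refine AlgHom.ext fun x => ?_
  induction x using level_induction with
  | hg g => exact hf g
  | hc c => simp
  | hadd x y hx hy => simp [hx, hy]
  | hmul x y hx hy => simp [hx, hy]

/-- An element that intertwines two homomorphisms on the generators does so everywhere. -/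
theorem level_semiconj {f f' : Lev h w m →ₐ[ℂ] B} {r : B}
    (hf : ∀ g, r * f (lgen h w m g) = f' (lgen h w m g) * r) (x : Lev h w m) :
    r * f x = f' x * r := by
  induction x using level_induction with
  | hg g => exact hf g
  | hc c => simp [Algebra.commutes]
  | hadd x y hx hy => simp [mul_add, add_mul, hx, hy]
  | hmul x y hx hy => rw [map_mul, map_mul, ← mul_assoc, hx, mul_assoc, hy, mul_assoc]

/-- The filtration of `Lev h w m` by the powers of the ideal generated by `E` and `A⁺`. -/
def levFil (h w : ℂ) (m k : ℕ) : Submodule ℂ (Lev h w m) :=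
  Submodule.span ℂ {z | ∃ l : List Gen, k ≤ l.countP Gen.isSmall ∧ (l.map (lgen h w m)).prod = z}

theorem isFilt_levFil (h w : ℂ) (m : ℕ) : IsFilt (levFil h w m) := by
  have hmul : ∀ {i j : ℕ} {x y : Lev h w m}, x ∈ levFil h w m i → y ∈ levFil h w m j →
      x * y ∈ levFil h w m (i + j) := by
    intro k l x y hx hy
    induction hx, hy using Submodule.span_induction₂ with
    | mem_mem x y hx hy =>
      obtain ⟨l, h1, rfl⟩ := hx
      obtain ⟨l', h1', rfl⟩ := hy
      refine Submodule.subset_span ⟨l ++ l', ?_, by simp⟩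
      rw [List.countP_append]; omega
    | zero_left y hy => simp
    | zero_right x hx => simp
    | add_left x y z hx hy hz h1 h2 => rw [add_mul]; exact add_mem h1 h2
    | add_right x y z hx hy hz h1 h2 => rw [mul_add]; exact add_mem h1 h2
    | smul_left r x y hx hy h => rw [smul_mul_assoc]; exact Submodule.smul_mem _ _ h
    | smul_right r x y hx hy h => rw [mul_smul_comm]; exact Submodule.smul_mem _ _ h
  refine ⟨?_, ?_, hmul⟩
  · rw [eq_top_iff]
    rintro x -
    induction x using level_induction with
    | hg g => exact Submodule.subset_span ⟨[g], Nat.zero_le _, List.prod_singleton⟩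
    | hc c =>
      rw [Algebra.algebraMap_eq_smul_one]
      exact Submodule.smul_mem _ _ (Submodule.subset_span ⟨[], Nat.zero_le _, rfl⟩)
    | hadd x y hx hy => exact add_mem hx hy
    | hmul x y hx hy =>
      have := hmul hx hy
      rwa [add_zero] at this
  · intro k l hkl
    refine Submodule.span_mono ?_
    rintro z ⟨l, h, r⟩
    exact ⟨l, hkl.trans h, r⟩

theorem levFil_eq_bot (h w : ℂ) (m : ℕ) : levFil h w m m = ⊥ := by
  rw [eq_bot_iff, levFil, Submodule.span_le]
  rintro _ ⟨l, hl, rfl⟩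
  have := mkLev_rel (Rel.word (h := h) (w := w) (m := m) l hl)
  rw [map_list_prod, List.map_map, map_zero] at this
  exact this

theorem lgen_mem_levFil {g : Gen} (hg : g.isSmall = true) : lgen h w m g ∈ levFil h w m 1 :=
  Submodule.subset_span ⟨[g], by simp [hg], List.prod_singleton⟩

/-- The universal property of `Lev h w m`. -/
def levelLift {a : Gen → B} (ha : OscRel h w a) {I : ℕ → Submodule ℂ B} (hI : IsFilt I)
    (hE : a .E ∈ I 1) (hP : a .Ap ∈ I 1) (hm : I m = ⊥) : Lev h w m →ₐ[ℂ] B :=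
  RingQuot.liftAlgHom ℂ ⟨FreeAlgebra.lift ℂ a, by
    have hf (g : Gen) : FreeAlgebra.lift ℂ a (fgen g) = a g := FreeAlgebra.lift_ι_apply _ _
    have zE := hI.pow_eq_zero hm hE
    have zP := hI.pow_eq_zero hm hP
    intro x y r
    cases r with
    | comm_A_Ap =>
      simp only [map_sub, map_mul, map_sum, map_smul, map_pow, hf]
      rw [← nsinh_eq_sum h zE, sum_exp_eq_nexp zP]
      exact ha.comm_A_Ap
    | comm_N_Ap =>
      simp only [map_sub, map_mul, map_sum, map_smul, map_pow, hf]
      rw [← nesd_eq_sum w zP]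
      exact ha.comm_N_Ap
    | comm_N_A =>
      simp only [map_sub, map_mul, map_neg, hf]
      exact ha.comm_N_A
    | comm_E g =>
      simp only [map_mul, hf]
      exact ha.comm_E g
    | word l hl =>
      have key : ∀ l : List Gen, (l.map a).prod ∈ I (l.countP Gen.isSmall) := by
        intro l
        induction l with
        | nil => exact hI.mem_zero _
        | cons g l ih =>
          rw [List.map_cons, List.prod_cons, List.countP_cons]
          cases g with
          | E => rw [add_comm]; exact hI.mul hE ih
          | Ap => rw [add_comm]; exact hI.mul hP ih
          | N => exact hI.mul_left _ ih
          | A => exact hI.mul_left _ ih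
      have := hI.anti hl (key l)
      rw [hm, Submodule.mem_bot] at this
      rw [map_zero, map_list_prod, List.map_map, ← this]
      congr 2
      funext g
      exact hf g⟩

@[simp] theorem levelLift_lgen {a : Gen → B} (ha : OscRel h w a) {I : ℕ → Submodule ℂ B}
    (hI : IsFilt I) (hE : a .E ∈ I 1) (hP : a .Ap ∈ I 1) (hm : I m = ⊥) (g : Gen) :
    levelLift ha hI hE hP hm (lgen h w m g) = a g := by
  show RingQuot.liftAlgHom ℂ _ (RingQuot.mkAlgHom ℂ _ _) = _
  rw [RingQuot.liftAlgHom_mkAlgHom_apply]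
  exact FreeAlgebra.lift_ι_apply _ _

/-- The projection to a smaller level. -/
def levelProj (h w : ℂ) {m M : ℕ} (hm : m ≤ M) : Lev h w M →ₐ[ℂ] Lev h w m :=
  levelLift (oscRel_lgen h w m) (isFilt_levFil h w m) (lgen_mem_levFil rfl) (lgen_mem_levFil rfl)
    (eq_bot_iff.mpr (((isFilt_levFil h w m).anti hm).trans (levFil_eq_bot h w m).le))

@[simp] theorem levelProj_lgen {M : ℕ} (hm : m ≤ M) (g : Gen) :
    levelProj h w hm (lgen h w M g) = lgen h w m g := levelLift_lgen ..

/-- The transition maps of the inverse system, between the sealed algebras. -/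
def levMap (h w : ℂ) (m : ℕ) : Lev h w (m + 1) →ₐ[ℂ] Lev h w m := (Uhw h w).map m

theorem levMap_eq (m : ℕ) : levMap h w m = levelProj h w (Nat.le_succ m) :=
  level_hom_ext fun g => by
    rw [levelProj_lgen]
    exact (gen h w g).2 m

/-- The generators in the first factor of the tensor square. -/
def leg1 (h w : ℂ) (m : ℕ) (g : Gen) : Lev h w m ⊗[ℂ] Lev h w m :=
  lgen h w m g ⊗ₜ 1

/-- The generators in the second factor of the tensor square. -/
def leg2 (h w : ℂ) (m : ℕ) (g : Gen) : Lev h w m ⊗[ℂ] Lev h w m :=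
  1 ⊗ₜ lgen h w m g

theorem legs_leg1_leg2 : Legs (leg1 h w m) (leg2 h w m) := fun g g' => by
  simp [leg1, leg2, Commute, SemiconjBy]

theorem oscRel_leg1 (h w : ℂ) (m : ℕ) : OscRel h w (leg1 h w m) :=
  (oscRel_lgen h w m).tmul_one

theorem oscRel_leg2 (h w : ℂ) (m : ℕ) : OscRel h w (leg2 h w m) :=
  (oscRel_lgen h w m).one_tmul

/-- The coproduct. Modulo total degree `2 m` it determines the coproduct modulo degree `m` in
each factor. -/
def levComul (h w : ℂ) (m : ℕ) : Lev h w (2 * m) →ₐ[ℂ] Lev h w m ⊗[ℂ] Lev h w m :=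
  levelLift (oscRel_cop legs_leg1_leg2 (oscRel_leg1 h w m) (oscRel_leg2 h w m))
    (isFilt_tenFil (isFilt_levFil h w m) (isFilt_levFil h w m))
    (add_mem
      (tmul_mem_tenFil (lgen_mem_levFil rfl) ((isFilt_levFil h w m).mem_zero _) (by omega))
      (tmul_mem_tenFil ((isFilt_levFil h w m).mem_zero _) (lgen_mem_levFil rfl) (by omega)))
    (add_mem
      (tmul_mem_tenFil (lgen_mem_levFil rfl) ((isFilt_levFil h w m).mem_zero _) (by omega))
      (tmul_mem_tenFil ((isFilt_levFil h w m).mem_zero _) (lgen_mem_levFil rfl) (by omega)))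
    (by
      rw [two_mul]
      exact tenFil_eq_bot (isFilt_levFil h w m) (isFilt_levFil h w m) (levFil_eq_bot h w m)
        (levFil_eq_bot h w m))

@[simp] theorem levComul_lgen (g : Gen) :
    levComul h w m (lgen h w (2 * m) g) = cop h w (leg1 h w m) (leg2 h w m) g :=
  levelLift_lgen ..

/-- The antipode, as a homomorphism to the opposite algebra. -/
def levAnti (h w : ℂ) (m : ℕ) : Lev h w m →ₐ[ℂ] (Lev h w m)ᵐᵒᵖ :=
  levelLift (oscRel_lgen h w m).oscRel_anti (isFilt_levFil h w m).op
    (neg_mem (lgen_mem_levFil rfl)) (neg_mem (lgen_mem_levFil rfl))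
    (by rw [levFil_eq_bot]; ext; simp)

@[simp] theorem levAnti_lgen (g : Gen) :
    levAnti h w m (lgen h w m g) = MulOpposite.op (anti h w (lgen h w m) g) :=
  levelLift_lgen ..

/-- The counit. -/
def levCounit (h w : ℂ) (m : ℕ) : Lev h w (m + 1) →ₐ[ℂ] ℂ :=
  levelLift (a := fun _ => 0) (I := fun k => if k = 0 then ⊤ else ⊥)
    ⟨IsNilpotent.zero, IsNilpotent.zero, by
      rw [nsinh_eq_sum (n := 1) h (by simp)]; simp, by
      rw [nesd_eq_sum (n := 1) w (by simp)]; simp, by simp, by simp⟩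
    ⟨by simp, by
      intro i j hij
      show (if j = 0 then _ else _) ≤ (if i = 0 then _ else _)
      split_ifs <;> first | omega | simp, by
      intro i j x y hx hy
      by_cases hi : i = 0
      · by_cases hj : j = 0
        · simp [hi, hj]
        · simp [hj] at hx hy ⊢
          simp [hy]
      · simp [hi] at hx hy ⊢
        simp [hx]⟩
    (by simp) (by simp) (by simp)

@[simp] theorem levCounit_lgen (g : Gen) : levCounit h w m (lgen h w (m + 1) g) = 0 :=
  levelLift_lgen ..

/-- The element conjugating the antipode is a unit. -/
theorem isUnit_nord_lgen :
    IsUnit (nord (w • lgen h w m .Ap) (lgen h w m .N)) := by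
  refine (isFilt_levFil h w m).isUnit_of_sub_mem (levFil_eq_bot h w m) ?_
  have hP : lgen h w m .Ap ∈ levFil h w m 1 := lgen_mem_levFil rfl
  rw [nord_eq_sum (n := m + 1) (by rw [smul_pow, lgen_pow rfl (by omega), smul_zero]),
    Finset.sum_range_succ']
  simp only [Nat.factorial_zero, Nat.cast_one, inv_one, pow_zero, mul_one, one_smul,
    add_sub_cancel_right]
  refine Submodule.sum_mem _ fun k _ => Submodule.smul_mem _ _ ?_
  refine (isFilt_levFil h w m).mul_right ?_ _
  rw [pow_succ]
  exact (isFilt_levFil h w m).mul_left _ (Submodule.smul_mem _ _ hP)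

end Level

/-! ### Inverse limits -/

namespace Tower

open Filter Topology

variable {T T' : Tower}

theorem lim_ext {x y : T.Lim} (h : ∀ m, x.1 m = y.1 m) : x = y := Subtype.ext (funext h)

theorem continuous_lim_iff {X : Type*} [TopologicalSpace X] {f : X → T.Lim} :
    Continuous f ↔ ∀ m, @Continuous X (T.obj m) _ ⊥ (fun x => (f x).1 m) := by
  rw [continuous_iInf_rng]
  exact forall_congr' fun m => continuous_induced_rng

theorem continuous_val (m : ℕ) : @Continuous T.Lim (T.obj m) _ ⊥ (fun x => x.1 m) :=
  continuous_lim_iff.mp continuous_id m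

/-- A map that only depends on one component is continuous. -/
theorem continuous_of_val {X : Type*} [TopologicalSpace X] (m : ℕ) (g : T.obj m → X) :
    Continuous fun x : T.Lim => g (x.1 m) :=
  let _ : TopologicalSpace (T.obj m) := ⊥
  (continuous_bot (f := g)).comp (continuous_val m)

instance : T2Space T.Lim := by
  refine ⟨fun x y hxy => ?_⟩
  obtain ⟨m, hm⟩ : ∃ m, x.1 m ≠ y.1 m := by
    by_contra! hc
    exact hxy (lim_ext hc)
  refine ⟨{z | z.1 m = x.1 m}, {z | z.1 m = y.1 m}, ?_, ?_, rfl, rfl, ?_⟩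
  · exact @IsOpen.preimage _ _ _ ⊥ _ (continuous_val m) {x.1 m} trivial
  · exact @IsOpen.preimage _ _ _ ⊥ _ (continuous_val m) {y.1 m} trivial
  · rw [Set.disjoint_left]
    intro z hz hz'
    exact hm (hz.symm.trans hz')

/-- A series converges if in every component it is a finite sum. -/
theorem hasSum_lim {ι : Type*} {f : ι → T.Lim} {s : T.Lim}
    (h : ∀ m, ∃ F : Finset ι, (∀ k ∉ F, (f k).1 m = 0) ∧ ∑ k ∈ F, (f k).1 m = s.1 m) :
    HasSum f s := by
  show Tendsto _ _ _
  rw [nhds_iInf, tendsto_iInf]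
  intro m
  let _ : TopologicalSpace (T.obj m) := ⊥
  have : DiscreteTopology (T.obj m) := ⟨rfl⟩
  rw [nhds_induced, tendsto_comap_iff, nhds_discrete, tendsto_pure]
  obtain ⟨F, hF, hs⟩ := h m
  rw [SummationFilter.unconditional_filter]
  refine eventually_atTop.mpr ⟨F, fun G hG => ?_⟩
  have e : ((∑ k ∈ G, f k : T.Lim) : ∀ m, T.obj m) m = ∑ k ∈ G, (f k).1 m := by
    rw [AddSubmonoidClass.coe_finsetSum, Finset.sum_apply]
  show ((∑ k ∈ G, f k : T.Lim) : ∀ m, T.obj m) m = s.1 m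
  rw [e, ← hs]
  exact (Finset.sum_subset hG fun k _ hk => hF k hk).symm

/-- The homomorphism of the limits induced by homomorphisms of the components, where the
component `m` of the image depends on the component `n m` of the argument. -/
def liftAlg (n : ℕ → ℕ) (f : ∀ m, T.obj (n m) →ₐ[ℂ] T'.obj m)
    (hf : ∀ (x : T.Lim) m, T'.map m (f (m + 1) (x.1 (n (m + 1)))) = f m (x.1 (n m))) :
    T.Lim →ₐ[ℂ] T'.Lim :=
  AlgHom.codRestrict (AlgHom.pi fun m => (f m).comp
    ((Pi.evalAlgHom ℂ T.obj (n m)).comp T.limit.val)) T'.limit fun x m => hf x m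

/-- The linear analogue of `liftAlg`. -/
def liftLin (n : ℕ → ℕ) (f : ∀ m, T.obj (n m) →ₗ[ℂ] T'.obj m)
    (hf : ∀ (x : T.Lim) m, T'.map m (f (m + 1) (x.1 (n (m + 1)))) = f m (x.1 (n m))) :
    T.Lim →ₗ[ℂ] T'.Lim where
  toFun x := ⟨fun m => f m (x.1 (n m)), hf x⟩
  map_add' x y := lim_ext fun m => map_add (f m) (x.1 (n m)) (y.1 (n m))
  map_smul' c x := lim_ext fun m => map_smul (f m) c (x.1 (n m))

theorem continuous_liftAlg (n : ℕ → ℕ) (f : ∀ m, T.obj (n m) →ₐ[ℂ] T'.obj m)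
    (hf : ∀ (x : T.Lim) m, T'.map m (f (m + 1) (x.1 (n (m + 1)))) = f m (x.1 (n m))) :
    Continuous (liftAlg n f hf) :=
  continuous_lim_iff.mpr fun m => @continuous_of_val T (T'.obj m) ⊥ (n m) (f m)

theorem continuous_liftLin (n : ℕ → ℕ) (f : ∀ m, T.obj (n m) →ₗ[ℂ] T'.obj m)
    (hf : ∀ (x : T.Lim) m, T'.map m (f (m + 1) (x.1 (n (m + 1)))) = f m (x.1 (n m))) :
    Continuous (liftLin n f hf) :=
  continuous_lim_iff.mpr fun m => @continuous_of_val T (T'.obj m) ⊥ (n m) (f m)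

theorem map_ringInverse {B C : Type*} [Ring B] [Ring C] (f : B →+* C) {x : B} (hx : IsUnit x) :
    f (Ring.inverse x) = Ring.inverse (f x) := by
  obtain ⟨u, rfl⟩ := hx
  rw [Ring.inverse_unit, show f u = (Units.map (f : B →* C) u : C) from rfl, Ring.inverse_unit]
  rfl

theorem isUnit_lim {x : T.Lim} (h : ∀ m, IsUnit (x.1 m)) : IsUnit x := by
  let y : T.Lim := ⟨fun m => Ring.inverse (x.1 m), fun m => by
    have := map_ringInverse (T.map m).toRingHom (h (m + 1))
    refine this.trans ?_
    exact congrArg _ (x.2 m)⟩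
  refine ⟨⟨x, y, lim_ext fun m => ?_, lim_ext fun m => ?_⟩, rfl⟩
  · exact Ring.mul_inverse_cancel _ (h m)
  · exact Ring.inverse_mul_cancel _ (h m)

/-- The projection of the limit to a component. -/
def valHom (T : Tower) (m : ℕ) : T.Lim →ₐ[ℂ] T.obj m :=
  (Pi.evalAlgHom ℂ T.obj m).comp T.limit.val

theorem ringInverse_val {x : T.Lim} (h : IsUnit x) (m : ℕ) :
    (Ring.inverse x).1 m = Ring.inverse (x.1 m) :=
  map_ringInverse (T.valHom m).toRingHom h

/-! #### Series in the limit -/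

theorem hasSum_pow {x : T.Lim} (hx : ∀ m, IsNilpotent (x.1 m)) (c : ℕ → ℂ) (p : ℕ → ℕ)
    (hp : ∀ k, k ≤ p k) {s : T.Lim}
    (hs : ∀ m n, x.1 m ^ n = 0 → s.1 m = ∑ k ∈ Finset.range n, c k • x.1 m ^ p k) :
    ∑' k, c k • x ^ p k = s := by
  refine (hasSum_lim fun m => ?_).tsum_eq
  obtain ⟨n, hn⟩ := hx m
  refine ⟨Finset.range n, fun k hk => ?_, (hs m n hn).symm⟩
  show c k • x.1 m ^ p k = 0
  rw [Finset.mem_range, not_lt] at hk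
  rw [pow_eq_zero_of_le (hk.trans (hp k)) hn, smul_zero]

theorem fexp_val {x : T.Lim} (hx : ∀ m, IsNilpotent (x.1 m)) (m : ℕ) :
    (fexp x).1 m = nexp (x.1 m) := by
  let s : T.Lim := ⟨fun m => nexp (x.1 m), fun m => by
    rw [map_nexp _ (hx _), x.2 m]⟩
  have : fexp x = s := hasSum_pow hx _ id (fun _ => le_rfl) fun m n hn => nexp_eq_sum hn
  rw [this]

theorem sinhDiv_val (h : ℂ) {x : T.Lim} (hx : ∀ m, IsNilpotent (x.1 m)) (m : ℕ) :
    (sinhDiv h x).1 m = nsinh h (x.1 m) := by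
  let s : T.Lim := ⟨fun m => nsinh h (x.1 m), fun m => by
    rw [map_nsinh _ h (hx _), x.2 m]⟩
  have : sinhDiv h x = s := hasSum_pow hx _ (fun k => 2 * k + 1) (fun _ => by omega)
    fun m n hn => nsinh_eq_sum h hn
  rw [this]

theorem expSubOneDiv_val (w : ℂ) {x : T.Lim} (hx : ∀ m, IsNilpotent (x.1 m)) (m : ℕ) :
    (expSubOneDiv w x).1 m = nesd w (x.1 m) := by
  let s : T.Lim := ⟨fun m => nesd w (x.1 m), fun m => by
    rw [map_nesd _ w (hx _), x.2 m]⟩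
  have : expSubOneDiv w x = s := hasSum_pow hx _ (fun k => k + 1) (fun _ => by omega)
    fun m n hn => nesd_eq_sum w hn
  rw [this]

end Tower

/-! ### Naturality of the constructions in the algebra -/

section Naturality

variable {B C : Type*} [Ring B] [Algebra ℂ B] [Ring C] [Algebra ℂ C] {h w : ℂ} {a b : Gen → B}

section MapHom

variable (f : B →ₐ[ℂ] C) (ha : OscRel h w a) (hb : OscRel h w b)
include ha

theorem map_eE (c : ℂ) : f (eE c a) = eE c (fun g => f (a g)) := by
  rw [eE, eE, map_nexp f (ha.nil_smulE c), map_smul]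

theorem map_eP (c : ℂ) : f (eP c a) = eP c (fun g => f (a g)) := by
  rw [eP, eP, map_nexp f (ha.nil_smulP c), map_smul]

theorem map_xP : f (xP w a) = xP w (fun g => f (a g)) := by
  rw [xP, xP, map_nesd f _ ha.nilP]

theorem map_nord {y t : B} (hy : IsNilpotent y) : f (nord y t) = nord (f y) (f t) := by
  obtain ⟨n, hn⟩ := hy
  rw [nord_eq_sum hn, nord_eq_sum (n := n) (by rw [← map_pow, hn, map_zero])]
  simp

theorem map_thetaG (σ : ℂ) : f (thetaG w σ a) = thetaG w σ (fun g => f (a g)) := by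
  rw [thetaG, thetaG, nT, nT, map_mul, map_mul, map_eE f ha, map_nord f ha (ha.nil_eE_x σ),
    map_nexp f ha.nil_E_N, map_smul, map_mul, map_eE f ha, map_xP f ha]
  simp

include hb

theorem map_cop (g : Gen) :
    f (cop h w a b g) = cop h w (fun g => f (a g)) (fun g => f (b g)) g := by
  cases g <;> simp [cop, map_eE f ha, map_eE f hb, map_eP f hb, map_nsinh f h hb.nilE]

theorem map_rt (hab : Legs a b) :
    f (rt h w a b) = rt h w (fun g => f (a g)) (fun g => f (b g)) := by
  have c1 : Commute (eE h a * a .A) (xP w b) := by simp (maxDischargeDepth := 9) [hab _ _]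
  have n1 := nil_A_x hb (2 * h) _ c1
  have n2 := (nil_E_N hab ha (2 * h)).neg
  have n3 := nil_N_P hab hb w
  have n4 := (nil_N_P hab.symm ha w).neg
  rw [rt, rt, twInv, twInv, rh, rh, tw, tw, map_mul, map_mul, map_mul, map_nexp f n1,
    map_nexp f n2, map_nexp f n3, map_nexp f n4]
  simp only [map_smul, map_mul, map_neg, map_eE f ha, map_xP f hb]

end MapHom

theorem thetaG_zero (σ : ℂ) : thetaG w σ (fun _ => (0 : B)) = 1 := by
  simp [thetaG, nT, nord, eE, xP, nord_eq_sum (n := 1) (y := (0 : B)) (by simp),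
    nesd_eq_sum (n := 1) (x := (0 : B)) (-w) (by simp), twoSided]

theorem cop_zero_left (b : Gen → B) (g : Gen) : cop h w (fun _ => 0) b g = b g := by
  cases g <;> simp [cop, eE]

theorem cop_zero_right (a : Gen → B) (g : Gen) : cop h w a (fun _ => 0) g = a g := by
  cases g <;> simp [cop, eE, eP, nsinh_eq_sum (n := 1) (x := (0 : B)) h (by simp)]

/-- Coassociativity on the generators. -/
theorem cop_cop {i j k : Gen → B} (hij : Legs i j) (hjk : Legs j k)
    (hi : OscRel h w i) (hj : OscRel h w j) (hk : OscRel h w k) (g : Gen) :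
    cop h w (cop h w i j) k g = cop h w i (cop h w j k) g := by
  have q1 := eP_cop hjk hj hk w
  have q2 := eE_cop hjk hj hk h
  have q3 := eE_cop hij hi hj (-h)
  have q4 := nsinh_cop hjk hj hk
  cases g with
  | N =>
    show (i .N * eP w j + j .N) * eP w k + k .N = i .N * eP w (cop h w j k) +
      (j .N * eP w k + k .N)
    rw [q1]
    noncomm_ring
  | E => exact add_assoc _ _ _
  | Ap => exact add_assoc _ _ _
  | A =>
    show cop h w i j .A * (eE h k * eP w k) + eE (-h) (cop h w i j) * k .A +
        w • (eE (-h) (cop h w i j) * cop h w i j .N * (nsinh h (k .E) * eP w k)) =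
      i .A * (eE h (cop h w j k) * eP w (cop h w j k)) + eE (-h) i * cop h w j k .A +
        w • (eE (-h) i * i .N * (nsinh h (cop h w j k .E) * eP w (cop h w j k)))
    rw [q1, q2, q3, q4]
    have c1 : Commute (eE h k) (eP w j) := by simp [hjk.symm _ _]
    have c2 : Commute (eE h k) (eP w k) := by simp [hk.commE]
    have c3 : Commute (eE (-h) j) (i .N) := by simp [hij.symm _ _]
    have c4 : Commute (nsinh h (k .E)) (eP w j) := by simp [hjk.symm _ _]
    simp only [cop, mul_add, add_mul, smul_add, mul_smul_comm, smul_mul_assoc, mul_assoc,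
      c1.eq, c1.left_comm, c3.eq, c3.left_comm, c4.eq, c4.left_comm]
    abel

end Naturality

/-! ### Sandwiching and the square of the ribbon element -/

section Sandwich

variable {L : Type*} [Ring L] [Algebra ℂ L]

/-- The bilinear action of a tensor: `p ⊗ r` sends `c` to `f p * c * g r`. -/
def tsand (f g : L →ₗ[ℂ] L) : L ⊗[ℂ] L →ₗ[ℂ] L →ₗ[ℂ] L :=
  TensorProduct.lift (LinearMap.mk₂ ℂ
    (fun p r => LinearMap.mulLeft ℂ (f p) ∘ₗ LinearMap.mulRight ℂ (g r))
    (by intros; ext; simp [add_mul])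
    (by intros; ext; simp)
    (by intros; ext; simp [mul_add])
    (by intros; ext; simp))

@[simp] theorem tsand_tmul (f g : L →ₗ[ℂ] L) (p r c : L) :
    tsand f g (p ⊗ₜ r) c = f p * (c * g r) := rfl

/-- For an antihomomorphism `f` and a homomorphism `g` the bilinear action is a right action: in a
product of tensors the left factor acts first. -/
theorem tsand_mul_right {f g : L →ₗ[ℂ] L} (hf : ∀ x y, f (x * y) = f y * f x)
    (hg : ∀ x y, g (x * y) = g x * g y) (D Y : L ⊗[ℂ] L) (c : L) :
    tsand f g (D * Y) c = tsand f g Y (tsand f g D c) := by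
  induction D using TensorProduct.induction_on with
  | zero => simp
  | add x y hx hy => simp only [add_mul, map_add, LinearMap.add_apply, hx, hy]
  | tmul p r =>
    induction Y using TensorProduct.induction_on with
    | zero => simp
    | add x y hx hy => simp only [mul_add, map_add, LinearMap.add_apply, hx, hy]
    | tmul p' r' => simp [hf, hg, mul_assoc]

/-- For a homomorphism `f` and an antihomomorphism `g` the bilinear action is a left action. -/
theorem tsand_mul_left {f g : L →ₗ[ℂ] L} (hf : ∀ x y, f (x * y) = f x * f y)
    (hg : ∀ x y, g (x * y) = g y * g x) (D Y : L ⊗[ℂ] L) (c : L) :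
    tsand f g (D * Y) c = tsand f g D (tsand f g Y c) := by
  induction D using TensorProduct.induction_on with
  | zero => simp
  | add x y hx hy => simp only [add_mul, map_add, LinearMap.add_apply, hx, hy]
  | tmul p r =>
    induction Y using TensorProduct.induction_on with
    | zero => simp
    | add x y hx hy => simp only [mul_add, map_add, LinearMap.add_apply, hx, hy]
    | tmul p' r' => simp [hf, hg, mul_assoc]

variable {h w : ℂ} {a : Gen → L} (ha : OscRel h w a)
include ha

theorem eE_tmul_one (c : ℂ) : eE c (fun g => a g ⊗ₜ[ℂ] (1 : L)) = eE c a ⊗ₜ 1 :=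
  (map_eE (Algebra.TensorProduct.includeLeft : L →ₐ[ℂ] L ⊗[ℂ] L) ha c).symm

theorem eE_one_tmul (c : ℂ) : eE c (fun g => (1 : L) ⊗ₜ[ℂ] a g) = 1 ⊗ₜ eE c a :=
  (map_eE (Algebra.TensorProduct.includeRight : L →ₐ[ℂ] L ⊗[ℂ] L) ha c).symm

theorem eP_tmul_one (c : ℂ) : eP c (fun g => a g ⊗ₜ[ℂ] (1 : L)) = eP c a ⊗ₜ 1 :=
  (map_eP (Algebra.TensorProduct.includeLeft : L →ₐ[ℂ] L ⊗[ℂ] L) ha c).symm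

theorem eP_one_tmul (c : ℂ) : eP c (fun g => (1 : L) ⊗ₜ[ℂ] a g) = 1 ⊗ₜ eP c a :=
  (map_eP (Algebra.TensorProduct.includeRight : L →ₐ[ℂ] L ⊗[ℂ] L) ha c).symm

theorem nsinh_tmul_one : nsinh h (a .E ⊗ₜ[ℂ] (1 : L)) = nsinh h (a .E) ⊗ₜ 1 :=
  (map_nsinh (Algebra.TensorProduct.includeLeft : L →ₐ[ℂ] L ⊗[ℂ] L) h ha.nilE).symm

theorem nsinh_one_tmul : nsinh h ((1 : L) ⊗ₜ[ℂ] a .E) = 1 ⊗ₜ nsinh h (a .E) :=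
  (map_nsinh (Algebra.TensorProduct.includeRight : L →ₐ[ℂ] L ⊗[ℂ] L) h ha.nilE).symm

theorem thetaG_tmul_one (σ : ℂ) : thetaG w σ (fun g => a g ⊗ₜ[ℂ] (1 : L)) = thetaG w σ a ⊗ₜ 1 :=
  (map_thetaG (Algebra.TensorProduct.includeLeft : L →ₐ[ℂ] L ⊗[ℂ] L) ha σ).symm

theorem thetaG_one_tmul (σ : ℂ) : thetaG w σ (fun g => (1 : L) ⊗ₜ[ℂ] a g) = 1 ⊗ₜ thetaG w σ a :=
  (map_thetaG (Algebra.TensorProduct.includeRight : L →ₐ[ℂ] L ⊗[ℂ] L) ha σ).symm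

/-- The coproduct of `A`, as a sum of pure tensors. -/
theorem cop_A_tmul : cop h w (fun g => a g ⊗ₜ[ℂ] (1 : L)) (fun g => (1 : L) ⊗ₜ[ℂ] a g) .A =
    a .A ⊗ₜ (eE h a * eP w a) + eE (-h) a ⊗ₜ a .A +
      w • ((eE (-h) a * a .N) ⊗ₜ (nsinh h (a .E) * eP w a)) := by
  simp [cop, eE_tmul_one ha, eE_one_tmul ha, eP_one_tmul ha, nsinh_one_tmul ha]

theorem cop_N_tmul : cop h w (fun g => a g ⊗ₜ[ℂ] (1 : L)) (fun g => (1 : L) ⊗ₜ[ℂ] a g) .N =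
    a .N ⊗ₜ eP w a + 1 ⊗ₜ a .N := by
  simp [cop, eP_one_tmul ha]

theorem cop_flip_A_tmul : cop h w (fun g => (1 : L) ⊗ₜ[ℂ] a g) (fun g => a g ⊗ₜ[ℂ] (1 : L)) .A =
    (eE h a * eP w a) ⊗ₜ a .A + a .A ⊗ₜ eE (-h) a +
      w • ((nsinh h (a .E) * eP w a) ⊗ₜ (eE (-h) a * a .N)) := by
  simp [cop, eE_tmul_one ha, eE_one_tmul ha, eP_tmul_one ha, nsinh_tmul_one ha]

theorem cop_flip_N_tmul : cop h w (fun g => (1 : L) ⊗ₜ[ℂ] a g) (fun g => a g ⊗ₜ[ℂ] (1 : L)) .N =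
    eP w a ⊗ₜ a .N + a .N ⊗ₜ 1 := by
  simp [cop, eP_tmul_one ha]

end Sandwich

section Drinfeld

variable {L : Type*} [Ring L] [Algebra ℂ L] {S : L →ₗ[ℂ] L}

theorem anti_map_pow (S1 : S 1 = 1) (Sm : ∀ x y, S (x * y) = S y * S x) (x : L) (k : ℕ) :
    S (x ^ k) = S x ^ k := by
  induction k with
  | zero => simp [S1]
  | succ k ih => rw [pow_succ, Sm, ih, pow_succ']

theorem anti_map_nexp (S1 : S 1 = 1) (Sm : ∀ x y, S (x * y) = S y * S x) {x : L}
    (hx : IsNilpotent x) : S (nexp x) = nexp (S x) := by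
  obtain ⟨n, hn⟩ := hx
  rw [nexp_eq_sum hn, nexp_eq_sum (n := n) (by rw [← anti_map_pow S1 Sm, hn, map_zero])]
  simp [anti_map_pow S1 Sm]

theorem anti_map_nsinh (S1 : S 1 = 1) (Sm : ∀ x y, S (x * y) = S y * S x) (h : ℂ) {x : L}
    (hx : IsNilpotent x) : S (nsinh h x) = nsinh h (S x) := by
  obtain ⟨n, hn⟩ := hx
  rw [nsinh_eq_sum h hn, nsinh_eq_sum (n := n) h (by rw [← anti_map_pow S1 Sm, hn, map_zero])]
  simp [anti_map_pow S1 Sm]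

variable {h w : ℂ} {a : Gen → L} (ha : OscRel h w a) (S1 : S 1 = 1)
  (Sm : ∀ x y, S (x * y) = S y * S x) (Sg : ∀ g, S (a g) = anti h w a g)
include ha S1 Sm Sg

theorem S_eE (c : ℂ) : S (eE c a) = eE (-c) a := by
  rw [eE, anti_map_nexp S1 Sm (ha.nil_smulE c), map_smul, Sg, eE, anti, neg_smul, smul_neg]

theorem S_eP (c : ℂ) : S (eP c a) = eP (-c) a := by
  rw [eP, anti_map_nexp S1 Sm (ha.nil_smulP c), map_smul, Sg, eP, anti, neg_smul, smul_neg]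

theorem S_nsinh : S (nsinh h (a .E)) = -nsinh h (a .E) := by
  rw [anti_map_nsinh S1 Sm h ha.nilE, Sg, anti, nsinh_neg h _ ha.nilE]

/-- `m (S ⊗ id) Δ = ε` on the generators. -/
theorem tsand_cop_left (g : Gen) :
    tsand S LinearMap.id (cop h w (fun g => a g ⊗ₜ[ℂ] (1 : L)) (fun g => (1 : L) ⊗ₜ[ℂ] a g) g) 1 =
      0 := by
  have c1 (c : ℂ) (g : Gen) : Commute (a g) (eE c a) := by simp [ha.commE']
  have c2 (g : Gen) : Commute (a g) (nsinh h (a .E)) := by simp [ha.commE']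
  have c3 (c d : ℂ) : Commute (eP c a) (eE d a) := by simp [ha.commE']
  have c4 (c : ℂ) : Commute (eP c a) (nsinh h (a .E)) := by simp [ha.commE']
  have c5 (c : ℂ) : Commute (nsinh h (a .E)) (eE c a) := by simp [ha.commE']
  have q1 := ha.eP_neg_mul w
  have q2 := ha.eP_mul_neg w
  cases g with
  | N =>
    rw [cop_N_tmul ha]
    simp only [map_add, LinearMap.add_apply, tsand_tmul, LinearMap.id_apply, one_mul, S1, Sg, anti,
      neg_mul, mul_assoc, q1, mul_one]
    abel
  | E => simp [cop, S1, Sg, anti]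
  | Ap => simp [cop, S1, Sg, anti]
  | A =>
    rw [cop_A_tmul ha]
    simp only [map_add, LinearMap.add_apply, tsand_tmul, LinearMap.id_apply, one_mul, S1, Sg, anti,
      map_smul, LinearMap.smul_apply, Sm, S_eE ha S1 Sm Sg, neg_neg, add_mul, neg_mul,
      smul_mul_assoc, mul_assoc, (c3 _ _).eq, (c3 _ _).left_comm, q1,
      lassoc q1, (c1 _ _).eq, (c1 _ _).left_comm, mul_one, (c2 _).eq, (c2 _).left_comm,
      (c4 _).left_comm, (c4 _).eq, (c5 _).left_comm, (c5 _).eq]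
    module

/-- `m (id ⊗ S) Δ = ε` on the generators. -/
theorem tsand_cop_right (g : Gen) :
    tsand LinearMap.id S (cop h w (fun g => a g ⊗ₜ[ℂ] (1 : L)) (fun g => (1 : L) ⊗ₜ[ℂ] a g) g) 1 =
      0 := by
  have c1 (c : ℂ) (g : Gen) : Commute (a g) (eE c a) := by simp [ha.commE']
  have c2 (g : Gen) : Commute (a g) (nsinh h (a .E)) := by simp [ha.commE']
  have c3 (c d : ℂ) : Commute (eP c a) (eE d a) := by simp [ha.commE']
  have c4 (c : ℂ) : Commute (eP c a) (nsinh h (a .E)) := by simp [ha.commE']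
  have c5 (c : ℂ) : Commute (nsinh h (a .E)) (eE c a) := by simp [ha.commE']
  cases g with
  | N =>
    rw [cop_N_tmul ha]
    simp only [map_add, LinearMap.add_apply, tsand_tmul, LinearMap.id_apply, one_mul, Sg, anti,
      S_eP ha S1 Sm Sg]
    abel
  | E => simp [cop, S1, Sg, anti]
  | Ap => simp [cop, S1, Sg, anti]
  | A =>
    rw [cop_A_tmul ha]
    simp only [map_add, LinearMap.add_apply, tsand_tmul, LinearMap.id_apply, one_mul, S1, Sg, anti,
      map_smul, LinearMap.smul_apply, Sm, S_eE ha S1 Sm Sg, S_eP ha S1 Sm Sg,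
      S_nsinh ha S1 Sm Sg, neg_neg, add_mul, neg_mul, mul_add, mul_neg,
      smul_mul_assoc, mul_smul_comm, mul_assoc, (c3 _ _).eq,
      (c3 _ _).left_comm,
      (c1 _ _).eq, (c1 _ _).left_comm, mul_one, (c2 _).eq, (c2 _).left_comm,
      (c4 _).left_comm, (c4 _).eq, (c5 _).left_comm, (c5 _).eq]
    module

/-- The square of the antipode is conjugation by `e ^ (w A⁺)`. -/
theorem S_S (hgen : ∀ p : L → Prop, (∀ g, p (a g)) → (∀ c, p (algebraMap ℂ L c)) →
    (∀ x y, p x → p y → p (x + y)) → (∀ x y, p x → p y → p (x * y)) → ∀ x, p x) (x : L) :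
    S (S x) * eP w a = eP w a * x := by
  have q1 := ha.eP_neg_mul w
  have q2 := ha.eP_mul_neg w
  refine hgen (fun x => S (S x) * eP w a = eP w a * x) ?_ ?_ ?_ ?_ x
  · intro g
    have c2 : Commute (a .N) (nsinh h (a .E)) := by simp [ha.commE']
    have c4 (c : ℂ) : Commute (eP c a) (nsinh h (a .E)) := by simp [ha.commE']
    cases g with
    | N =>
      simp only [Sg, anti, map_neg, Sm, S_eP ha S1 Sm Sg, neg_neg, mul_neg, mul_assoc, q1, mul_one]
    | E =>
      simp only [Sg, anti, map_neg, neg_neg]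
      exact (commute_eP w (ha.commE _))
    | Ap =>
      simp only [Sg, anti, map_neg, neg_neg]
      exact (commute_eP w (Commute.refl _))
    | A =>
      simp only [Sg, anti, map_neg, map_add, map_smul, Sm, S_eP ha S1 Sm Sg, S_nsinh ha S1 Sm Sg,
        neg_neg, mul_add, mul_neg, neg_mul, add_mul, smul_mul_assoc, mul_smul_comm, mul_assoc, q1,
        mul_one, c2.eq, c2.left_comm, (c4 _).eq, (c4 _).left_comm, smul_neg]
      abel
  · intro c
    have : S (algebraMap ℂ L c) = algebraMap ℂ L c := by
      rw [Algebra.algebraMap_eq_smul_one, map_smul, S1]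
    rw [this, this, Algebra.commutes]
  · intro x y hx hy
    rw [map_add, map_add, add_mul, hx, hy, mul_add]
  · intro x y hx hy
    rw [Sm, Sm, mul_assoc, hy, ← mul_assoc, hx, mul_assoc]

/-- `S(θ) = θ`, for an antihomomorphism `S` given on the generators as the antipode. -/
theorem S_thetaG (hV : IsUnit (nord (w • a .Ap) (a .N))) :
    S (thetaG w (-h) a) = thetaG w (-h) a := by
  let S' : L →ₐ[ℂ] Lᵐᵒᵖ := AlgHom.ofLinearMap ((MulOpposite.opLinearEquiv ℂ).toLinearMap ∘ₗ S)
    (by simp [S1]) (by intro x y; simp [Sm])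
  have e1 := map_thetaG S' ha (-h)
  have e2 : (fun g => S' (a g)) = fun g => MulOpposite.op (anti h w a g) :=
    funext fun g => congrArg MulOpposite.op (Sg g)
  rw [e2] at e1
  have e3 := ha.thetaG_anti (σ := -h) ha.smul_sinh_neg (by
    rw [neg_neg]; exact eE_smul_sinh ha) hV
  rw [← e1] at e3
  exact e3

/-- Drinfeld's argument: with `u = m (S ⊗ id) R₂₁`, the element `e ^ (-w A⁺) u` is central, hence
`S u` is inverse to `m (S ⊗ id) R⁻¹`, and the latter is `θ⁻² u`. -/
theorem drinfeld_sq
    (hgen : ∀ p : L → Prop, (∀ g, p (a g)) → (∀ c, p (algebraMap ℂ L c)) →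
      (∀ x y, p x → p y → p (x + y)) → (∀ x y, p x → p y → p (x * y)) → ∀ x, p x)
    (hV : IsUnit (nord (w • a .Ap) (a .N)))
    (hθ : tsand S LinearMap.id (thetaG w h (cop h w (fun g => a g ⊗ₜ[ℂ] (1 : L))
      (fun g => (1 : L) ⊗ₜ[ℂ] a g))) 1 = 1)
    (hR : IsUnit (rt h w (fun g => a g ⊗ₜ[ℂ] (1 : L)) (fun g => (1 : L) ⊗ₜ[ℂ] a g))) :
    tsand S LinearMap.id (rt h w (fun g => (1 : L) ⊗ₜ[ℂ] a g) (fun g => a g ⊗ₜ[ℂ] (1 : L))) 1 *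
      S (tsand S LinearMap.id
        (rt h w (fun g => (1 : L) ⊗ₜ[ℂ] a g) (fun g => a g ⊗ₜ[ℂ] (1 : L))) 1) =
      thetaG w (-h) a ^ 2 := by
  have Sm' : ∀ x y : L, (LinearMap.id : L →ₗ[ℂ] L) (x * y) =
      (LinearMap.id : L →ₗ[ℂ] L) x * (LinearMap.id : L →ₗ[ℂ] L) y := fun _ _ => rfl
  have hi : OscRel h w (fun g => a g ⊗ₜ[ℂ] (1 : L)) := ha.tmul_one
  have hj : OscRel h w (fun g => (1 : L) ⊗ₜ[ℂ] a g) := ha.one_tmul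
  have hij : Legs (fun g => a g ⊗ₜ[ℂ] (1 : L)) (fun g => (1 : L) ⊗ₜ[ℂ] a g) := fun g g' => by
    simp [Commute, SemiconjBy]
  have q1 := ha.eP_neg_mul w
  have q2 := ha.eP_mul_neg w
  have hΔ := oscRel_cop hij hi hj
  have h1 := rt_rt_thetaG_cop hij hi hj
  have h2 := hΔ.thetaG_mul_neg (σ := -h) hΔ.smul_sinh_neg
  rw [neg_neg] at h2
  have h3 := fun g => tsand_cop_left ha S1 Sm Sg g
  have h4 := fun g => rt_cop hij.symm hj hi g
  have Sθ := S_thetaG ha S1 Sm Sg hV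
  have cθ : ∀ x, Commute (thetaG w (-h) a) x := fun x =>
    hgen (fun x => Commute (thetaG w (-h) a) x) (ha.thetaG_comm ha.smul_sinh_neg)
      (fun c => (Algebra.commutes c _).symm) (fun _ _ hx hy => hx.add_right hy)
      (fun _ _ hx hy => hx.mul_right hy) x
  rw [thetaG_tmul_one ha, thetaG_one_tmul ha, Algebra.TensorProduct.tmul_mul_tmul, one_mul,
    mul_one] at h1
  have fA := cop_flip_A_tmul ha
  have fN := cop_flip_N_tmul ha
  have fE : cop h w (fun g => (1 : L) ⊗ₜ[ℂ] a g) (fun g => a g ⊗ₜ[ℂ] (1 : L)) .E =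
    1 ⊗ₜ a .E + a .E ⊗ₜ 1 := rfl
  have fP : cop h w (fun g => (1 : L) ⊗ₜ[ℂ] a g) (fun g => a g ⊗ₜ[ℂ] (1 : L)) .Ap =
    1 ⊗ₜ a .Ap + a .Ap ⊗ₜ 1 := rfl
  have swap : ∀ T : L ⊗[ℂ] L, S (tsand S LinearMap.id (Algebra.TensorProduct.comm ℂ L L T) 1) =
      tsand S (S ∘ₗ S) T 1 := by
    intro T
    induction T using TensorProduct.induction_on with
    | zero => simp
    | add x y hx hy => simp only [map_add, LinearMap.add_apply, hx, hy]
    | tmul p r => simp [Sm]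
  have hR21 : rt h w (fun g => (1 : L) ⊗ₜ[ℂ] a g) (fun g => a g ⊗ₜ[ℂ] (1 : L)) =
      Algebra.TensorProduct.comm ℂ L L
        (rt h w (fun g => a g ⊗ₜ[ℂ] (1 : L)) (fun g => (1 : L) ⊗ₜ[ℂ] a g)) :=
    (map_rt (Algebra.TensorProduct.comm ℂ L L).toAlgHom hi hj hij).symm
  rw [hR21] at h1 h4 ⊢
  generalize rt h w (fun g => a g ⊗ₜ[ℂ] (1 : L)) (fun g => (1 : L) ⊗ₜ[ℂ] a g) = R at *
  obtain ⟨⟨R, R', hRR', hR'R⟩, rfl⟩ := hR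
  dsimp only at *
  set u := tsand S LinearMap.id (Algebra.TensorProduct.comm ℂ L L R) 1 with hu
  set P := tsand S LinearMap.id R' 1 with hP
  -- `u = θ ^ 2 P`
  have e1 : u = thetaG w (-h) a ^ 2 * P := by
    have e2 : Algebra.TensorProduct.comm ℂ L L R = (thetaG w (-h) a ⊗ₜ thetaG w (-h) a) *
        (thetaG w h (cop h w (fun g => a g ⊗ₜ[ℂ] (1 : L)) (fun g => (1 : L) ⊗ₜ[ℂ] a g)) * R') := by
      rw [← h1, mul_assoc, lassoc h2, one_mul, mul_assoc, hRR', mul_one]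
    have e3 : ∀ (T : L ⊗[ℂ] L) c, tsand S LinearMap.id T (thetaG w (-h) a ^ 2 * c) =
        thetaG w (-h) a ^ 2 * tsand S LinearMap.id T c := by
      intro T c
      induction T using TensorProduct.induction_on with
      | zero => simp
      | add x y hx hy => simp only [map_add, LinearMap.add_apply, hx, hy, mul_add]
      | tmul p r =>
        rw [tsand_tmul, tsand_tmul, mul_assoc, ((cθ _).pow_left 2).symm.left_comm]
    rw [hu, e2, tsand_mul_right Sm Sm', tsand_mul_right Sm Sm', tsand_tmul, Sθ, one_mul,
      LinearMap.id_apply, ← pow_two, ← mul_one (thetaG w (-h) a ^ 2), e3, e3, hθ, mul_one]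
  -- the bilinear action of the opposite coproduct of `g` annihilates `u`
  have e4 (g : Gen) : tsand S LinearMap.id
      (cop h w (fun g => (1 : L) ⊗ₜ[ℂ] a g) (fun g => a g ⊗ₜ[ℂ] (1 : L)) g) u = 0 := by
    rw [hu, ← tsand_mul_right Sm Sm', h4 g, tsand_mul_right Sm Sm', h3, map_zero]
  have uE : Commute (a .E) u := by
    have := e4 .E
    rw [fE] at this
    simp only [map_add, LinearMap.add_apply, tsand_tmul, S1, Sg, anti, LinearMap.id_apply,
      one_mul, mul_one, neg_mul] at this
    exact (add_neg_eq_zero.mp this).symm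
  have uP : Commute (a .Ap) u := by
    have := e4 .Ap
    rw [fP] at this
    simp only [map_add, LinearMap.add_apply, tsand_tmul, S1, Sg, anti, LinearMap.id_apply,
      one_mul, mul_one, neg_mul] at this
    exact (add_neg_eq_zero.mp this).symm
  have uN : Commute (a .N) (eP (-w) a * u) := by
    have := e4 .N
    rw [fN] at this
    simp only [map_add, LinearMap.add_apply, tsand_tmul, S1, Sg, anti, LinearMap.id_apply,
      one_mul, mul_one, neg_mul, S_eP ha S1 Sm Sg] at this
    have := add_neg_eq_zero.mp this
    rw [← mul_assoc, mul_assoc (a .N)] at this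
    exact this.symm
  have uA : Commute (a .A) (eP (-w) a * u) := by
    have := e4 .A
    have c0 (c : ℂ) : Commute (eE c a) u := commute_eE_left c uE
    have c1 (c : ℂ) (g : Gen) : Commute (a g) (eE c a) := by simp [ha.commE']
    have c3 (c d : ℂ) : Commute (eP c a) (eE d a) := by simp [ha.commE']
    have c5 (c : ℂ) : Commute (nsinh h (a .E)) (eE c a) := by simp [ha.commE']
    have c6 : Commute (a .N) (nsinh h (a .E)) := by simp [ha.commE']
    have c7 (c : ℂ) : Commute (eP c a) (nsinh h (a .E)) := by simp [ha.commE']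
    rw [fA] at this
    simp only [map_add, LinearMap.add_apply, tsand_tmul, S1, Sm, Sg, anti, LinearMap.id_apply,
      map_smul, LinearMap.smul_apply,
      one_mul, mul_one, neg_mul, mul_neg, add_mul, smul_mul_assoc, S_eP ha S1 Sm Sg,
      S_eE ha S1 Sm Sg, S_nsinh ha S1 Sm Sg, mul_assoc, (c0 _).symm.eq, (c0 _).symm.left_comm,
      (c1 _ _).eq, (c1 _ _).left_comm, (c3 _ _).eq, (c3 _ _).left_comm, (c5 _).eq,
      (c5 _).left_comm, c6.eq, c6.left_comm, (c7 _).eq, (c7 _).left_comm] at this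
    have k1 := uN.eq
    rw [mul_assoc] at k1
    rw [k1] at this
    have k2 : eE (-h) a * (a .A * (eP (-w) a * u)) = eE (-h) a * (eP (-w) a * u * a .A) := by
      rw [eq_comm, ← sub_eq_zero, ← this]
      simp only [mul_assoc, smul_neg]
      abel
    have k3 := congrArg (eE h a * ·) k2
    show a .A * (eP (-w) a * u) = eP (-w) a * u * a .A
    simpa only [lassoc (ha.eE_mul _ _), add_neg_cancel, eE_zero, one_mul] using k3
  set z := eP (-w) a * u with hz
  have zc : ∀ x, Commute z x := fun x =>
    hgen (fun x => Commute z x) (fun g => by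
        cases g with
        | N => exact uN.symm
        | A => exact uA.symm
        | E => exact ((commute_eP (-w) (ha.commE _)).mul_right uE).symm
        | Ap => exact ((commute_eP (-w) (Commute.refl _)).mul_right uP).symm)
      (fun c => (Algebra.commutes c _).symm) (fun _ _ hx hy => hx.add_right hy)
      (fun _ _ hx hy => hx.mul_right hy) x
  have hS2 := S_S ha S1 Sm Sg hgen
  have uz : u = eP w a * z := by rw [hz, lassoc q2, one_mul]
  have Su : S u = S z * eP (-w) a := by rw [uz, Sm, S_eP ha S1 Sm Sg]
  -- `S z` commutes with the image of `S`, which is everything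
  have Szc : ∀ x, Commute (S z) x := by
    intro x
    have k1 : S (S (eP (-w) a * x * eP w a)) = x := by
      have := hS2 (eP (-w) a * x * eP w a)
      rw [mul_assoc, lassoc q2, one_mul] at this
      have k := congrArg (· * eP (-w) a) this
      simpa only [mul_assoc, q2, mul_one] using k
    rw [← k1, Commute, SemiconjBy, ← Sm, ← Sm, (zc _).eq]
  have k2 : ∀ x, S u * S (S x) = x * S u := by
    intro x
    have k1 : S (S x) = eP w a * x * eP (-w) a := by
      rw [← hS2 x, mul_assoc, q2, mul_one]
    rw [k1, Su, mul_assoc, mul_assoc, lassoc q1, one_mul, ← mul_assoc, (Szc x).eq, mul_assoc]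
  have Sm2 : ∀ x y, (S ∘ₗ S) (x * y) = (S ∘ₗ S) x * (S ∘ₗ S) y := by
    intro x y; simp [Sm]
  have k3 : ∀ T : L ⊗[ℂ] L, tsand S (S ∘ₗ S) T (S u) = tsand S LinearMap.id T 1 * S u := by
    intro T
    induction T using TensorProduct.induction_on with
    | zero => simp
    | add x y hx hy => simp only [map_add, LinearMap.add_apply, hx, hy, add_mul]
    | tmul p r => simp [k2, mul_assoc]
  have k4 : P * S u = 1 := by
    rw [hP, ← k3, hu, swap, ← tsand_mul_right Sm Sm2, hRR', Algebra.TensorProduct.one_def,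
      tsand_tmul]
    simp [S1]
  rw [e1, mul_assoc, ← e1, k4, mul_one]

end Drinfeld

/-! ### The Hopf algebra structure of the limit -/

section HopfStructure

open Tower

variable {h w : ℂ}

theorem subsingleton_level_zero : Subsingleton (Lev h w 0) := by
  refine subsingleton_of_zero_eq_one ?_
  have := mkLev_rel (Rel.word (h := h) (w := w) (m := 0) [] (Nat.zero_le _))
  rw [map_zero] at this
  exact this.symm.trans (map_one _)

/-- The components of an element of the limit. -/
def coord (x : (Uhw h w).Lim) (m : ℕ) : Lev h w m := x.1 m

/-- The components of an element of the completed tensor square. -/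
def coord₂ (x : ((Uhw h w).tensor (Uhw h w)).Lim) (m : ℕ) : Lev h w m ⊗[ℂ] Lev h w m := x.1 m

theorem levMap_coord (x : (Uhw h w).Lim) (m : ℕ) :
    levMap h w m (coord x (m + 1)) = coord x m := x.2 m

theorem map_levMap_coord₂ (x : ((Uhw h w).tensor (Uhw h w)).Lim) (m : ℕ) :
    Algebra.TensorProduct.map (levMap h w m) (levMap h w m) (coord₂ x (m + 1)) = coord₂ x m :=
  x.2 m

theorem levelProj_val {m M : ℕ} (hm : m ≤ M) (x : (Uhw h w).Lim) :
    levelProj h w hm (coord x M) = coord x m := by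
  induction M, hm using Nat.le_induction with
  | base =>
    have : levelProj h w (le_refl m) = AlgHom.id ℂ _ := level_hom_ext fun g => by simp
    rw [this]; rfl
  | succ M hm ih =>
    have : levelProj h w (hm.trans (Nat.le_succ M)) =
        (levelProj h w hm).comp (levMap h w M) := by
      rw [levMap_eq]
      exact level_hom_ext fun g => by simp
    rw [this, AlgHom.comp_apply, levMap_coord, ih]

theorem map_levelProj_val {m M : ℕ} (hm : m ≤ M) (x : ((Uhw h w).tensor (Uhw h w)).Lim) :
    Algebra.TensorProduct.map (levelProj h w hm) (levelProj h w hm) (coord₂ x M) = coord₂ x m := by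
  induction M, hm using Nat.le_induction with
  | base =>
    have : levelProj h w (le_refl m) = AlgHom.id ℂ _ := level_hom_ext fun g => by simp
    rw [this, Algebra.TensorProduct.map_id]; rfl
  | succ M hm ih =>
    have : levelProj h w (hm.trans (Nat.le_succ M)) =
        (levelProj h w hm).comp (levMap h w M) := by
      rw [levMap_eq]
      exact level_hom_ext fun g => by simp
    rw [this, Algebra.TensorProduct.map_comp, AlgHom.comp_apply, map_levMap_coord₂,
      ih]

/-- Compatibility of the coproducts with the projections. -/
theorem levComul_proj {m M : ℕ} (hm : m ≤ M) :
    (Algebra.TensorProduct.map (levelProj h w hm) (levelProj h w hm)).comp (levComul h w M) =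
      (levComul h w m).comp (levelProj h w (Nat.mul_le_mul_left 2 hm)) := by
  refine level_hom_ext (B := Lev h w m ⊗[ℂ] Lev h w m) fun g => ?_
  rw [AlgHom.comp_apply, AlgHom.comp_apply, levComul_lgen, levelProj_lgen, levComul_lgen]
  refine (map_cop (C := Lev h w m ⊗[ℂ] Lev h w m)
    (Algebra.TensorProduct.map (levelProj h w hm) (levelProj h w hm))
    (oscRel_leg1 h w M) (oscRel_leg2 h w M) g).trans ?_
  congr 1
  · funext g
    simp [leg1]
  · funext g
    simp [leg2]

/-- The coproduct of the limit. -/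
def limComul (h w : ℂ) : (Uhw h w).Lim →ₐ[ℂ] ((Uhw h w).tensor (Uhw h w)).Lim :=
  liftAlg (T := Uhw h w) (T' := (Uhw h w).tensor (Uhw h w)) (fun m => 2 * m)
    (fun m => levComul h w m) (by
      intro x m
      have := DFunLike.congr_fun (levComul_proj (h := h) (w := w) (Nat.le_succ m))
        (coord x (2 * (m + 1)))
      rw [AlgHom.comp_apply, AlgHom.comp_apply, levelProj_val, ← levMap_eq] at this
      exact this)

/-- The map `Δ ⊗ id` of components. -/
def levComulId (h w : ℂ) (m : ℕ) : Lev h w (2 * m) ⊗[ℂ] Lev h w (2 * m) →ₐ[ℂ]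
    Lev h w m ⊗[ℂ] (Lev h w m ⊗[ℂ] Lev h w m) :=
  (Algebra.TensorProduct.assoc ℂ ℂ ℂ (Lev h w m) (Lev h w m) (Lev h w m)).toAlgHom.comp
    (Algebra.TensorProduct.map (levComul h w m) (levelProj h w (Nat.le_mul_of_pos_left m two_pos)))

/-- The map `id ⊗ Δ` of components. -/
def levIdComul (h w : ℂ) (m : ℕ) : Lev h w (2 * m) ⊗[ℂ] Lev h w (2 * m) →ₐ[ℂ]
    Lev h w m ⊗[ℂ] (Lev h w m ⊗[ℂ] Lev h w m) :=
  Algebra.TensorProduct.map (levelProj h w (Nat.le_mul_of_pos_left m two_pos)) (levComul h w m)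

theorem assoc_map {A B C A' B' C' : Type*} [Ring A] [Algebra ℂ A] [Ring B] [Algebra ℂ B] [Ring C]
    [Algebra ℂ C] [Ring A'] [Algebra ℂ A'] [Ring B'] [Algebra ℂ B'] [Ring C'] [Algebra ℂ C']
    (f : A →ₐ[ℂ] A') (g : B →ₐ[ℂ] B') (k : C →ₐ[ℂ] C') (x : A ⊗[ℂ] B) (c : C) :
    Algebra.TensorProduct.map f (Algebra.TensorProduct.map g k)
      (Algebra.TensorProduct.assoc ℂ ℂ ℂ A B C (x ⊗ₜ c)) =
    Algebra.TensorProduct.assoc ℂ ℂ ℂ A' B' C' (Algebra.TensorProduct.map f g x ⊗ₜ k c) := by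
  induction x using TensorProduct.induction_on with
  | zero => simp
  | tmul a b => simp
  | add a b ha hb => simp only [TensorProduct.add_tmul, map_add, ha, hb]

theorem levelProj_comp {m n M : ℕ} (h1 : m ≤ n) (h2 : n ≤ M) :
    (levelProj h w h1).comp (levelProj h w h2) = levelProj h w (h1.trans h2) :=
  level_hom_ext fun g => by simp

theorem levelProj_levelProj {m n M : ℕ} (h1 : m ≤ n) (h2 : n ≤ M) (x : Lev h w M) :
    levelProj h w h1 (levelProj h w h2 x) = levelProj h w (h1.trans h2) x := by
  rw [← levelProj_comp h1 h2]; rfl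

theorem levComulId_tmul (m : ℕ) (x y : Lev h w (2 * m)) :
    levComulId h w m (x ⊗ₜ y) = Algebra.TensorProduct.assoc ℂ ℂ ℂ _ _ _
      (levComul h w m x ⊗ₜ levelProj h w (Nat.le_mul_of_pos_left m two_pos) y) := rfl

theorem levComulId_proj {m M : ℕ} (hm : m ≤ M) (x : Lev h w (2 * M) ⊗[ℂ] Lev h w (2 * M)) :
    Algebra.TensorProduct.map (levelProj h w hm)
        (Algebra.TensorProduct.map (levelProj h w hm) (levelProj h w hm)) (levComulId h w M x) =
      levComulId h w m (Algebra.TensorProduct.map (levelProj h w (Nat.mul_le_mul_left 2 hm))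
        (levelProj h w (Nat.mul_le_mul_left 2 hm)) x) := by
  induction x using TensorProduct.induction_on with
  | zero => simp
  | add x y hx hy => simp only [map_add, hx, hy]
  | tmul x y =>
    have e1 := DFunLike.congr_fun (levComul_proj (h := h) (w := w) hm) x
    rw [AlgHom.comp_apply, AlgHom.comp_apply] at e1
    rw [Algebra.TensorProduct.map_tmul, levComulId_tmul, levComulId_tmul, assoc_map, e1,
      levelProj_levelProj, levelProj_levelProj]

theorem levIdComul_proj {m M : ℕ} (hm : m ≤ M) (x : Lev h w (2 * M) ⊗[ℂ] Lev h w (2 * M)) :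
    Algebra.TensorProduct.map (levelProj h w hm)
        (Algebra.TensorProduct.map (levelProj h w hm) (levelProj h w hm)) (levIdComul h w M x) =
      levIdComul h w m (Algebra.TensorProduct.map (levelProj h w (Nat.mul_le_mul_left 2 hm))
        (levelProj h w (Nat.mul_le_mul_left 2 hm)) x) := by
  induction x using TensorProduct.induction_on with
  | zero => simp
  | add x y hx hy => simp only [map_add, hx, hy]
  | tmul x y =>
    have e1 := DFunLike.congr_fun (levComul_proj (h := h) (w := w) hm) y
    rw [AlgHom.comp_apply, AlgHom.comp_apply] at e1
    simp only [levIdComul, Algebra.TensorProduct.map_tmul, e1, levelProj_levelProj]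

/-- The map `Δ ⊗ id` of the limit. -/
def limComulId (h w : ℂ) : ((Uhw h w).tensor (Uhw h w)).Lim →ₐ[ℂ]
    ((Uhw h w).tensor ((Uhw h w).tensor (Uhw h w))).Lim :=
  liftAlg (T := (Uhw h w).tensor (Uhw h w)) (T' := (Uhw h w).tensor ((Uhw h w).tensor (Uhw h w)))
    (fun m => 2 * m) (fun m => levComulId h w m) (by
      intro x m
      have := levComulId_proj (Nat.le_succ m) (coord₂ x (2 * (m + 1)))
      rw [map_levelProj_val, ← levMap_eq] at this
      exact this)

/-- The map `id ⊗ Δ` of the limit. -/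
def limIdComul (h w : ℂ) : ((Uhw h w).tensor (Uhw h w)).Lim →ₐ[ℂ]
    ((Uhw h w).tensor ((Uhw h w).tensor (Uhw h w))).Lim :=
  liftAlg (T := (Uhw h w).tensor (Uhw h w)) (T' := (Uhw h w).tensor ((Uhw h w).tensor (Uhw h w)))
    (fun m => 2 * m) (fun m => levIdComul h w m) (by
      intro x m
      have := levIdComul_proj (Nat.le_succ m) (coord₂ x (2 * (m + 1)))
      rw [map_levelProj_val, ← levMap_eq] at this
      exact this)

/-! #### Counit -/

theorem levCounit_proj {m M : ℕ} (hm : m ≤ M) (x : Lev h w (M + 1)) :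
    levCounit h w m (levelProj h w (Nat.succ_le_succ hm) x) = levCounit h w M x := by
  have : (levCounit h w m).comp (levelProj h w (Nat.succ_le_succ hm)) = levCounit h w M :=
    level_hom_ext fun g => by
      rw [AlgHom.comp_apply]; simp
  rw [← this]; rfl

/-- The counit of the limit. -/
def limCounit (h w : ℂ) : (Uhw h w).Lim →ₐ[ℂ] ℂ := (levCounit h w 0).comp ((Uhw h w).valHom 1)

theorem levCounit_val (m : ℕ) (x : (Uhw h w).Lim) :
    levCounit h w m (coord x (m + 1)) = limCounit h w x := by
  rw [← levCounit_proj (Nat.zero_le m), levelProj_val]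
  rfl

/-- The map `ε ⊗ id` of components. -/
def levCounitId (h w : ℂ) (m : ℕ) :
    Lev h w (m + 1) ⊗[ℂ] Lev h w (m + 1) →ₐ[ℂ] Lev h w m :=
  (Algebra.TensorProduct.lid ℂ (Lev h w m)).toAlgHom.comp
    (Algebra.TensorProduct.map (levCounit h w m) (levelProj h w (Nat.le_succ m)))

/-- The map `id ⊗ ε` of components. -/
def levIdCounit (h w : ℂ) (m : ℕ) :
    Lev h w (m + 1) ⊗[ℂ] Lev h w (m + 1) →ₐ[ℂ] Lev h w m :=
  (Algebra.TensorProduct.rid ℂ ℂ (Lev h w m)).toAlgHom.comp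
    (Algebra.TensorProduct.map (levelProj h w (Nat.le_succ m)) (levCounit h w m))

theorem levCounitId_tmul (m : ℕ) (x y : Lev h w (m + 1)) :
    levCounitId h w m (x ⊗ₜ y) = levCounit h w m x • levelProj h w (Nat.le_succ m) y := rfl

theorem levIdCounit_tmul (m : ℕ) (x y : Lev h w (m + 1)) :
    levIdCounit h w m (x ⊗ₜ y) = levCounit h w m y • levelProj h w (Nat.le_succ m) x := rfl

theorem levCounitId_proj {m M : ℕ} (hm : m ≤ M)
    (x : Lev h w (M + 1) ⊗[ℂ] Lev h w (M + 1)) :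
    levelProj h w hm (levCounitId h w M x) =
      levCounitId h w m (Algebra.TensorProduct.map (levelProj h w (Nat.succ_le_succ hm))
        (levelProj h w (Nat.succ_le_succ hm)) x) := by
  induction x using TensorProduct.induction_on with
  | zero => simp
  | add x y hx hy => simp only [map_add, hx, hy]
  | tmul x y =>
    rw [Algebra.TensorProduct.map_tmul, levCounitId_tmul, levCounitId_tmul, levCounit_proj hm,
      map_smul, levelProj_levelProj, levelProj_levelProj]

theorem levIdCounit_proj {m M : ℕ} (hm : m ≤ M)
    (x : Lev h w (M + 1) ⊗[ℂ] Lev h w (M + 1)) :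
    levelProj h w hm (levIdCounit h w M x) =
      levIdCounit h w m (Algebra.TensorProduct.map (levelProj h w (Nat.succ_le_succ hm))
        (levelProj h w (Nat.succ_le_succ hm)) x) := by
  induction x using TensorProduct.induction_on with
  | zero => simp
  | add x y hx hy => simp only [map_add, hx, hy]
  | tmul x y =>
    rw [Algebra.TensorProduct.map_tmul, levIdCounit_tmul, levIdCounit_tmul, levCounit_proj hm,
      map_smul, levelProj_levelProj, levelProj_levelProj]

/-- The map `ε ⊗ id` of the limit. -/
def limCounitId (h w : ℂ) : ((Uhw h w).tensor (Uhw h w)).Lim →ₐ[ℂ] (Uhw h w).Lim :=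
  liftAlg (T := (Uhw h w).tensor (Uhw h w)) (T' := Uhw h w)
    (fun m => m + 1) (fun m => levCounitId h w m) (by
      intro x m
      have := levCounitId_proj (Nat.le_succ m) (coord₂ x (m + 1 + 1))
      rw [map_levelProj_val, ← levMap_eq] at this
      exact this)

/-- The map `id ⊗ ε` of the limit. -/
def limIdCounit (h w : ℂ) : ((Uhw h w).tensor (Uhw h w)).Lim →ₐ[ℂ] (Uhw h w).Lim :=
  liftAlg (T := (Uhw h w).tensor (Uhw h w)) (T' := Uhw h w)
    (fun m => m + 1) (fun m => levIdCounit h w m) (by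
      intro x m
      have := levIdCounit_proj (Nat.le_succ m) (coord₂ x (m + 1 + 1))
      rw [map_levelProj_val, ← levMap_eq] at this
      exact this)

/-! #### Antipode -/

/-- The antipode of the components, as a linear map. -/
def levS (h w : ℂ) (m : ℕ) : Lev h w m →ₗ[ℂ] Lev h w m :=
  (MulOpposite.opLinearEquiv ℂ).symm.toLinearMap ∘ₗ (levAnti h w m).toLinearMap

theorem levS_lgen (m : ℕ) (g : Gen) :
    levS h w m (lgen h w m g) = anti h w (lgen h w m) g :=
  congrArg MulOpposite.unop (levAnti_lgen g)

theorem levS_one (m : ℕ) : levS h w m 1 = 1 :=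
  congrArg MulOpposite.unop (map_one (levAnti h w m))

theorem levS_mul (m : ℕ) (x y : Lev h w m) : levS h w m (x * y) = levS h w m y * levS h w m x :=
  congrArg MulOpposite.unop (map_mul (levAnti h w m) x y)

theorem map_anti {B C : Type*} [Ring B] [Algebra ℂ B] [Ring C] [Algebra ℂ C] (f : B →ₐ[ℂ] C)
    {a : Gen → B} (ha : OscRel h w a) (g : Gen) :
    f (anti h w a g) = anti h w (fun g => f (a g)) g := by
  cases g <;> simp [anti, map_eP f ha, map_nsinh f h ha.nilE]

theorem levS_proj {m M : ℕ} (hm : m ≤ M) (x : Lev h w M) :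
    levelProj h w hm (levS h w M x) = levS h w m (levelProj h w hm x) := by
  induction x using level_induction with
  | hg g =>
    rw [levelProj_lgen, levS_lgen, levS_lgen, map_anti _ (oscRel_lgen h w M)]
    congr 1
    funext g
    simp
  | hc c =>
    rw [AlgHom.commutes, Algebra.algebraMap_eq_smul_one, Algebra.algebraMap_eq_smul_one, map_smul,
      map_smul, map_smul, levS_one, levS_one, map_one]
  | hadd x y hx hy => rw [map_add, map_add, map_add, map_add, hx, hy]
  | hmul x y hx hy => rw [levS_mul, map_mul, map_mul, levS_mul, hx, hy]

/-- The antipode of the limit. -/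
def limS (h w : ℂ) : (Uhw h w).Lim →ₗ[ℂ] (Uhw h w).Lim :=
  liftLin (T := Uhw h w) (T' := Uhw h w) (fun m => m) (fun m => levS h w m) (by
    intro x m
    have := levS_proj (Nat.le_succ m) (coord x (m + 1))
    rw [levelProj_val, ← levMap_eq] at this
    exact this)

/-- The map `m (S ⊗ id)` of components. -/
def levMulSId (h w : ℂ) (m : ℕ) : Lev h w m ⊗[ℂ] Lev h w m →ₗ[ℂ] Lev h w m :=
  (tsand (levS h w m) LinearMap.id).flip 1

/-- The map `m (id ⊗ S)` of components. -/
def levMulIdS (h w : ℂ) (m : ℕ) : Lev h w m ⊗[ℂ] Lev h w m →ₗ[ℂ] Lev h w m :=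
  (tsand LinearMap.id (levS h w m)).flip 1

theorem levMulSId_tmul (m : ℕ) (x y : Lev h w m) :
    levMulSId h w m (x ⊗ₜ y) = levS h w m x * y := by
  show levS h w m x * (1 * y) = _
  rw [one_mul]

theorem levMulIdS_tmul (m : ℕ) (x y : Lev h w m) :
    levMulIdS h w m (x ⊗ₜ y) = x * levS h w m y := by
  show x * (1 * levS h w m y) = _
  rw [one_mul]

theorem levMulSId_proj {m M : ℕ} (hm : m ≤ M) (x : Lev h w M ⊗[ℂ] Lev h w M) :
    levelProj h w hm (levMulSId h w M x) =
      levMulSId h w m (Algebra.TensorProduct.map (levelProj h w hm) (levelProj h w hm) x) := by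
  induction x using TensorProduct.induction_on with
  | zero => simp
  | add x y hx hy => simp only [map_add, hx, hy]
  | tmul x y =>
    rw [Algebra.TensorProduct.map_tmul, levMulSId_tmul, levMulSId_tmul, map_mul, levS_proj]

theorem levMulIdS_proj {m M : ℕ} (hm : m ≤ M) (x : Lev h w M ⊗[ℂ] Lev h w M) :
    levelProj h w hm (levMulIdS h w M x) =
      levMulIdS h w m (Algebra.TensorProduct.map (levelProj h w hm) (levelProj h w hm) x) := by
  induction x using TensorProduct.induction_on with
  | zero => simp
  | add x y hx hy => simp only [map_add, hx, hy]
  | tmul x y =>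
    rw [Algebra.TensorProduct.map_tmul, levMulIdS_tmul, levMulIdS_tmul, map_mul, levS_proj]

/-- The map `m (S ⊗ id)` of the limit. -/
def limMulSId (h w : ℂ) : ((Uhw h w).tensor (Uhw h w)).Lim →ₗ[ℂ] (Uhw h w).Lim :=
  liftLin (T := (Uhw h w).tensor (Uhw h w)) (T' := Uhw h w) (fun m => m)
    (fun m => levMulSId h w m) (by
      intro x m
      have := levMulSId_proj (Nat.le_succ m) (coord₂ x (m + 1))
      rw [map_levelProj_val, ← levMap_eq] at this
      exact this)

/-- The map `m (id ⊗ S)` of the limit. -/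
def limMulIdS (h w : ℂ) : ((Uhw h w).tensor (Uhw h w)).Lim →ₗ[ℂ] (Uhw h w).Lim :=
  liftLin (T := (Uhw h w).tensor (Uhw h w)) (T' := Uhw h w) (fun m => m)
    (fun m => levMulIdS h w m) (by
      intro x m
      have := levMulIdS_proj (Nat.le_succ m) (coord₂ x (m + 1))
      rw [map_levelProj_val, ← levMap_eq] at this
      exact this)

end HopfStructure

/-! ### The Hopf algebra axioms -/

section HopfAxioms

open Tower

variable {h w : ℂ}

/-- The generators in the first of three factors. -/
def tri1 (h w : ℂ) (m : ℕ) (g : Gen) : Lev h w m ⊗[ℂ] (Lev h w m ⊗[ℂ] Lev h w m) :=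
  lgen h w m g ⊗ₜ 1

/-- The generators in the second of three factors. -/
def tri2 (h w : ℂ) (m : ℕ) (g : Gen) : Lev h w m ⊗[ℂ] (Lev h w m ⊗[ℂ] Lev h w m) :=
  1 ⊗ₜ leg1 h w m g

/-- The generators in the last of three factors. -/
def tri3 (h w : ℂ) (m : ℕ) (g : Gen) : Lev h w m ⊗[ℂ] (Lev h w m ⊗[ℂ] Lev h w m) :=
  1 ⊗ₜ leg2 h w m g

theorem oscRel_tri1 (m : ℕ) : OscRel h w (tri1 h w m) := (oscRel_lgen h w m).tmul_one

theorem oscRel_tri2 (m : ℕ) : OscRel h w (tri2 h w m) := (oscRel_leg1 h w m).one_tmul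

theorem oscRel_tri3 (m : ℕ) : OscRel h w (tri3 h w m) := (oscRel_leg2 h w m).one_tmul

theorem legs_tri1_tri2 (m : ℕ) : Legs (tri1 h w m) (tri2 h w m) := fun g g' => by
  simp [tri1, tri2, Commute, SemiconjBy]

theorem legs_tri1_tri3 (m : ℕ) : Legs (tri1 h w m) (tri3 h w m) := fun g g' => by
  simp [tri1, tri3, Commute, SemiconjBy]

theorem legs_tri2_tri3 (m : ℕ) : Legs (tri2 h w m) (tri3 h w m) := fun g g' => by
  simp [tri2, tri3, leg1, leg2, Commute, SemiconjBy]

theorem levComulId_leg1 (m : ℕ) : (fun g => levComulId h w m (leg1 h w (2 * m) g)) =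
    cop h w (tri1 h w m) (tri2 h w m) := by
  funext g
  let f : Lev h w m ⊗[ℂ] Lev h w m →ₐ[ℂ] Lev h w m ⊗[ℂ] (Lev h w m ⊗[ℂ] Lev h w m) :=
    (Algebra.TensorProduct.assoc ℂ ℂ ℂ (Lev h w m) (Lev h w m) (Lev h w m)).toAlgHom.comp
      Algebra.TensorProduct.includeLeft
  have e1 := map_cop f (oscRel_leg1 h w m) (oscRel_leg2 h w m) g
  have e2 : (fun g => f (leg1 h w m g)) = tri1 h w m := by
    funext g; simp [f, leg1, tri1, Algebra.TensorProduct.one_def]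
  have e3 : (fun g => f (leg2 h w m g)) = tri2 h w m := by
    funext g; simp [f, leg1, leg2, tri2, Algebra.TensorProduct.one_def]
  rw [e2, e3] at e1
  rw [← e1, leg1, levComulId_tmul, levComul_lgen, map_one]
  rfl

theorem levComulId_leg2 (m : ℕ) : (fun g => levComulId h w m (leg2 h w (2 * m) g)) =
    tri3 h w m := by
  funext g
  rw [leg2, levComulId_tmul, levelProj_lgen, map_one, Algebra.TensorProduct.one_def]
  simp [tri3, leg2]

theorem levIdComul_leg1 (m : ℕ) : (fun g => levIdComul h w m (leg1 h w (2 * m) g)) =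
    tri1 h w m := by
  funext g
  simp [levIdComul, leg1, tri1]

theorem levIdComul_leg2 (m : ℕ) : (fun g => levIdComul h w m (leg2 h w (2 * m) g)) =
    cop h w (tri2 h w m) (tri3 h w m) := by
  funext g
  have e1 := map_cop (Algebra.TensorProduct.includeRight :
      Lev h w m ⊗[ℂ] Lev h w m →ₐ[ℂ] Lev h w m ⊗[ℂ] (Lev h w m ⊗[ℂ] Lev h w m))
    (oscRel_leg1 h w m) (oscRel_leg2 h w m) g
  simp only [levIdComul, leg2, Algebra.TensorProduct.map_tmul, levComul_lgen, map_one]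
  exact e1

theorem levComulId_levComul (m : ℕ) (x : Lev h w (2 * (2 * m))) :
    levComulId h w m (levComul h w (2 * m) x) = levIdComul h w m (levComul h w (2 * m) x) := by
  have key : (levComulId h w m).comp (levComul h w (2 * m)) =
      (levIdComul h w m).comp (levComul h w (2 * m)) := by
    refine level_hom_ext fun g => ?_
    rw [AlgHom.comp_apply, AlgHom.comp_apply, levComul_lgen,
      map_cop _ (oscRel_leg1 h w (2 * m)) (oscRel_leg2 h w (2 * m)),
      map_cop _ (oscRel_leg1 h w (2 * m)) (oscRel_leg2 h w (2 * m)),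
      levComulId_leg1, levComulId_leg2, levIdComul_leg1, levIdComul_leg2]
    exact cop_cop (legs_tri1_tri2 m) (legs_tri2_tri3 m) (oscRel_tri1 m) (oscRel_tri2 m)
      (oscRel_tri3 m) g
  exact DFunLike.congr_fun key x

theorem levCounitId_levComul (m : ℕ) (x : Lev h w (2 * (m + 1))) :
    levCounitId h w m (levComul h w (m + 1) x) = levelProj h w (by omega) x := by
  have key : (levCounitId h w m).comp (levComul h w (m + 1)) =
      levelProj h w (show m ≤ 2 * (m + 1) by omega) := by
    refine level_hom_ext fun g => ?_
    have e1 : (fun g => levCounitId h w m (leg1 h w (m + 1) g)) = fun _ => 0 := by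
      funext g; rw [leg1, levCounitId_tmul, levCounit_lgen, zero_smul]
    have e2 : (fun g => levCounitId h w m (leg2 h w (m + 1) g)) = lgen h w m := by
      funext g; rw [leg2, levCounitId_tmul, map_one, one_smul, levelProj_lgen]
    rw [AlgHom.comp_apply, levComul_lgen,
      map_cop _ (oscRel_leg1 h w (m + 1)) (oscRel_leg2 h w (m + 1)), e1, e2, cop_zero_left,
      levelProj_lgen]
  exact DFunLike.congr_fun key x

theorem levIdCounit_levComul (m : ℕ) (x : Lev h w (2 * (m + 1))) :
    levIdCounit h w m (levComul h w (m + 1) x) = levelProj h w (by omega) x := by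
  have key : (levIdCounit h w m).comp (levComul h w (m + 1)) =
      levelProj h w (show m ≤ 2 * (m + 1) by omega) := by
    refine level_hom_ext fun g => ?_
    have e1 : (fun g => levIdCounit h w m (leg2 h w (m + 1) g)) = fun _ => 0 := by
      funext g; rw [leg2, levIdCounit_tmul, levCounit_lgen, zero_smul]
    have e2 : (fun g => levIdCounit h w m (leg1 h w (m + 1) g)) = lgen h w m := by
      funext g; rw [leg1, levIdCounit_tmul, map_one, one_smul, levelProj_lgen]
    rw [AlgHom.comp_apply, levComul_lgen,
      map_cop _ (oscRel_leg1 h w (m + 1)) (oscRel_leg2 h w (m + 1)), e1, e2, cop_zero_right,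
      levelProj_lgen]
  exact DFunLike.congr_fun key x

theorem levMulSId_levComul (m : ℕ) (ε : Lev h w (2 * m) →ₐ[ℂ] ℂ)
    (hε : ∀ g, ε (lgen h w (2 * m) g) = 0) (x : Lev h w (2 * m)) :
    levMulSId h w m (levComul h w m x) = algebraMap ℂ _ (ε x) := by
  show tsand (levS h w m) LinearMap.id (levComul h w m x) 1 = _
  induction x using level_induction with
  | hg g =>
    rw [levComul_lgen, hε, map_zero]
    exact tsand_cop_left (oscRel_lgen h w m) (levS_one m) (levS_mul m) (levS_lgen m) g
  | hc c =>
    rw [AlgHom.commutes, AlgHom.commutes, Algebra.algebraMap_eq_smul_one,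
      Algebra.TensorProduct.one_def, map_smul, LinearMap.smul_apply, tsand_tmul, levS_one]
    simp [Algebra.algebraMap_eq_smul_one]
  | hadd x y hx hy => simp only [map_add, LinearMap.add_apply, hx, hy]
  | hmul x y hx hy =>
    rw [map_mul, tsand_mul_right (levS_mul m) (fun _ _ => rfl), hx,
      Algebra.algebraMap_eq_smul_one, map_smul, hy, map_mul, map_mul,
      Algebra.algebraMap_eq_smul_one (ε x), smul_one_mul]

theorem levMulIdS_levComul (m : ℕ) (ε : Lev h w (2 * m) →ₐ[ℂ] ℂ)
    (hε : ∀ g, ε (lgen h w (2 * m) g) = 0) (x : Lev h w (2 * m)) :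
    levMulIdS h w m (levComul h w m x) = algebraMap ℂ _ (ε x) := by
  show tsand LinearMap.id (levS h w m) (levComul h w m x) 1 = _
  induction x using level_induction with
  | hg g =>
    rw [levComul_lgen, hε, map_zero]
    exact tsand_cop_right (oscRel_lgen h w m) (levS_one m) (levS_mul m) (levS_lgen m) g
  | hc c =>
    rw [AlgHom.commutes, AlgHom.commutes, Algebra.algebraMap_eq_smul_one,
      Algebra.TensorProduct.one_def, map_smul, LinearMap.smul_apply, tsand_tmul, levS_one]
    simp [Algebra.algebraMap_eq_smul_one]
  | hadd x y hx hy => simp only [map_add, LinearMap.add_apply, hx, hy]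
  | hmul x y hx hy =>
    rw [map_mul, tsand_mul_left (fun _ _ => rfl) (levS_mul m), hy,
      Algebra.algebraMap_eq_smul_one, map_smul, hx, map_mul, map_mul,
      Algebra.algebraMap_eq_smul_one (ε y), mul_smul_comm, mul_one]

instance : Subsingleton (Lev h w 0) := subsingleton_level_zero

theorem limMulSId_limComul (a : (Uhw h w).Lim) :
    limMulSId h w (limComul h w a) = algebraMap ℂ (Uhw h w).Lim (limCounit h w a) := by
  refine lim_ext fun m => ?_
  show levMulSId h w m (levComul h w m (coord a (2 * m))) =
    algebraMap ℂ (Lev h w m) (limCounit h w a)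
  cases m with
  | zero => exact Subsingleton.elim _ _
  | succ k =>
    rw [levMulSId_levComul (k + 1) (levCounit h w (2 * k + 1)) levCounit_lgen,
      ← levCounit_val (2 * k + 1)]
    rfl

theorem limMulIdS_limComul (a : (Uhw h w).Lim) :
    limMulIdS h w (limComul h w a) = algebraMap ℂ (Uhw h w).Lim (limCounit h w a) := by
  refine lim_ext fun m => ?_
  show levMulIdS h w m (levComul h w m (coord a (2 * m))) =
    algebraMap ℂ (Lev h w m) (limCounit h w a)
  cases m with
  | zero => exact Subsingleton.elim _ _
  | succ k =>
    rw [levMulIdS_levComul (k + 1) (levCounit h w (2 * k + 1)) levCounit_lgen,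
      ← levCounit_val (2 * k + 1)]
    rfl

/-- The complete Hopf algebra `U_{h,w}(H(4))`. -/
def uhwHopf (h w : ℂ) : CompleteHopf (Uhw h w) where
  comul := limComul h w
  counit := limCounit h w
  antipode := limS h w
  continuous_comul := continuous_liftAlg ..
  continuous_counit := continuous_of_val (T := Uhw h w) 1 fun y => levCounit h w 0 y
  continuous_antipode := continuous_liftLin ..
  antipode_one := lim_ext fun m => levS_one m
  antipode_mul a b := lim_ext fun m => levS_mul m (coord a m) (coord b m)
  comulId := limComulId h w
  continuous_comulId := continuous_liftAlg ..
  comulId_tmul a b := lim_ext fun m =>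
    (levComulId_tmul m (coord a (2 * m)) (coord b (2 * m))).trans (by
      rw [levelProj_val]; rfl)
  idComul := limIdComul h w
  continuous_idComul := continuous_liftAlg ..
  idComul_tmul a b := lim_ext fun m => by
    have : levIdComul h w m (coord a (2 * m) ⊗ₜ coord b (2 * m)) =
        coord a m ⊗ₜ levComul h w m (coord b (2 * m)) := by
      rw [levIdComul, Algebra.TensorProduct.map_tmul, levelProj_val]
    exact this
  counitId := limCounitId h w
  continuous_counitId := continuous_liftAlg ..
  counitId_tmul a b := lim_ext fun m =>
    (levCounitId_tmul m (coord a (m + 1)) (coord b (m + 1))).trans (by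
      rw [levelProj_val, levCounit_val]; rfl)
  idCounit := limIdCounit h w
  continuous_idCounit := continuous_liftAlg ..
  idCounit_tmul a b := lim_ext fun m =>
    (levIdCounit_tmul m (coord a (m + 1)) (coord b (m + 1))).trans (by
      rw [levelProj_val, levCounit_val]; rfl)
  mulAntipodeId := limMulSId h w
  continuous_mulAntipodeId := continuous_liftLin ..
  mulAntipodeId_tmul a b := lim_ext fun m => levMulSId_tmul m (coord a m) (coord b m)
  mulIdAntipode := limMulIdS h w
  continuous_mulIdAntipode := continuous_liftLin ..
  mulIdAntipode_tmul a b := lim_ext fun m => levMulIdS_tmul m (coord a m) (coord b m)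
  coassoc a := lim_ext fun m => levComulId_levComul m (coord a (2 * (2 * m)))
  counitId_comul a := lim_ext fun m =>
    (levCounitId_levComul m (coord a (2 * (m + 1)))).trans (levelProj_val _ a)
  idCounit_comul a := lim_ext fun m =>
    (levIdCounit_levComul m (coord a (2 * (m + 1)))).trans (levelProj_val _ a)
  mulAntipodeId_comul := limMulSId_limComul
  mulIdAntipode_comul := limMulIdS_limComul

end HopfAxioms

/-! ### The structures on the limit -/

section Structures

open Tower

variable {h w : ℂ}

/-! #### Series in the generators -/

theorem lim_ext_coord {x y : (Uhw h w).Lim} (hxy : ∀ m, coord x m = coord y m) : x = y :=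
  lim_ext hxy

theorem lim_ext_coord₂ {x y : ((Uhw h w).tensor (Uhw h w)).Lim}
    (hxy : ∀ m, coord₂ x m = coord₂ y m) : x = y :=
  lim_ext hxy

@[simp] theorem coord_gen (g : Gen) (m : ℕ) : coord (gen h w g) m = lgen h w m g := rfl

@[simp] theorem coord_mul (x y : (Uhw h w).Lim) (m : ℕ) :
    coord (x * y) m = coord x m * coord y m := rfl

@[simp] theorem coord_add (x y : (Uhw h w).Lim) (m : ℕ) :
    coord (x + y) m = coord x m + coord y m := rfl

@[simp] theorem coord_sub (x y : (Uhw h w).Lim) (m : ℕ) :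
    coord (x - y) m = coord x m - coord y m := rfl

@[simp] theorem coord_neg (x : (Uhw h w).Lim) (m : ℕ) : coord (-x) m = -coord x m := rfl

@[simp] theorem coord_smul (c : ℂ) (x : (Uhw h w).Lim) (m : ℕ) :
    coord (c • x) m = c • coord x m := rfl

@[simp] theorem coord_one (m : ℕ) : coord (1 : (Uhw h w).Lim) m = 1 := rfl

@[simp] theorem coord_zero (m : ℕ) : coord (0 : (Uhw h w).Lim) m = 0 := rfl

@[simp] theorem coord_pow (x : (Uhw h w).Lim) (k m : ℕ) :
    coord (x ^ k) m = coord x m ^ k := rfl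

@[simp] theorem coord₂_mul (x y : ((Uhw h w).tensor (Uhw h w)).Lim) (m : ℕ) :
    coord₂ (x * y) m = coord₂ x m * coord₂ y m := rfl

@[simp] theorem coord₂_add (x y : ((Uhw h w).tensor (Uhw h w)).Lim) (m : ℕ) :
    coord₂ (x + y) m = coord₂ x m + coord₂ y m := rfl

@[simp] theorem coord₂_neg (x : ((Uhw h w).tensor (Uhw h w)).Lim) (m : ℕ) :
    coord₂ (-x) m = -coord₂ x m := rfl

@[simp] theorem coord₂_smul (c : ℂ) (x : ((Uhw h w).tensor (Uhw h w)).Lim) (m : ℕ) :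
    coord₂ (c • x) m = c • coord₂ x m := rfl

@[simp] theorem coord₂_tmul (x y : (Uhw h w).Lim) (m : ℕ) :
    coord₂ (tmul x y) m = coord x m ⊗ₜ coord y m := rfl

theorem coord_fexp {x : (Uhw h w).Lim} (hx : ∀ m, IsNilpotent (coord x m)) (m : ℕ) :
    coord (fexp x) m = nexp (coord x m) := fexp_val hx m

theorem coord₂_fexp {x : ((Uhw h w).tensor (Uhw h w)).Lim}
    (hx : ∀ m, IsNilpotent (coord₂ x m)) (m : ℕ) :
    coord₂ (fexp x) m = nexp (coord₂ x m) := fexp_val hx m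

theorem coord_fexp_smulE (c : ℂ) (m : ℕ) :
    coord (fexp (c • gen h w .E)) m = eE c (lgen h w m) :=
  coord_fexp (x := c • gen h w .E) (fun m => (oscRel_lgen h w m).nil_smulE c) m

theorem coord_fexp_neg_smulE (c : ℂ) (m : ℕ) :
    coord (fexp (-(c • gen h w .E))) m = eE (-c) (lgen h w m) := by
  refine (coord_fexp (x := -(c • gen h w .E))
    (fun m => ((oscRel_lgen h w m).nil_smulE c).neg) m).trans ?_
  show nexp (-(c • lgen h w m .E)) = _
  rw [eE, neg_smul]

theorem coord_fexp_smulP (c : ℂ) (m : ℕ) :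
    coord (fexp (c • gen h w .Ap)) m = eP c (lgen h w m) :=
  coord_fexp (x := c • gen h w .Ap) (fun m => (oscRel_lgen h w m).nil_smulP c) m

theorem coord_fexp_neg_smulP (c : ℂ) (m : ℕ) :
    coord (fexp (-(c • gen h w .Ap))) m = eP (-c) (lgen h w m) := by
  refine (coord_fexp (x := -(c • gen h w .Ap))
    (fun m => ((oscRel_lgen h w m).nil_smulP c).neg) m).trans ?_
  show nexp (-(c • lgen h w m .Ap)) = _
  rw [eP, neg_smul]

theorem coord_sinhDiv (m : ℕ) :
    coord (sinhDiv h (gen h w .E)) m = nsinh h (lgen h w m .E) :=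
  sinhDiv_val h (x := gen h w .E) (fun m => (oscRel_lgen h w m).nilE) m

theorem coord_expSubOneDiv (c : ℂ) (m : ℕ) :
    coord (expSubOneDiv c (gen h w .Ap)) m = nesd c (lgen h w m .Ap) :=
  expSubOneDiv_val c (x := gen h w .Ap) (fun m => (oscRel_lgen h w m).nilP) m

theorem coord_oneSubExpNegDiv (m : ℕ) :
    coord (oneSubExpNegDiv w (gen h w .Ap)) m = xP w (lgen h w m) := coord_expSubOneDiv (-w) m

theorem relations_gen (h w : ℂ) : Relations h w (gen h w) where
  comm_A_Ap := lim_ext_coord fun m => by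
    simp only [coord_sub, coord_mul, coord_gen, coord_sinhDiv, coord_fexp_smulP]
    exact (oscRel_lgen h w m).comm_A_Ap
  comm_N_Ap := lim_ext_coord fun m => by
    simp only [coord_sub, coord_mul, coord_gen, coord_expSubOneDiv]
    exact (oscRel_lgen h w m).comm_N_Ap
  comm_N_A := lim_ext_coord fun m => by
    simp only [coord_sub, coord_mul, coord_gen, coord_neg]
    exact (oscRel_lgen h w m).comm_N_A
  comm_E g := lim_ext_coord fun m => by
    simp only [coord_mul, coord_gen]
    exact (oscRel_lgen h w m).comm_E g

theorem coord₂_comul (x : (Uhw h w).Lim) (m : ℕ) :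
    coord₂ ((uhwHopf h w).comul x) m = levComul h w m (coord x (2 * m)) := rfl

theorem coord_antipode (x : (Uhw h w).Lim) (m : ℕ) :
    coord ((uhwHopf h w).antipode x) m = levS h w m (coord x m) := rfl

theorem isUhwHopf (h w : ℂ) : IsUhwHopf h w (uhwHopf h w) where
  comul_N := lim_ext_coord₂ fun m => by
    simp only [coord₂_comul, coord_gen, levComul_lgen, coord₂_add, coord₂_tmul, coord_fexp_smulP,
      coord_one]
    exact cop_N_tmul (oscRel_lgen h w m)
  comul_E := lim_ext_coord₂ fun m => by
    simp only [coord₂_comul, coord_gen, levComul_lgen, coord₂_add, coord₂_tmul, coord_one]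
    rfl
  comul_Ap := lim_ext_coord₂ fun m => by
    simp only [coord₂_comul, coord_gen, levComul_lgen, coord₂_add, coord₂_tmul, coord_one]
    rfl
  comul_A := lim_ext_coord₂ fun m => by
    simp only [coord₂_comul, coord_gen, levComul_lgen, coord₂_add, coord₂_smul, coord₂_tmul,
      coord_mul, coord_fexp_smulP, coord_fexp_smulE, coord_fexp_neg_smulE, coord_sinhDiv]
    exact cop_A_tmul (oscRel_lgen h w m)
  counit_gen g := levCounit_lgen g
  antipode_N := lim_ext_coord fun m => by
    simp only [coord_antipode, coord_gen, levS_lgen, coord_neg, coord_mul, coord_fexp_neg_smulP]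
    rfl
  antipode_E := lim_ext_coord fun m => by
    simp only [coord_antipode, coord_gen, levS_lgen, coord_neg]
    rfl
  antipode_Ap := lim_ext_coord fun m => by
    simp only [coord_antipode, coord_gen, levS_lgen, coord_neg]
    rfl
  antipode_A := lim_ext_coord fun m => by
    simp only [coord_antipode, coord_gen, levS_lgen, coord_neg, coord_add, coord_smul, coord_mul,
      coord_fexp_neg_smulP, coord_sinhDiv]
    rfl

/-! #### The universal R-matrix -/

theorem ringInverse_eq {B : Type*} [Ring B] {x y : B} (hxy : x * y = 1) (hyx : y * x = 1) :
    Ring.inverse x = y :=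
  Ring.inverse_unit ⟨x, y, hxy, hyx⟩

theorem coord₂_twist (m : ℕ) :
    coord₂ (twist h w) m = tw w (leg1 h w m) (leg2 h w m) := by
  have e (m : ℕ) : coord₂ (w • tmul (gen h w .N) (gen h w .Ap)) m =
      w • (leg1 h w m .N * leg2 h w m .Ap) := by simp [leg1, leg2]
  rw [twist, coord₂_fexp, e, tw]
  intro m
  rw [e]
  exact nil_N_P legs_leg1_leg2 (oscRel_leg2 h w m) w

/-- The flip of the factors. -/
def levFlip (h w : ℂ) (m : ℕ) : Lev h w m ⊗[ℂ] Lev h w m →ₐ[ℂ] Lev h w m ⊗[ℂ] Lev h w m :=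
  (Algebra.TensorProduct.comm ℂ (Lev h w m) (Lev h w m)).toAlgHom

theorem coord₂_flip (x : ((Uhw h w).tensor (Uhw h w)).Lim) (m : ℕ) :
    coord₂ ((Uhw h w).flip x) m = levFlip h w m (coord₂ x m) := rfl

theorem levFlip_leg1 (m : ℕ) : (fun g => levFlip h w m (leg1 h w m g)) = leg2 h w m := rfl

theorem levFlip_leg2 (m : ℕ) : (fun g => levFlip h w m (leg2 h w m g)) = leg1 h w m := rfl

theorem coord₂_flip_twist (m : ℕ) :
    coord₂ ((Uhw h w).flip (twist h w)) m = tw w (leg2 h w m) (leg1 h w m) := by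
  rw [coord₂_flip, coord₂_twist, tw, map_nexp _ (nil_N_P legs_leg1_leg2 (oscRel_leg2 h w m) w),
    map_smul, map_mul, tw]
  rfl

theorem coord₂_Rhw (m : ℕ) : coord₂ (Rhw h w) m = rt h w (leg1 h w m) (leg2 h w m) := by
  have u1 (m : ℕ) := tw_mul_twInv (w := w) legs_leg1_leg2.symm (oscRel_leg1 h w m)
  have u2 (m : ℕ) := twInv_mul_tw (w := w) legs_leg1_leg2.symm (oscRel_leg1 h w m)
  have uF : IsUnit ((Uhw h w).flip (twist h w)) := by
    refine isUnit_lim fun m => ?_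
    show IsUnit (coord₂ ((Uhw h w).flip (twist h w)) m)
    rw [coord₂_flip_twist]
    exact ⟨⟨_, _, u1 m, u2 m⟩, rfl⟩
  have e1 : coord₂ (Ring.inverse ((Uhw h w).flip (twist h w))) m =
      twInv w (leg2 h w m) (leg1 h w m) := by
    have := ringInverse_val uF m
    refine this.trans ?_
    show Ring.inverse (coord₂ ((Uhw h w).flip (twist h w)) m) = _
    rw [coord₂_flip_twist]
    exact ringInverse_eq (u1 m) (u2 m)
  have e2 : coord₂ (Rh h w) m = rh h w (leg1 h w m) (leg2 h w m) := by
    have k1 (m : ℕ) : coord₂ (-((2 * h) • tmul (gen h w .E) (gen h w .N))) m =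
        -((2 * h) • (leg1 h w m .E * leg2 h w m .N)) := by simp [leg1, leg2]
    have k2 (m : ℕ) : coord₂ ((2 * h) • tmul (fexp (h • gen h w .E) * gen h w .A)
        (oneSubExpNegDiv w (gen h w .Ap))) m =
        (2 * h) • (eE h (leg1 h w m) * leg1 h w m .A * xP w (leg2 h w m)) := by
      have k3 := eE_tmul_one (oscRel_lgen h w m) h
      have k4 : xP w (leg2 h w m) = 1 ⊗ₜ xP w (lgen h w m) :=
        (map_xP (Algebra.TensorProduct.includeRight :
          Lev h w m →ₐ[ℂ] Lev h w m ⊗[ℂ] Lev h w m) (oscRel_lgen h w m)).symm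
      have k5 : eE h (leg1 h w m) = eE h (lgen h w m) ⊗ₜ 1 := k3
      rw [coord₂_smul, coord₂_tmul, coord_mul, coord_fexp_smulE, coord_oneSubExpNegDiv, k4, k5]
      simp [leg1]
    rw [Rh, coord₂_mul, coord₂_fexp, coord₂_fexp, k1, k2, rh]
    · intro m
      rw [k2]
      exact nil_A_x (oscRel_leg2 h w m) _ _
        (by simp (maxDischargeDepth := 9) [legs_leg1_leg2 _ _])
    · intro m
      rw [k1]
      exact (nil_E_N legs_leg1_leg2 (oscRel_leg1 h w m) _).neg
  rw [Rhw, coord₂_mul, coord₂_mul, e1, e2, coord₂_twist, rt]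

end Structures

/-! ### The quasitriangular and ribbon structures -/

section RibbonStructure

open Tower

variable {h w : ℂ}

theorem isUnit_rt {B : Type*} [Ring B] [Algebra ℂ B] {i j : Gen → B} (hij : Legs i j)
    (hi : OscRel h w i) (hj : OscRel h w j) : IsUnit (rt h w i j) := by
  have c1 : Commute (eE h i * i .A) (xP w j) := by simp (maxDischargeDepth := 9) [hij _ _]
  have n1 := nil_A_x hj (2 * h) _ c1
  have n2 := (nil_E_N hij hi (2 * h)).neg
  refine IsUnit.mul (IsUnit.mul ?_ (IsUnit.mul ?_ ?_)) ?_
  · exact ⟨⟨_, _, twInv_mul_tw hij.symm hi, tw_mul_twInv hij.symm hi⟩, rfl⟩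
  · exact ⟨⟨_, _, nexp_mul_neg n2, nexp_neg_mul n2⟩, rfl⟩
  · exact ⟨⟨_, _, nexp_mul_neg n1, nexp_neg_mul n1⟩, rfl⟩
  · exact ⟨⟨_, _, tw_mul_twInv hij hj, twInv_mul_tw hij hj⟩, rfl⟩

theorem isUnit_Rhw (h w : ℂ) : IsUnit (Rhw h w) := by
  refine isUnit_lim fun m => ?_
  show IsUnit (coord₂ (Rhw h w) m)
  rw [coord₂_Rhw]
  exact isUnit_rt legs_leg1_leg2 (oscRel_leg1 h w m) (oscRel_leg2 h w m)

theorem coord₂_flip_Rhw (m : ℕ) :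
    coord₂ ((Uhw h w).flip (Rhw h w)) m = rt h w (leg2 h w m) (leg1 h w m) := by
  rw [coord₂_flip, coord₂_Rhw, map_rt _ (oscRel_leg1 h w m) (oscRel_leg2 h w m) legs_leg1_leg2,
    levFlip_leg1, levFlip_leg2]

/-- `R Δ(x) = σ(Δ(x)) R`. -/
theorem Rhw_mul_comul (x : (Uhw h w).Lim) :
    Rhw h w * (uhwHopf h w).comul x = (Uhw h w).flip ((uhwHopf h w).comul x) * Rhw h w := by
  refine lim_ext_coord₂ fun m => ?_
  rw [coord₂_mul, coord₂_mul, coord₂_flip, coord₂_comul, coord₂_Rhw]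
  refine level_semiconj (f := levComul h w m) (f' := (levFlip h w m).comp (levComul h w m))
    (fun g => ?_) _
  rw [AlgHom.comp_apply, levComul_lgen, map_cop _ (oscRel_leg1 h w m) (oscRel_leg2 h w m),
    levFlip_leg1, levFlip_leg2]
  exact rt_cop legs_leg1_leg2 (oscRel_leg1 h w m) (oscRel_leg2 h w m) g

/-- The inclusion of the first and last factors. -/
def levLeg13 (h w : ℂ) (m : ℕ) : Lev h w m ⊗[ℂ] Lev h w m →ₐ[ℂ]
    Lev h w m ⊗[ℂ] (Lev h w m ⊗[ℂ] Lev h w m) :=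
  Algebra.TensorProduct.map (AlgHom.id ℂ _) Algebra.TensorProduct.includeRight

/-- The inclusion of the first two factors. -/
def levLeg12 (h w : ℂ) (m : ℕ) : Lev h w m ⊗[ℂ] Lev h w m →ₐ[ℂ]
    Lev h w m ⊗[ℂ] (Lev h w m ⊗[ℂ] Lev h w m) :=
  Algebra.TensorProduct.map (AlgHom.id ℂ _) Algebra.TensorProduct.includeLeft

/-- The inclusion of the last two factors. -/
def levLeg23 (h w : ℂ) (m : ℕ) : Lev h w m ⊗[ℂ] Lev h w m →ₐ[ℂ]
    Lev h w m ⊗[ℂ] (Lev h w m ⊗[ℂ] Lev h w m) :=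
  Algebra.TensorProduct.includeRight

theorem levLeg13_rt (m : ℕ) : levLeg13 h w m (rt h w (leg1 h w m) (leg2 h w m)) =
    rt h w (tri1 h w m) (tri3 h w m) := by
  rw [map_rt _ (oscRel_leg1 h w m) (oscRel_leg2 h w m) legs_leg1_leg2]
  congr 1

theorem levLeg12_rt (m : ℕ) : levLeg12 h w m (rt h w (leg1 h w m) (leg2 h w m)) =
    rt h w (tri1 h w m) (tri2 h w m) := by
  rw [map_rt _ (oscRel_leg1 h w m) (oscRel_leg2 h w m) legs_leg1_leg2]
  congr 1

theorem levLeg23_rt (m : ℕ) : levLeg23 h w m (rt h w (leg1 h w m) (leg2 h w m)) =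
    rt h w (tri2 h w m) (tri3 h w m) := by
  rw [map_rt _ (oscRel_leg1 h w m) (oscRel_leg2 h w m) legs_leg1_leg2]
  congr 1

theorem isQuasitriangular (h w : ℂ) : (uhwHopf h w).IsQuasitriangular (Rhw h w) where
  isUnit := isUnit_Rhw h w
  intertwine x := by
    rw [Rhw_mul_comul, mul_assoc, Ring.mul_inverse_cancel _ (isUnit_Rhw h w), mul_one]
  comulId_R := lim_ext fun m => by
    show levComulId h w m (coord₂ (Rhw h w) (2 * m)) =
      levLeg13 h w m (coord₂ (Rhw h w) m) * levLeg23 h w m (coord₂ (Rhw h w) m)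
    rw [coord₂_Rhw, coord₂_Rhw, levLeg13_rt, levLeg23_rt,
      map_rt _ (oscRel_leg1 h w (2 * m)) (oscRel_leg2 h w (2 * m)) legs_leg1_leg2,
      levComulId_leg1, levComulId_leg2]
    exact rt_cop_left (legs_tri1_tri2 m) (legs_tri1_tri3 m) (legs_tri2_tri3 m) (oscRel_tri1 m)
      (oscRel_tri2 m) (oscRel_tri3 m)
  idComul_R := lim_ext fun m => by
    show levIdComul h w m (coord₂ (Rhw h w) (2 * m)) =
      levLeg13 h w m (coord₂ (Rhw h w) m) * levLeg12 h w m (coord₂ (Rhw h w) m)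
    rw [coord₂_Rhw, coord₂_Rhw, levLeg13_rt, levLeg12_rt,
      map_rt _ (oscRel_leg1 h w (2 * m)) (oscRel_leg2 h w (2 * m)) legs_leg1_leg2,
      levIdComul_leg1, levIdComul_leg2]
    exact rt_cop_right (legs_tri1_tri2 m) (legs_tri1_tri3 m) (legs_tri2_tri3 m) (oscRel_tri1 m)
      (oscRel_tri2 m) (oscRel_tri3 m)

/-! #### The ribbon element -/

theorem levMap_lgen (m : ℕ) : (fun g => levMap h w m (lgen h w (m + 1) g)) = lgen h w m :=
  funext fun g => by rw [levMap_eq, levelProj_lgen]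

/-- The ribbon element for `σ = -h`, and its inverse for `σ = h`. -/
def limTheta (h w σ : ℂ) : (Uhw h w).Lim :=
  ⟨fun m => thetaG w σ (lgen h w m), fun m => by
    have := map_thetaG (levMap h w m) (oscRel_lgen h w (m + 1)) σ
    rw [levMap_lgen] at this
    exact this⟩

@[simp] theorem coord_limTheta (σ : ℂ) (m : ℕ) :
    coord (limTheta h w σ) m = thetaG w σ (lgen h w m) := rfl

/-- The sum of the series in the definition of the ribbon element. -/
def limThetaSum (h w σ : ℂ) : (Uhw h w).Lim := fexp (-(σ • gen h w .E)) * limTheta h w σ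

theorem coord_limThetaSum (σ : ℂ) (m : ℕ) : coord (limThetaSum h w σ) m =
    nT w σ (lgen h w m) * nexp (-((2 * σ) • (lgen h w m .E * lgen h w m .N))) := by
  have e := (oscRel_lgen h w m).eE_mul (-σ) σ
  rw [limThetaSum, coord_mul, coord_limTheta, coord_fexp_neg_smulE, thetaG, ← mul_assoc,
    ← mul_assoc, e]
  simp

theorem limTheta_eq (σ : ℂ) :
    limTheta h w σ = fexp (σ • gen h w .E) * limThetaSum h w σ := by
  refine lim_ext_coord fun m => ?_
  rw [coord_mul, coord_fexp_smulE, coord_limThetaSum, coord_limTheta, thetaG, mul_assoc]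

theorem coord_gauss (σ : ℂ) (m : ℕ) :
    coord (fexp (-((2 * σ) • (gen h w .E * gen h w .N)))) m =
      nexp (-((2 * σ) • (lgen h w m .E * lgen h w m .N))) :=
  coord_fexp (x := -((2 * σ) • (gen h w .E * gen h w .N)))
    (fun m => (oscRel_lgen h w m).nil_E_N) m

theorem eE_pow {B : Type*} [Ring B] [Algebra ℂ B] {a : Gen → B} (ha : OscRel h w a) (σ : ℂ)
    (k : ℕ) : eE σ a ^ k = eE (σ * k) a := by
  induction k with
  | zero => simp
  | succ k ih => rw [pow_succ, ih, ha.eE_mul, Nat.cast_succ, mul_add, mul_one]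

theorem hasSum_limTheta (σ : ℂ) : HasSum (fun l : ℕ => ((2 * σ) ^ l / (l ! : ℂ)) •
      (fexp ((σ * l) • gen h w .E) * oneSubExpNegDiv w (gen h w .Ap) ^ l * gen h w .A ^ l *
        fexp (-((2 * σ) • (gen h w .E * gen h w .N))))) (limThetaSum h w σ) := by
  refine hasSum_lim fun m => ?_
  have ha := oscRel_lgen h w m
  obtain ⟨n, hn⟩ := ha.nil_x
  have c1 : Commute (eE σ (lgen h w m)) (xP w (lgen h w m)) := by simp [ha.commE]
  refine ⟨Finset.range n, fun l hl => ?_, ?_⟩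
  · show coord _ m = 0
    rw [coord_smul, coord_mul, coord_mul, coord_mul, coord_pow, coord_oneSubExpNegDiv,
      pow_eq_zero_of_le (by simpa using hl) hn]
    simp
  · show _ = coord (limThetaSum h w σ) m
    rw [coord_limThetaSum, nT, nord_eq_sum (n := n) (by
      rw [smul_pow, c1.mul_pow, hn, mul_zero, smul_zero]), Finset.sum_mul]
    refine Finset.sum_congr rfl fun l _ => ?_
    show coord _ m = _
    rw [coord_smul, coord_mul, coord_mul, coord_mul, coord_pow, coord_pow, coord_oneSubExpNegDiv,
      coord_fexp_smulE, coord_gauss, coord_gen, smul_pow, c1.mul_pow, eE_pow ha]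
    simp only [smul_mul_assoc, smul_smul]
    congr 1
    ring

theorem isTheta_limTheta (h w : ℂ) : IsTheta h w (gen h w) (limTheta h w (-h)) := by
  have e (c : ℂ) (x : (Uhw h w).Lim) : -(c • x) = (-c) • x := (neg_smul c x).symm
  have e2 (x : (Uhw h w).Lim) : - -x = x := neg_neg x
  refine ⟨limThetaSum h w (-h), (hasSum_limTheta (h := h) (w := w) (-h)).congr_fun fun l => ?_, ?_⟩
  · rw [e, neg_mul, mul_neg, ← e (2 * h), e2, neg_pow (2 * h)]
  · rw [e]
    exact limTheta_eq (-h)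

theorem isThetaInv_limTheta (h w : ℂ) : IsThetaInv h w (gen h w) (limTheta h w h) :=
  ⟨limThetaSum h w h, hasSum_limTheta h, limTheta_eq h⟩

theorem limTheta_mul_limTheta_neg (h w : ℂ) : limTheta h w h * limTheta h w (-h) = 1 :=
  lim_ext_coord fun m =>
    (oscRel_lgen h w m).thetaG_mul_neg (eE_smul_sinh (oscRel_lgen h w m))

theorem limTheta_neg_mul_limTheta (h w : ℂ) : limTheta h w (-h) * limTheta h w h = 1 :=
  lim_ext_coord fun m => by
    have := (oscRel_lgen h w m).thetaG_mul_neg (oscRel_lgen h w m).smul_sinh_neg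
    rw [neg_neg] at this
    exact this

theorem limTheta_central (x : (Uhw h w).Lim) : limTheta h w (-h) * x = x * limTheta h w (-h) :=
  lim_ext_coord fun m => level_semiconj (f := AlgHom.id ℂ _) (f' := AlgHom.id ℂ _)
    (fun g => (oscRel_lgen h w m).thetaG_comm (oscRel_lgen h w m).smul_sinh_neg g) (coord x m)

theorem levComul_thetaG (σ : ℂ) (m : ℕ) : levComul h w m (thetaG w σ (lgen h w (2 * m))) =
    thetaG w σ (cop h w (leg1 h w m) (leg2 h w m)) := by
  rw [map_thetaG _ (oscRel_lgen h w (2 * m))]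
  congr 1
  exact funext fun g => levComul_lgen g

theorem levCounit_thetaG (σ : ℂ) (m : ℕ) :
    levCounit h w m (thetaG w σ (lgen h w (m + 1))) = 1 := by
  rw [map_thetaG _ (oscRel_lgen h w (m + 1))]
  simp only [levCounit_lgen]
  exact thetaG_zero σ

theorem coord_uElem (m : ℕ) : coord ((uhwHopf h w).uElem (Rhw h w)) m =
    tsand (levS h w m) LinearMap.id (rt h w (leg2 h w m) (leg1 h w m)) 1 := by
  show levMulSId h w m (coord₂ ((Uhw h w).flip (Rhw h w)) m) = _
  rw [coord₂_flip_Rhw]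
  rfl

/-- `m (S ⊗ id) Δ = ε` for the inverse of the ribbon element. -/
theorem tsand_thetaG_cop (m : ℕ) : tsand (levS h w (m + 1)) LinearMap.id
    (thetaG w h (cop h w (leg1 h w (m + 1)) (leg2 h w (m + 1)))) 1 = 1 := by
  have := levMulSId_levComul (m + 1) (levCounit h w (2 * m + 1)) levCounit_lgen
    (thetaG w h (lgen h w (2 * (m + 1))))
  rw [levComul_thetaG] at this
  refine this.trans ?_
  have e : levCounit h w (2 * m + 1) (thetaG w h (lgen h w (2 * (m + 1)))) = 1 :=
    levCounit_thetaG h (2 * m + 1)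
  rw [e, map_one]

theorem isRibbon (h w : ℂ) : (uhwHopf h w).IsRibbon (Rhw h w) (limTheta h w (-h)) where
  quasitriangular := isQuasitriangular h w
  central := limTheta_central
  sq := lim_ext_coord fun m => by
    rw [coord_pow, coord_mul, coord_antipode, coord_uElem, coord_limTheta]
    cases m with
    | zero => exact Subsingleton.elim _ _
    | succ m =>
      exact (drinfeld_sq (oscRel_lgen h w (m + 1)) (levS_one _) (levS_mul _) (levS_lgen _)
        (fun p h1 h2 h3 h4 x => level_induction h1 h2 h3 h4 x) isUnit_nord_lgen
        (tsand_thetaG_cop m)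
        (isUnit_rt legs_leg1_leg2 (oscRel_leg1 h w _) (oscRel_leg2 h w _))).symm
  antipode_theta := lim_ext_coord fun m =>
    S_thetaG (oscRel_lgen h w m) (levS_one _) (levS_mul _) (levS_lgen _) isUnit_nord_lgen
  comul_theta := by
    have u : IsUnit ((Uhw h w).flip (Rhw h w) * Rhw h w) :=
      ((isUnit_Rhw h w).map (Uhw h w).flip).mul (isUnit_Rhw h w)
    have key : (Uhw h w).flip (Rhw h w) * Rhw h w * (uhwHopf h w).comul (limTheta h w (-h)) =
        tmul (limTheta h w (-h)) (limTheta h w (-h)) := lim_ext_coord₂ fun m => by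
      have ha := oscRel_lgen h w m
      have e1 : thetaG w (-h) (leg1 h w m) = thetaG w (-h) (lgen h w m) ⊗ₜ 1 :=
        thetaG_tmul_one ha (-h)
      have e2 : thetaG w (-h) (leg2 h w m) = 1 ⊗ₜ thetaG w (-h) (lgen h w m) :=
        thetaG_one_tmul ha (-h)
      rw [coord₂_mul, coord₂_mul, coord₂_flip_Rhw, coord₂_Rhw, coord₂_comul, coord_limTheta,
        levComul_thetaG, rt_rt_thetaG_cop legs_leg1_leg2 (oscRel_leg1 h w m) (oscRel_leg2 h w m),
        e1, e2, coord₂_tmul, coord_limTheta]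
      simp
    rw [← key, ← mul_assoc, Ring.inverse_mul_cancel _ u, one_mul]
  counit_theta := levCounit_thetaG (-h) 0

end RibbonStructure

/-! ### The representations, on formal power series -/

section Representation

open PowerSeries

/-- The topology of pointwise convergence of operators is the topology of the convergence of all
coordinates of all images. -/
theorem hasSum_end_iff {f : ℕ → Module.End ℂ (ℕ → ℂ)} {S : Module.End ℂ (ℕ → ℂ)} :
    HasSum f S ↔ ∀ v s, HasSum (fun k => f k v s) (S v s) := by
  let g : Module.End ℂ (ℕ → ℂ) →+ ((ℕ → ℂ) → (ℕ → ℂ)) :=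
    { toFun := fun f => f, map_zero' := rfl, map_add' := fun _ _ => rfl }
  have hg : Topology.IsInducing g := ⟨rfl⟩
  rw [← hg.hasSum_iff f S, Pi.hasSum]
  exact forall_congr' fun v => Pi.hasSum

instance : T2Space (Module.End ℂ (ℕ → ℂ)) :=
  T2Space.of_injective_continuous (f := fun f : Module.End ℂ (ℕ → ℂ) => (f : (ℕ → ℂ) → (ℕ → ℂ)))
    DFunLike.coe_injective continuous_induced_dom

theorem hasSum_smul_end {c : ℕ → ℂ} {z : ℂ} (hc : HasSum c z) (f : Module.End ℂ (ℕ → ℂ)) :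
    HasSum (fun k => c k • f) (z • f) :=
  hasSum_end_iff.mpr fun v s => hc.mul_right (f v s)

/-! #### Scalar and diagonal operators -/

theorem hasSum_exp (z : ℂ) : HasSum (fun k : ℕ => ((k ! : ℂ)⁻¹) * z ^ k) (Complex.exp z) := by
  have := NormedSpace.expSeries_div_hasSum_exp z
  rw [← Complex.exp_eq_exp_ℂ] at this
  simpa only [div_eq_inv_mul] using this

theorem hasSum_sinhRatio (h e : ℂ) :
    HasSum (fun k : ℕ => h ^ (2 * k) / ((2 * k + 1)! : ℂ) * e ^ (2 * k + 1)) (sinhRatio h e) := by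
  rw [sinhRatio]
  split_ifs with hh
  · subst hh
    convert! hasSum_ite_eq 0 e using 2 with k
    rcases k with _ | k <;> simp
  · have := (Complex.hasSum_sinh (h * e)).div_const h
    convert! this using 2 with k
    field_simp
    ring

/-- The operator multiplying the coordinates by given numbers. -/
def diagOp (d : ℕ → ℂ) : Module.End ℂ (ℕ → ℂ) where
  toFun v := fun r => d r * v r
  map_add' u v := by ext r; simp [mul_add]
  map_smul' c v := by ext r; simp [mul_left_comm]

@[simp] theorem diagOp_apply (d v : ℕ → ℂ) (r : ℕ) : diagOp d v r = d r * v r := rfl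

theorem diagOp_mul (d d' : ℕ → ℂ) : diagOp d * diagOp d' = diagOp (d * d') :=
  LinearMap.ext fun _ => funext fun _ => (mul_assoc _ _ _).symm

theorem diagOp_pow (d : ℕ → ℂ) (k : ℕ) : diagOp d ^ k = diagOp (d ^ k) := by
  induction k with
  | zero => exact LinearMap.ext fun v => funext fun r => (one_mul _).symm
  | succ k ih => rw [pow_succ, ih, diagOp_mul, pow_succ]

theorem smul_diagOp (c : ℂ) (d : ℕ → ℂ) : c • diagOp d = diagOp (c • d) :=
  LinearMap.ext fun _ => funext fun _ => (mul_assoc _ _ _).symm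

theorem smul_one_eq_diagOp (c : ℂ) : (c • 1 : Module.End ℂ (ℕ → ℂ)) = diagOp fun _ => c := rfl

theorem hasSum_diagOp {f : ℕ → ℕ → ℂ} {d : ℕ → ℂ} (hf : ∀ r, HasSum (fun k => f k r) (d r)) :
    HasSum (fun k => diagOp (f k)) (diagOp d) :=
  hasSum_end_iff.mpr fun v s => (hf s).mul_right (v s)

theorem fexp_diagOp (d : ℕ → ℂ) : fexp (diagOp d) = diagOp fun r => Complex.exp (d r) := by
  refine HasSum.tsum_eq ?_
  simp only [diagOp_pow, smul_diagOp]
  exact hasSum_diagOp fun r => hasSum_exp (d r)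

theorem sinhDiv_repE (h e : ℂ) : sinhDiv h (repE e) = sinhRatio h e • 1 := by
  refine HasSum.tsum_eq ?_
  simp only [repE, smul_pow, one_pow, smul_smul]
  exact hasSum_smul_end (hasSum_sinhRatio h e) 1

theorem repN_eq (n : ℂ) : repN n = diagOp fun r => (r : ℂ) + n := rfl

/-! #### The coordinates as power series -/

/-- The norm `√(r!)` of the monomial `X ^ r`. -/
def weight (r : ℕ) : ℂ := (Real.sqrt (r ! : ℝ) : ℂ)

theorem weight_ne_zero (r : ℕ) : weight r ≠ 0 := by
  rw [weight, Complex.ofReal_ne_zero]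
  positivity

theorem weight_succ (r : ℕ) : weight (r + 1) = (Real.sqrt ((r : ℝ) + 1) : ℂ) * weight r := by
  rw [weight, weight, Nat.factorial_succ, Nat.cast_mul, Real.sqrt_mul (by positivity)]
  push_cast
  rfl

/-- The space of formal series `∑ r, v r |r⟩`, identified with the formal power series by
`|r⟩ ↦ X ^ r / √(r!)`. -/
def fock : (ℕ → ℂ) ≃ₗ[ℂ] ℂ⟦X⟧ where
  toFun v := PowerSeries.mk fun r => v r / weight r
  map_add' u v := by ext r; simp [add_div]
  map_smul' c v := by ext r; simp [mul_div_assoc]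
  invFun V := fun r => weight r * coeff r V
  left_inv v := by
    funext r
    simp [mul_div_cancel₀ _ (weight_ne_zero r)]
  right_inv V := by
    ext r
    simp [mul_div_cancel_left₀ _ (weight_ne_zero r)]

theorem coeff_fock (v : ℕ → ℂ) (r : ℕ) : coeff r (fock v) = v r / weight r :=
  coeff_mk r fun r => v r / weight r

/-- An operator on power series, in the coordinates. -/
def fockEnd : Module.End ℂ ℂ⟦X⟧ →ₐ[ℂ] Module.End ℂ (ℕ → ℂ) :=
  (fock.symm.conjAlgEquiv ℂ).toAlgHom

theorem fockEnd_apply (f : Module.End ℂ ℂ⟦X⟧) (v : ℕ → ℂ) (s : ℕ) :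
    fockEnd f v s = weight s * coeff s (f (fock v)) := rfl

/-- Multiplication by a power series. -/
def fockMul (p : ℂ⟦X⟧) : Module.End ℂ (ℕ → ℂ) := fockEnd (LinearMap.mulLeft ℂ p)

theorem fockMul_apply (p : ℂ⟦X⟧) (v : ℕ → ℂ) (s : ℕ) :
    fockMul p v s = weight s * coeff s (p * fock v) := rfl

theorem fockMul_pow (p : ℂ⟦X⟧) (k : ℕ) : fockMul p ^ k = fockMul (p ^ k) := by
  rw [fockMul, ← map_pow, LinearMap.pow_mulLeft, fockMul]

theorem smul_fockMul (c : ℂ) (p : ℂ⟦X⟧) : c • fockMul p = fockMul (c • p) := by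
  rw [fockMul, ← map_smul, fockMul]
  congr 1
  ext
  simp

theorem coeff_mul_congr {p q r : ℂ⟦X⟧} {s : ℕ} (hpq : ∀ i ≤ s, coeff i p = coeff i q) :
    coeff s (p * r) = coeff s (q * r) := by
  rw [coeff_mul, coeff_mul]
  refine Finset.sum_congr rfl fun x hx => ?_
  rw [hpq _ (by have := Finset.HasAntidiagonal.mem_antidiagonal.mp hx; omega)]

/-- A series of power series, each coefficient of which is constant from some partial sum on,
gives a convergent series of multiplication operators. -/
theorem hasSum_fockMul {f : ℕ → ℂ⟦X⟧} {p : ℂ⟦X⟧}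
    (hf : ∀ s n, s < n → coeff s (∑ k ∈ Finset.range n, f k) = coeff s p) :
    HasSum (fun k => fockMul (f k)) (fockMul p) := by
  refine hasSum_end_iff.mpr fun v s => ?_
  have h0 (i k : ℕ) (hik : i < k) : coeff i (f k) = 0 := by
    have h1 := hf i (k + 1) (by omega)
    rw [Finset.sum_range_succ, map_add, hf i k hik] at h1
    simpa using h1
  have e : fockMul p v s = ∑ k ∈ Finset.range (s + 1), fockMul (f k) v s := by
    simp only [fockMul_apply]
    rw [← Finset.mul_sum, ← map_sum, ← Finset.sum_mul]
    congr 1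
    exact coeff_mul_congr fun i hi => (hf i _ (by omega)).symm
  rw [e]
  refine hasSum_sum_of_ne_finset_zero fun k hk => ?_
  rw [fockMul_apply, coeff_mul_congr (q := 0) fun i hi => ?_]
  · simp
  · rw [h0 i k (by simp at hk; omega), map_zero]

/-! #### Exponentials of power series -/

/-- The partial sums of `e ^ p` satisfy the differential equation of the exponential up to a shift
of the index. -/
theorem derivative_exp_sum (p : ℂ⟦X⟧) (n : ℕ) :
    derivative ℂ (∑ k ∈ Finset.range (n + 1), ((k ! : ℂ)⁻¹) • p ^ k) =
      derivative ℂ p * ∑ k ∈ Finset.range n, ((k ! : ℂ)⁻¹) • p ^ k := by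
  rw [Finset.sum_range_succ', map_add, map_sum, Finset.mul_sum]
  simp only [pow_zero, Derivation.map_smul, Derivation.map_one_eq_zero, smul_zero, add_zero]
  refine Finset.sum_congr rfl fun k _ => ?_
  have hk : ((k + 1 : ℕ) : ℂ) ≠ 0 := Nat.cast_ne_zero.mpr k.succ_ne_zero
  rw [Derivation.leibniz_pow, Nat.add_sub_cancel, ← Nat.cast_smul_eq_nsmul ℂ, smul_smul,
    Nat.factorial_succ, Nat.cast_mul, mul_inv, mul_right_comm, inv_mul_cancel₀ hk, one_mul,
    mul_smul_comm, smul_eq_mul, mul_comm]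

/-- The exponential of `p` is the solution of `q' = p' q` with constant coefficient `1`. -/
theorem coeff_exp_sum {p q : ℂ⟦X⟧} (hp : constantCoeff p = 0) (hq : constantCoeff q = 1)
    (hd : derivative ℂ q = derivative ℂ p * q) (s n : ℕ) (hs : s < n) :
    coeff s (∑ k ∈ Finset.range n, ((k ! : ℂ)⁻¹) • p ^ k) = coeff s q := by
  induction s using Nat.strong_induction_on generalizing n with
  | _ s ih =>
    obtain ⟨n, rfl⟩ : ∃ m, n = m + 1 := ⟨n - 1, by omega⟩
    cases s with
    | zero =>
      rw [coeff_zero_eq_constantCoeff_apply, coeff_zero_eq_constantCoeff_apply, hq,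
        Finset.sum_range_succ']
      simp [hp]
    | succ s =>
      have h1 : coeff s (derivative ℂ (∑ k ∈ Finset.range (n + 1), ((k ! : ℂ)⁻¹) • p ^ k)) =
          coeff s (derivative ℂ q) := by
        rw [derivative_exp_sum, hd, mul_comm, mul_comm (derivative ℂ p)]
        exact coeff_mul_congr fun i hi => ih i (by omega) n (by omega)
      rw [coeff_derivative, coeff_derivative] at h1
      exact mul_right_cancel₀ (Nat.cast_add_one_ne_zero s) h1

theorem derivative_esd_sum (w : ℂ) (p : ℂ⟦X⟧) (n : ℕ) :
    derivative ℂ (∑ k ∈ Finset.range n, (w ^ k / ((k + 1)! : ℂ)) • p ^ (k + 1)) =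
      derivative ℂ p * ∑ k ∈ Finset.range n, ((k ! : ℂ)⁻¹) • (w • p) ^ k := by
  rw [map_sum, Finset.mul_sum]
  refine Finset.sum_congr rfl fun k _ => ?_
  have hk : ((k + 1 : ℕ) : ℂ) ≠ 0 := Nat.cast_ne_zero.mpr k.succ_ne_zero
  have e : w ^ k / ((k + 1)! : ℂ) * ((k + 1 : ℕ) : ℂ) = ((k ! : ℂ)⁻¹) * w ^ k := by
    rw [Nat.factorial_succ, Nat.cast_mul]
    field_simp
  rw [Derivation.map_smul, Derivation.leibniz_pow, Nat.add_sub_cancel,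
    ← Nat.cast_smul_eq_nsmul ℂ, smul_smul, e, smul_pow, smul_smul, mul_smul_comm, smul_eq_mul,
    mul_comm (p ^ k)]

/-- The series `(e ^ (w p) - 1) / w` is the solution `r` of `r' = p' e ^ (w p)` without constant
coefficient. -/
theorem coeff_esd_sum {w : ℂ} {p q r : ℂ⟦X⟧} (hp : constantCoeff p = 0) (hq : constantCoeff q = 1)
    (hd : derivative ℂ q = derivative ℂ (w • p) * q) (hr : constantCoeff r = 0)
    (hd' : derivative ℂ r = derivative ℂ p * q) (s n : ℕ) (hs : s < n) :
    coeff s (∑ k ∈ Finset.range n, (w ^ k / ((k + 1)! : ℂ)) • p ^ (k + 1)) = coeff s r := by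
  cases s with
  | zero =>
    rw [coeff_zero_eq_constantCoeff_apply, coeff_zero_eq_constantCoeff_apply, hr]
    simp [hp]
  | succ s =>
    have h1 : coeff s (derivative ℂ
        (∑ k ∈ Finset.range n, (w ^ k / ((k + 1)! : ℂ)) • p ^ (k + 1))) =
        coeff s (derivative ℂ r) := by
      rw [derivative_esd_sum, hd', mul_comm, mul_comm (derivative ℂ p)]
      exact coeff_mul_congr fun i hi => coeff_exp_sum (by simp [hp]) hq hd i n (by omega)
    rw [coeff_derivative, coeff_derivative] at h1
    exact mul_right_cancel₀ (Nat.cast_add_one_ne_zero s) h1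

theorem fexp_fockMul {p q : ℂ⟦X⟧} (hp : constantCoeff p = 0) (hq : constantCoeff q = 1)
    (hd : derivative ℂ q = derivative ℂ p * q) : fexp (fockMul p) = fockMul q := by
  refine HasSum.tsum_eq ?_
  simp only [fockMul_pow, smul_fockMul]
  exact hasSum_fockMul (coeff_exp_sum hp hq hd)

theorem expSubOneDiv_fockMul {w : ℂ} {p q r : ℂ⟦X⟧} (hp : constantCoeff p = 0)
    (hq : constantCoeff q = 1) (hd : derivative ℂ q = derivative ℂ (w • p) * q)
    (hr : constantCoeff r = 0) (hd' : derivative ℂ r = derivative ℂ p * q) :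
    expSubOneDiv w (fockMul p) = fockMul r := by
  refine HasSum.tsum_eq ?_
  simp only [fockMul_pow, smul_fockMul]
  exact hasSum_fockMul (coeff_esd_sum hp hq hd hr hd')

/-! #### The operators of the representations -/

variable (w γ : ℂ)

/-- The series `-log (1 - w γ X) / w` by which `A⁺` multiplies. -/
def serAp : ℂ⟦X⟧ := PowerSeries.mk fun i => w ^ (i - 1) / (i : ℂ) * γ ^ i

/-- The series `1 / (1 - w γ X)`, which is `e ^ (w A⁺)`. -/
def serGeom : ℂ⟦X⟧ := PowerSeries.mk fun i => (w * γ) ^ i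

theorem constantCoeff_serAp : constantCoeff (serAp w γ) = 0 := by
  rw [← coeff_zero_eq_constantCoeff_apply, serAp, coeff_mk]
  simp

theorem constantCoeff_serGeom : constantCoeff (serGeom w γ) = 1 := by
  rw [← coeff_zero_eq_constantCoeff_apply, serGeom, coeff_mk, pow_zero]

theorem serGeom_eq : serGeom w γ = 1 + (w * γ) • (X * serGeom w γ) := by
  ext i
  cases i with
  | zero => simp [serGeom]
  | succ i => 
    rw [map_add, map_smul, coeff_succ_X_mul, serGeom, coeff_mk, coeff_mk, coeff_one]
    simp [pow_succ']

theorem derivative_serAp : derivative ℂ (serAp w γ) = γ • serGeom w γ := by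
  ext i
  have hi : ((i : ℂ) + 1) ≠ 0 := Nat.cast_add_one_ne_zero i
  rw [coeff_derivative, map_smul, serAp, serGeom, coeff_mk, coeff_mk, Nat.add_sub_cancel]
  push_cast
  rw [smul_eq_mul, mul_pow, pow_succ]
  field_simp

theorem derivative_serGeom :
    derivative ℂ (serGeom w γ) = (w * γ) • (serGeom w γ * serGeom w γ) := by
  have h1 := congrArg (derivative ℂ) (serGeom_eq w γ)
  rw [map_add, Derivation.map_one_eq_zero, zero_add, Derivation.map_smul, Derivation.leibniz,
    derivative_X, smul_eq_mul, smul_eq_mul, mul_one] at h1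
  have h2 := serGeom_eq w γ
  set g := serGeom w γ
  set g' := derivative ℂ g
  simp only [smul_eq_C_mul] at *
  linear_combination g * h1 - g' * h2

theorem repAp_eq : repAp w γ = fockMul (serAp w γ) := by
  refine LinearMap.ext fun v => funext fun s => ?_
  rw [fockMul_apply, mul_comm (serAp w γ), coeff_mul,
    Finset.Nat.sum_antidiagonal_eq_sum_range_succ
      (fun r i => coeff r (fock v) * coeff i (serAp w γ)), Finset.sum_range_succ, Nat.sub_self,
    coeff_zero_eq_constantCoeff_apply (serAp w γ), constantCoeff_serAp, mul_zero, add_zero,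
    Finset.mul_sum]
  change ∑ r ∈ Finset.range s, w ^ (s - r - 1) / ((s - r : ℕ) : ℂ) * γ ^ (s - r) *
    (Real.sqrt ((s ! : ℝ) / (r ! : ℝ)) : ℂ) * v r = _
  refine Finset.sum_congr rfl fun r hr => ?_
  rw [coeff_fock, serAp, coeff_mk, Real.sqrt_div (by positivity), Complex.ofReal_div]
  rw [weight, weight]
  ring

theorem repA_eq : repA γ = fockEnd (γ • (derivative ℂ : ℂ⟦X⟧ →ₗ[ℂ] ℂ⟦X⟧)) := by
  refine LinearMap.ext fun v => funext fun s => ?_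
  have e : coeff (s + 1) (fock v) = v (s + 1) / weight (s + 1) := coeff_fock _ _
  have h1 : coeff s ((γ • (derivative ℂ : ℂ⟦X⟧ →ₗ[ℂ] ℂ⟦X⟧)) (fock v)) =
      γ * (v (s + 1) / weight (s + 1) * (s + 1)) := by
    rw [LinearMap.smul_apply, map_smul, smul_eq_mul, ← e]
    congr 1
    exact coeff_derivative _ _
  rw [fockEnd_apply, h1, weight_succ]
  have h2 : ((Real.sqrt ((s : ℝ) + 1) : ℝ) : ℂ) * (Real.sqrt ((s : ℝ) + 1) : ℂ) = s + 1 := by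
    rw [← Complex.ofReal_mul, Real.mul_self_sqrt (by positivity)]
    push_cast
    rfl
  have h3 : ((Real.sqrt ((s : ℝ) + 1) : ℝ) : ℂ) ≠ 0 := by
    rw [Complex.ofReal_ne_zero]; positivity
  have h4 := weight_ne_zero s
  show γ * (Real.sqrt ((s : ℝ) + 1) : ℂ) * v (s + 1) = _
  rw [← h2]
  field_simp

theorem repN_eq_fock (n : ℂ) : repN n =
    fockEnd (n • 1 + LinearMap.mulLeft ℂ X * (derivative ℂ : ℂ⟦X⟧ →ₗ[ℂ] ℂ⟦X⟧)) := by
  refine LinearMap.ext fun v => funext fun s => ?_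
  have e : coeff s (fock v) = v s / weight s := coeff_fock _ _
  have h1 : coeff s ((n • 1 + LinearMap.mulLeft ℂ X *
      (derivative ℂ : ℂ⟦X⟧ →ₗ[ℂ] ℂ⟦X⟧) : Module.End ℂ ℂ⟦X⟧) (fock v)) =
        (s + n) * (v s / weight s) := by
    rw [LinearMap.add_apply, map_add]
    have : coeff s (X * derivative ℂ (fock v)) = s * coeff s (fock v) := by
      cases s with
      | zero => simp
      | succ s => rw [coeff_succ_X_mul, coeff_derivative, mul_comm]; push_cast; rfl
    rw [← e, add_comm (s : ℂ), add_mul, ← this]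
    rfl
  rw [fockEnd_apply, h1, mul_left_comm, mul_div_cancel₀ _ (weight_ne_zero s)]
  rfl

theorem fexp_repAp : fexp (w • repAp w γ) = fockMul (serGeom w γ) := by
  rw [repAp_eq, smul_fockMul]
  refine fexp_fockMul (by simp [constantCoeff_serAp]) (constantCoeff_serGeom w γ) ?_
  rw [Derivation.map_smul, derivative_serAp, derivative_serGeom, smul_smul, smul_mul_assoc]

theorem expSubOneDiv_repAp :
    expSubOneDiv w (repAp w γ) = fockMul (γ • (X * serGeom w γ)) := by
  rw [repAp_eq]
  refine expSubOneDiv_fockMul (constantCoeff_serAp w γ) (constantCoeff_serGeom w γ) ?_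
    (by simp) ?_
  · rw [Derivation.map_smul, derivative_serAp, derivative_serGeom, smul_smul, smul_mul_assoc]
  · rw [Derivation.map_smul, Derivation.leibniz, derivative_X, derivative_serGeom,
      derivative_serAp]
    have h2 := serGeom_eq w γ
    set g := serGeom w γ
    simp only [smul_eq_C_mul, smul_eq_mul] at *
    linear_combination (-(C γ * g)) * h2

theorem oneSubExpNegDiv_repAp : oneSubExpNegDiv w (repAp w γ) = fockMul (γ • X) := by
  rw [repAp_eq, oneSubExpNegDiv]
  have h2 := serGeom_eq w γ
  refine expSubOneDiv_fockMul (q := 1 - (w * γ) • X) (constantCoeff_serAp w γ) (by simp) ?_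
    (by simp) ?_
  · rw [Derivation.map_smul, derivative_serAp, map_sub, Derivation.map_smul,
      Derivation.map_one_eq_zero, derivative_X]
    set g := serGeom w γ
    simp only [smul_eq_C_mul, map_mul, map_neg] at *
    linear_combination (C w * C γ) * h2
  · rw [Derivation.map_smul, derivative_serAp, derivative_X]
    set g := serGeom w γ
    simp only [smul_eq_C_mul, map_mul, map_neg] at *
    linear_combination (-C γ) * h2

end Representation

/-! ### The ribbon element in the representations -/

section RepresentationRibbon

open PowerSeries

variable {h w e n γ : ℂ}

theorem relations_rep (hγ : γ ^ 2 = sinhRatio h e) : Relations h w (rep w e n γ) where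
  comm_A_Ap := by
    show repA γ * repAp w γ - repAp w γ * repA γ = sinhDiv h (repE e) * fexp (w • repAp w γ)
    rw [fexp_repAp, sinhDiv_repE, ← hγ, repAp_eq, repA_eq, fockMul, fockMul, ← map_mul, ← map_mul,
      ← map_sub, smul_mul_assoc (γ ^ 2), one_mul, ← map_smul]
    congr 1
    refine LinearMap.ext fun V => ?_
    show γ • derivative ℂ (serAp w γ * V) - serAp w γ * (γ • derivative ℂ V) =
      γ ^ 2 • (serGeom w γ * V)
    rw [Derivation.leibniz, derivative_serAp]
    simp only [smul_eq_C_mul, smul_eq_mul, map_pow]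
    ring
  comm_N_Ap := by
    show repN n * repAp w γ - repAp w γ * repN n = expSubOneDiv w (repAp w γ)
    rw [expSubOneDiv_repAp, repAp_eq, repN_eq_fock, fockMul, fockMul, ← map_mul, ← map_mul,
      ← map_sub]
    congr 1
    refine LinearMap.ext fun V => ?_
    show n • (serAp w γ * V) + X * derivative ℂ (serAp w γ * V) -
      serAp w γ * (n • V + X * derivative ℂ V) = γ • (X * serGeom w γ) * V
    rw [Derivation.leibniz, derivative_serAp]
    simp only [smul_eq_C_mul, smul_eq_mul]
    ring
  comm_N_A := by
    refine LinearMap.ext fun v => funext fun s => ?_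
    show ((s : ℂ) + n) * (γ * (Real.sqrt ((s : ℝ) + 1) : ℂ) * v (s + 1)) -
      γ * (Real.sqrt ((s : ℝ) + 1) : ℂ) * (((s + 1 : ℕ) + n) * v (s + 1)) =
      -(γ * (Real.sqrt ((s : ℝ) + 1) : ℂ) * v (s + 1))
    push_cast
    ring
  comm_E g := by
    show (e • 1) * _ = _ * (e • 1)
    rw [smul_mul_assoc, mul_smul_comm, one_mul, mul_one]

/-- The series `(1 - e ^ (-w A⁺)) / w` acts by `|r⟩ ↦ γ √(r + 1) |r + 1⟩`, whatever `w` is. -/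
theorem fockMul_X_apply_succ (v : ℕ → ℂ) (s : ℕ) :
    fockMul (γ • X) v (s + 1) = γ * (Real.sqrt ((s : ℝ) + 1) : ℂ) * v s := by
  rw [fockMul_apply, smul_mul_assoc, map_smul, coeff_succ_X_mul, coeff_fock, weight_succ,
    smul_eq_mul]
  have := weight_ne_zero s
  field_simp

theorem fockMul_X_apply_zero (v : ℕ → ℂ) : fockMul (γ • X) v 0 = 0 := by
  rw [fockMul_apply, smul_mul_assoc, map_smul, coeff_zero_X_mul, smul_zero, mul_zero]

/-- On `|r⟩` the operator `x ^ l A ^ l` is `γ ^ (2 l)` times the descending factorial of `r`. -/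
theorem fockMul_X_pow_mul_repA_pow (l : ℕ) : fockMul (γ • X) ^ l * repA γ ^ l =
    diagOp fun r => (γ ^ 2) ^ l * (r.descFactorial l : ℂ) := by
  induction l with
  | zero => exact LinearMap.ext fun v => funext fun r => by simp
  | succ l ih =>
    rw [pow_succ', pow_succ, mul_assoc, ← mul_assoc (_ ^ l), ih]
    refine LinearMap.ext fun v => funext fun s => ?_
    rw [Module.End.mul_apply, Module.End.mul_apply]
    cases s with
    | zero => rw [fockMul_X_apply_zero]; simp
    | succ s =>
      have h2 : ((Real.sqrt ((s : ℝ) + 1) : ℝ) : ℂ) * (Real.sqrt ((s : ℝ) + 1) : ℂ) = s + 1 := by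
        rw [← Complex.ofReal_mul, Real.mul_self_sqrt (by positivity)]
        push_cast
        rfl
      rw [fockMul_X_apply_succ, diagOp_apply, diagOp_apply, Nat.succ_descFactorial_succ]
      show γ * _ * (_ * (γ * (Real.sqrt ((s : ℝ) + 1) : ℂ) * v (s + 1))) = _
      push_cast
      rw [← h2]
      ring

theorem hasSum_binomial (z : ℂ) (r : ℕ) :
    HasSum (fun l : ℕ => (r.choose l : ℂ) * z ^ l) ((1 + z) ^ r) := by
  have e : (1 + z) ^ r = ∑ l ∈ Finset.range (r + 1), (r.choose l : ℂ) * z ^ l := by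
    rw [add_comm, add_pow]
    refine Finset.sum_congr rfl fun l _ => ?_
    rw [one_pow, mul_one, mul_comm]
  rw [e]
  refine hasSum_sum_of_ne_finset_zero fun l hl => ?_
  rw [Nat.choose_eq_zero_of_lt (by simp at hl; omega), Nat.cast_zero, zero_mul]

theorem fexp_smul_repE (c : ℂ) : fexp (c • repE e) = diagOp fun _ => Complex.exp (c * e) := by
  rw [repE, smul_smul, smul_one_eq_diagOp, fexp_diagOp]

theorem fexp_smul_repE_mul_repN (c : ℂ) : fexp (c • (repE e * repN n)) =
    diagOp fun r => Complex.exp (c * (e * (r + n))) := by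
  rw [repE, smul_one_eq_diagOp, repN_eq, diagOp_mul, smul_diagOp, fexp_diagOp]
  rfl

/-- The series of the ribbon element acts by scalars: on `|r⟩` it is the binomial expansion of
`(1 + 2 σ γ ^ 2 e ^ (σ e)) ^ r = e ^ (2 σ e r)`. -/
theorem hasSum_theta_rep {σ : ℂ} (hσ : 1 + 2 * σ * γ ^ 2 * Complex.exp (σ * e) =
      Complex.exp (2 * σ * e)) :
    HasSum (fun l : ℕ => ((2 * σ) ^ l / (l ! : ℂ)) •
      (fexp ((σ * l) • repE e) * oneSubExpNegDiv w (repAp w γ) ^ l * repA γ ^ l *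
        fexp ((-(2 * σ)) • (repE e * repN n)))) (Complex.exp (-(2 * σ * e * n)) • 1) := by
  have e1 (l : ℕ) : ((2 * σ) ^ l / (l ! : ℂ)) •
      (fexp ((σ * l) • repE e) * oneSubExpNegDiv w (repAp w γ) ^ l * repA γ ^ l *
        fexp ((-(2 * σ)) • (repE e * repN n))) = diagOp fun r =>
      (r.choose l : ℂ) * (2 * σ * γ ^ 2 * Complex.exp (σ * e)) ^ l *
        Complex.exp (-(2 * σ) * (e * (r + n))) := by
    rw [oneSubExpNegDiv_repAp, mul_assoc (fexp _), fockMul_X_pow_mul_repA_pow, fexp_smul_repE,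
      fexp_smul_repE_mul_repN, diagOp_mul, diagOp_mul, smul_diagOp]
    congr 1
    funext r
    have hl : (l ! : ℂ) ≠ 0 := Nat.cast_ne_zero.mpr (Nat.factorial_ne_zero l)
    have h1 : Complex.exp (σ * l * e) = Complex.exp (σ * e) ^ l := by
      rw [← Complex.exp_nat_mul]; ring_nf
    simp only [Pi.smul_apply, Pi.mul_apply, smul_eq_mul]
    rw [Nat.descFactorial_eq_factorial_mul_choose, h1]
    push_cast
    field_simp
    ring
  simp only [e1]
  rw [smul_one_eq_diagOp]
  refine hasSum_diagOp fun r => ?_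
  have h2 := (hasSum_binomial (2 * σ * γ ^ 2 * Complex.exp (σ * e)) r).mul_right
    (Complex.exp (-(2 * σ) * (e * (r + n))))
  rw [hσ, ← Complex.exp_nat_mul, ← Complex.exp_add] at h2
  convert! h2 using 2
  ring

/-- The identity `1 + 2 h (sinh (h e) / h) e ^ (h e) = e ^ (2 h e)`, also for `h = 0`. -/
theorem sinhRatio_identity (hγ : γ ^ 2 = sinhRatio h e) :
    1 + 2 * h * γ ^ 2 * Complex.exp (h * e) = Complex.exp (2 * h * e) := by
  rw [hγ, sinhRatio]
  have h1 : Complex.exp (2 * h * e) = Complex.exp (h * e) * Complex.exp (h * e) := by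
    rw [← Complex.exp_add]; ring_nf
  have h2 : Complex.exp (-(h * e)) * Complex.exp (h * e) = 1 := by
    rw [← Complex.exp_add]; simp
  split_ifs with hh
  · subst hh
    simp
  · rw [h1, Complex.sinh]
    field_simp
    linear_combination -h2

theorem sinhRatio_neg : sinhRatio (-h) e = sinhRatio h e := by
  simp only [sinhRatio, neg_eq_zero, neg_mul, Complex.sinh_neg, neg_div_neg_eq]

theorem neg_smul_end (c : ℂ) (f : Module.End ℂ (ℕ → ℂ)) : -(c • f) = (-c) • f :=
  (neg_smul c f).symm

theorem isTheta_rep (hγ : γ ^ 2 = sinhRatio h e) :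
    IsTheta h w (rep w e n γ) (Complex.exp ((2 * n - 1) * h * e) • 1) := by
  have h1 := hasSum_theta_rep (w := w) (n := n)
    (sinhRatio_identity (h := -h) (hγ.trans sinhRatio_neg.symm))
  refine ⟨_, h1.congr_fun fun l => ?_, ?_⟩
  · show _ • (fexp (-((h * l) • repE e)) * oneSubExpNegDiv w (repAp w γ) ^ l * repA γ ^ l *
      fexp ((2 * h) • (repE e * repN n))) = _
    rw [neg_smul_end, neg_mul, mul_neg, neg_neg, neg_pow (2 * h)]
  · show _ = fexp (-(h • repE e)) * _
    rw [neg_smul_end, fexp_smul_repE, smul_one_eq_diagOp, smul_one_eq_diagOp, diagOp_mul]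
    congr 1
    funext r
    rw [Pi.mul_apply, ← Complex.exp_add]
    congr 1
    ring

theorem isThetaInv_rep (hγ : γ ^ 2 = sinhRatio h e) :
    IsThetaInv h w (rep w e n γ) (Complex.exp (-((2 * n - 1) * h * e)) • 1) := by
  have h1 := hasSum_theta_rep (w := w) (n := n) (sinhRatio_identity hγ)
  refine ⟨_, h1.congr_fun fun l => ?_, ?_⟩
  · show _ • (fexp ((h * l) • repE e) * oneSubExpNegDiv w (repAp w γ) ^ l * repA γ ^ l *
      fexp (-((2 * h) • (repE e * repN n)))) = _
    rw [neg_smul_end]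
  · show _ = fexp (h • repE e) * _
    rw [fexp_smul_repE, smul_one_eq_diagOp, smul_one_eq_diagOp, diagOp_mul]
    congr 1
    funext r
    rw [Pi.mul_apply, ← Complex.exp_add]
    congr 1
    ring

end RepresentationRibbon

end

end HeisenbergDeformation

theorem proposition10 (h w : ℂ) :
    HeisenbergDeformation.Relations h w (HeisenbergDeformation.gen h w) ∧
    (∃ (H : HeisenbergDeformation.CompleteHopf (HeisenbergDeformation.Uhw h w))
        (θ θinv : (HeisenbergDeformation.Uhw h w).Lim),
      HeisenbergDeformation.IsUhwHopf h w H ∧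
      HeisenbergDeformation.IsTheta h w (HeisenbergDeformation.gen h w) θ ∧
      HeisenbergDeformation.IsThetaInv h w (HeisenbergDeformation.gen h w) θinv ∧
      θ * θinv = 1 ∧ θinv * θ = 1 ∧
      H.IsRibbon (HeisenbergDeformation.Rhw h w) θ) ∧
    (∀ e n γ : ℂ, γ ^ 2 = HeisenbergDeformation.sinhRatio h e →
      HeisenbergDeformation.Relations h w (HeisenbergDeformation.rep w e n γ) ∧
      HeisenbergDeformation.IsTheta h w (HeisenbergDeformation.rep w e n γ)
        (Complex.exp ((2 * n - 1) * h * e) • 1) ∧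
      HeisenbergDeformation.IsThetaInv h w (HeisenbergDeformation.rep w e n γ)
        (Complex.exp (-((2 * n - 1) * h * e)) • 1)) := by
  open HeisenbergDeformation in
  exact ⟨relations_gen h w,
    ⟨uhwHopf h w, limTheta h w (-h), limTheta h w h, isUhwHopf h w, isTheta_limTheta h w,
      isThetaInv_limTheta h w, limTheta_neg_mul_limTheta h w, limTheta_mul_limTheta_neg h w,
      isRibbon h w⟩,
    fun _ _ _ hγ => ⟨relations_rep hγ, isTheta_rep hγ, isThetaInv_rep hγ⟩⟩
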